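/- Let $f(x)=\log(1+|x|)$, applied entrywise. For $A\in\mathbb{R}^{n\times n}$, $A\neq 0$, let $A_i$ be its $i$-th column and $M=\|f(A)\|_F^2=\sum_i\|f(A_i)\|_2^2$. **Heavy hitter structure** $\mathcal{D}$ with parameters $(\nu,\phi,\delta)$, applied to a set $S\subseteq[n]$ of columns. Put $w=\lceil c_w/(\phi^2\nu^3)\rceil$ and $R=\max(1,\lceil c_R\log(n/\delta)\rceil)$. For each $r\in[R]$ take a (uniform) pairwise independent hash function $h_r:[n]\to[w]$ and 4-wise independent uniform signs $\epsilon^{(r)}_i\in\{-1,1\}$, and store $H^{(r)}_v=\sum_{i\in S,\,h_r(i)=v}\epsilon^{(r)}_iA_i$ for $v\in[w]$. All these hash functions and sign families are mutually independent. $\mathrm{Query}(i)$ returns the vector $v_{r^*}$, where $v_r=H^{(r)}_{h_r(i)}$ and $r^*$ is the index of the median of $\{\|f(v_r)\|_2\}_{r\in[R]}$. Write $\lambda_i=\|f(\mathrm{Query}(i))\|_2^2$. **Sampler.** Input: $A$, $\epsilon>0$, $K\ge 1$ and a number $\widehat M$ with $M\le\widehat M\le KM$. Put $L=\lceil\log_2(Kn/\epsilon)\rceil$,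 $\hat L=\lceil\log_2 n\rceil$, $j_0=\lceil\log_2(4K\epsilon^{-3}L^3)\rceil$. 1. Draw $\zeta$ uniformly from $[1/2,1]$. For each $\ell=0,\dots,\hat L$ let every column survive at level $\ell$ with probability $2^{-\ell}$; the vectors of survival indicators (over all levels) of different columns are independent. Let $\mathcal{D}_\ell$ be a heavy hitter structure applied to the columns that survive at level $\ell$, with parameters $\nu$, $\delta=1/(\hat L+1)$, and $\phi=c_\phi\epsilon^3/L^3$ if $\ell\ge1$, $\phi=c_\phi\epsilon^3/(KL^3)$ if $\ell=0$. The variable $\zeta$, the subsampling of each column, and all hash functions and sign families are mutually independent. 2. Let $\Lambda_\ell$ consist of the $\lceil c_\Lambda L^3/\epsilon^3\rceil$ surviving columns at level $\ell$ with the largest values $\lambda_i$ in $\mathcal{D}_\ell$ (all of them, if there are fewer). 3. For $j=0,\dots,L$ let $B_{\ell,j}$ be the set of elements of $\Lambda_\ell$ with $\lambda_i\in[(1+\epsilon)\zeta\widehat M/2^j,\,(2-\epsilon)\zeta\widehat M/2^j]$. If $j\le j_0$, put $\ell(j)=0$. If $j>j_0$, let $\ell(j)$ be the largest $\ell$ with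 $(1-\sqrt{20}\,\epsilon)L^2/\epsilon^2\le|B_{\ell,j}|\le 2(1+\sqrt{20}\,\epsilon)L^2/\epsilon^2$. If $\ell(j)$ exists, put $W_j=B_{\ell(j),j}$, let $\lambda^{(j)}_i$ $(i\in W_j)$ be the values in $\mathcal{D}_{\ell(j)}$, and put $\widetilde M_j=2^{\ell(j)}\sum_{i\in W_j}\lambda^{(j)}_i$; otherwise put $\widetilde M_j=0$. 4. Draw $j^*\in\{0,\dots,L\}$ with $\Pr\{j^*=j\}=\widetilde M_j/\sum_{j'}\widetilde M_{j'}$, then draw $i^*\in W_{j^*}$ with $\Pr\{i^*=i\}=\lambda^{(j^*)}_i/\sum_{i'\in W_{j^*}}\lambda^{(j^*)}_{i'}$, and output the vector $v$ returned by $\mathrm{Query}(i^*)$ on $\mathcal{D}_{\ell(j^*)}$. (If all $\widetilde M_j$ vanish, the sampler fails.) **Theorem.** There are absolute constants $\epsilon_0>0$, $c\in(0,1/2]$, $C>0$ and $c_w,c_R,c_\phi,\nu>0$, and for every $K\ge1$ a constant $c_\Lambda>0$ depending only on $K$, such that the following holds for all $n$, all nonzero $A\in\mathbb{R}^{n\times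 n}$, all $0<\epsilon\le\epsilon_0$ and all $\widehat M$ with $M\le\widehat M\le KM$. Say that the sampler samples $u\in[n]$ if it does not fail, $i^*=u$, and its output $v$ satisfies $$(1-C\epsilon)\|f(A_u)\|_2^2\le\|f(v)\|_2^2\le(1+C\epsilon)\|f(A_u)\|_2^2 .$$ Then with probability at least $0.9$ the sampler samples some $u\in[n]$. Moreover, there is a set $I\subseteq[n]$ with $\sum_{i\in I}\|f(A_i)\|_2^2\ge(1-6\epsilon)M$ such that for all $i\in I$ $$\Pr\{\text{the sampler samples } i\}\ \ge\ c\,\frac{\|f(A_i)\|_2^2}{\|f(A)\|_F^2}.$$ -/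

import Mathlib

open MeasureTheory ProbabilityTheory

noncomputable section

namespace HSketch

/-- The entrywise transformation `f(x) = log (1 + |x|)`. -/
def f (x : ℝ) : ℝ := Real.log (1 + |x|)

/-- `‖f(x)‖₂²` for a vector `x`, with `f` applied entrywise. -/
def energy {n : ℕ} (x : Fin n → ℝ) : ℝ := ∑ k, f (x k) ^ 2

/-- The column `A_i` of `A`. -/
def col {n : ℕ} (A : Matrix (Fin n) (Fin n) ℝ) (i : Fin n) : Fin n → ℝ := fun k => A k i

/-- `M = ‖f(A)‖_F²`. -/
def totalEnergy {n : ℕ} (A : Matrix (Fin n) (Fin n) ℝ) : ℝ := ∑ i, energy (col A i)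

/-- The parameters of one call of the sampler on an `n × n` matrix: the approximation factor `K` of
the estimate `Mhat` of `M`, the accuracy `ε`, and the constants hidden in the asymptotic notation of
the algorithm (`w = O(1/(φ²ν³))`, `R = O(log (n/δ))`, `φ = O(ε³/L³)`, `ν = O(1)`, and the
`Θ(L³/ε³)` heavy hitters kept from every structure). -/
structure Params (n : ℕ) where
  K : ℝ
  ε : ℝ
  Mhat : ℝ
  cw : ℝ
  cR : ℝ
  cφ : ℝ
  ν : ℝ
  cList : ℝ

namespace Params

variable {n : ℕ} (P : Params n)

/-- The last magnitude level `L = log (K n / ε)`. -/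
def L : ℕ := ⌈Real.logb 2 (P.K * n / P.ε)⌉₊

/-- The last subsampling level, `log n`. -/
def Lhat (_P : Params n) : ℕ := ⌈Real.logb 2 n⌉₊

/-- The threshold `j₀ = log (4 K ε⁻³ L³)`. -/
def j0 : ℕ := ⌈Real.logb 2 (4 * P.K * (P.L : ℝ) ^ 3 / P.ε ^ 3)⌉₊

/-- The failure parameter of every heavy hitter structure. -/
def δ : ℝ := 1 / (P.Lhat + 1)

/-- The heaviness parameter of the structure of subsampling level `l`. -/
def φ (l : ℕ) : ℝ :=
  if l = 0 then P.cφ * P.ε ^ 3 / (P.K * (P.L : ℝ) ^ 3) else P.cφ * P.ε ^ 3 / (P.L : ℝ) ^ 3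

/-- The number of buckets of a basic substructure of subsampling level `l`. -/
def w (l : ℕ) : ℕ := ⌈P.cw / (P.φ l ^ 2 * P.ν ^ 3)⌉₊

/-- The number of repetitions in a complete structure (at least one). -/
def R : ℕ := max 1 ⌈P.cR * Real.log (n / P.δ)⌉₊

/-- The number of heavy hitters kept from a complete structure. -/
def listSize : ℕ := ⌈P.cList * (P.L : ℝ) ^ 3 / P.ε ^ 3⌉₊

end Params

/-- All random choices made before the final draw: the scale `ζ`; which columns survive in the
subsample of each level; the hash function and the signs of each repetition at each level. -/
structure Seed {n : ℕ} (P : Params n) where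
  ζ : ℝ
  keep : Fin (P.Lhat + 1) → Fin n → Bool
  hash : (l : Fin (P.Lhat + 1)) → Fin P.R → Fin n → Fin (P.w l)
  sign : Fin (P.Lhat + 1) → Fin P.R → Fin n → ℤˣ

/-- The index at which a finite family of reals attains its median: the index in position
`⌊R/2⌋` (counted from `0`) when the family is sorted in increasing order. -/
def medianIndex {R : ℕ} (hR : 0 < R) (x : Fin R → ℝ) : Fin R :=
  Tuple.sort x ⟨R / 2, Nat.div_lt_self hR one_lt_two⟩

namespace Seed

variable {n : ℕ} {P : Params n} (s : Seed P) (A : Matrix (Fin n) (Fin n) ℝ)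

/-- Bucket `v` of the hash table of repetition `r` in the structure `𝓓_l`, which is applied to the
columns of `A` that survive at level `l`: the sum of `ε_i A_i` over surviving `i ∈ h⁻¹(v)`. -/
def bucket (l : Fin (P.Lhat + 1)) (r : Fin P.R) (v : Fin (P.w l)) : Fin n → ℝ :=
  fun k => ∑ i with s.keep l i = true ∧ s.hash l r i = v, ((s.sign l r i : ℤ) : ℝ) * A k i

/-- The vector `v_r` looked up by repetition `r` of `𝓓_l` for the index `i`. -/
def lookup (l : Fin (P.Lhat + 1)) (i : Fin n) (r : Fin P.R) : Fin n → ℝ :=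
  s.bucket A l r (s.hash l r i)

/-- `Query(i)` on `𝓓_l`. The median of the squared norms is attained at the same index as the
median of the norms. -/
def query (l : Fin (P.Lhat + 1)) (i : Fin n) : Fin n → ℝ :=
  s.lookup A l i
    (medianIndex (lt_of_lt_of_le Nat.one_pos (le_max_left 1 _)) fun r => energy (s.lookup A l i r))

/-- The estimate `λ_i = ‖f(Query(i))‖₂²` of `‖f(A_i)‖₂²` by `𝓓_l`. -/
def est (l : Fin (P.Lhat + 1)) (i : Fin n) : ℝ := energy (s.query A l i)

open Classical in
/-- `Λ_l`: the `listSize` surviving columns at level `l` with the largest estimates (all surviving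
columns if there are fewer), ties being broken in favour of the smaller index. -/
def heavy (l : Fin (P.Lhat + 1)) : Finset (Fin n) :=
  {i | s.keep l i = true ∧
    (Finset.univ.filter fun k => s.keep l k = true ∧
      (s.est A l i < s.est A l k ∨ (s.est A l k = s.est A l i ∧ k < i))).card < P.listSize}

open Classical in
/-- The elements of `Λ_l` whose estimate lies in
`[(1 + ε) ζ Mhat / 2^j, (2 - ε) ζ Mhat / 2^j]`. -/
def band (l : Fin (P.Lhat + 1)) (j : ℕ) : Finset (Fin n) :=
  {i ∈ s.heavy A l | (1 + P.ε) * s.ζ * P.Mhat / 2 ^ j ≤ s.est A l i ∧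
    s.est A l i ≤ (2 - P.ε) * s.ζ * P.Mhat / 2 ^ j}

/-- The number of elements of `Λ_l` in the `j`-th band is in the range that makes subsampling level
`l` usable for magnitude level `j`. -/
def InRange (j : ℕ) (l : Fin (P.Lhat + 1)) : Prop :=
  (1 - √20 * P.ε) * (P.L : ℝ) ^ 2 / P.ε ^ 2 ≤ ((s.band A l j).card : ℝ) ∧
    ((s.band A l j).card : ℝ) ≤ 2 * (1 + √20 * P.ε) * (P.L : ℝ) ^ 2 / P.ε ^ 2

open Classical in
/-- The subsampling level used for magnitude level `j`: level `0` if `j ≤ j₀`, and otherwise the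
largest usable level, if there is one. -/
def usedLevel (j : ℕ) : Option (Fin (P.Lhat + 1)) :=
  if j ≤ P.j0 then some 0
  else if h : (Finset.univ.filter fun l => s.InRange A j l).Nonempty then some (Finset.max' _ h)
  else none

/-- `W_j`: the columns recovered for magnitude level `j`. -/
def recovered (j : ℕ) : Finset (Fin n) :=
  match s.usedLevel A j with
  | some l => s.band A l j
  | none => ∅

/-- The estimate `λ_i^{(j)}` of the column `i` in the structure used for magnitude level `j`. -/
def levelEst (j : ℕ) (i : Fin n) : ℝ :=
  match s.usedLevel A j with
  | some l => s.est A l i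
  | none => 0

/-- The vector returned by `Query(i)` on the structure used for magnitude level `j`. -/
def levelQuery (j : ℕ) (i : Fin n) : Fin n → ℝ :=
  match s.usedLevel A j with
  | some l => s.query A l i
  | none => 0

/-- The estimated contribution `M̃_j` of magnitude level `j`. -/
def mTilde (j : ℕ) : ℝ :=
  match s.usedLevel A j with
  | some l => (∑ i ∈ s.band A l j, s.est A l i) * 2 ^ (l : ℕ)
  | none => 0

open Classical in
/-- The probability, given the seed, that the final draw is `(j*, i*) = (j, i)`: the level `j` is
drawn with probability `M̃_j / ∑ M̃`, and then `i` is drawn from `W_j` with probability proportional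
to its estimate. All these numbers are `0` if all `M̃_j` vanish, and then the sampler fails. -/
def drawProb (j : Fin (P.L + 1)) (i : Fin n) : ℝ :=
  if i ∈ s.recovered A j then
    s.mTilde A j / (∑ j' : Fin (P.L + 1), s.mTilde A j') *
      (s.levelEst A j i / ∑ i' ∈ s.recovered A j, s.levelEst A j i')
  else 0

end Seed

/-- `X` is a `k`-wise independent family, indexed by `ι`, of uniform random elements of `β`. -/
def KWiseUniform {Ω : Type*} [MeasurableSpace Ω] (μ : Measure Ω) (k : ℕ) {ι β : Type*} [Fintype β]
    (X : Ω → ι → β) : Prop :=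
  ∀ t : Finset ι, t.card ≤ k → ∀ g : ι → β,
    μ.real {ω | ∀ i ∈ t, X ω i = g i} = (1 / (Fintype.card β : ℝ)) ^ t.card

/-- Names of the independent components of a seed. -/
inductive Component {n : ℕ} (P : Params n) : Type
  | scale
  | column (i : Fin n)
  | hash (l : Fin (P.Lhat + 1)) (r : Fin P.R)
  | sign (l : Fin (P.Lhat + 1)) (r : Fin P.R)

/-- The σ-algebra generated by one component of a random seed. The component of a column consists
of its survival indicators at all levels; nothing is prescribed about their joint law, so the
subsamples may be nested or independent. -/
@[reducible] def Component.sigma {n : ℕ} {P : Params n} {Ω : Type*} (seed : Ω → Seed P) :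
    Component P → MeasurableSpace Ω
  | .scale => MeasurableSpace.comap (fun ω => (seed ω).ζ) (borel ℝ)
  | .column i => MeasurableSpace.comap (fun ω l => (seed ω).keep l i) ⊤
  | .hash l r => MeasurableSpace.comap (fun ω => (seed ω).hash l r) ⊤
  | .sign l r => MeasurableSpace.comap (fun ω => (seed ω).sign l r) ⊤

/-- The random variables `seed` and `draw` describe a run of the sampler with parameters `P` on the
matrix `A`. The value `none` of `draw` means that there was nothing to draw from. -/
structure IsRun {n : ℕ} (P : Params n) (A : Matrix (Fin n) (Fin n) ℝ) {Ω : Type*}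
    [MeasurableSpace Ω] (μ : Measure Ω) (seed : Ω → Seed P)
    (draw : Ω → Option (Fin (P.L + 1) × Fin n)) : Prop where
  measurable_seed : ∀ k : Component P, k.sigma seed ≤ ‹MeasurableSpace Ω›
  measurable_draw : ∀ o, MeasurableSet {ω | draw ω = o}
  indep : iIndep (Component.sigma seed) μ
  scale_uniform : pdf.IsUniform (fun ω => (seed ω).ζ) (Set.Icc (1 / 2 : ℝ) 1) μ
  keep_rate : ∀ l i, μ.real {ω | (seed ω).keep l i = true} = (1 / 2 : ℝ) ^ (l : ℕ)
  hash_pairwise : ∀ l r, KWiseUniform μ 2 fun ω => (seed ω).hash l r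
  sign_fourwise : ∀ l r, KWiseUniform μ 4 fun ω => (seed ω).sign l r
  draw_law : ∀ (j : Fin (P.L + 1)) (i : Fin n),
    μ⟦{ω | draw ω = some (j, i)} | ⨆ k, Component.sigma seed k⟧
      =ᵐ[μ] fun ω => (seed ω).drawProb A j i

/-- In a run with seed `s` and final draw `o`, the drawn column index is `u`, and the returned
vector `v` satisfies `(1 - η) ‖f(A_u)‖₂² ≤ ‖f(v)‖₂² ≤ (1 + η) ‖f(A_u)‖₂²`. -/
def Samples {n : ℕ} {P : Params n} (A : Matrix (Fin n) (Fin n) ℝ) (s : Seed P)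
    (o : Option (Fin (P.L + 1) × Fin n)) (η : ℝ) (u : Fin n) : Prop :=
  ∃ j : Fin (P.L + 1), o = some (j, u) ∧
    (1 - η) * energy (col A u) ≤ energy (s.levelQuery A j u) ∧
    energy (s.levelQuery A j u) ≤ (1 + η) * energy (col A u)

end HSketch

end

noncomputable section
set_option linter.unusedSectionVars false

namespace HSketch

/-! ### The transformation `f` and the energy -/

/-! Accuracy of the estimates. `f` is even and subadditive, so `√energy` obeys a triangle inequality
and a lookup differs from its column, in `√energy`, by at most the `√energy` of the noise in the
bucket. Moreover `f(x)²` is a concave function of `x²` vanishing at `0`; Jensen's inequality over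
the signs and subadditivity bound the expected noise energy by `1/w` times the surviving energy
(`integral_noise_le`). Markov's inequality, the median over repetitions and a union bound make all
estimates at all levels accurate up to the thresholds `tauSq` (`IsRun.measure_someNoisy_le`,
`abs_sqrt_est_sub_le`).

Recovery of magnitude levels. A band is sandwiched between the survivors of `inner` and those of
`outer`, two versions of the magnitude level that differ by a tiny `slack` at the ends. Call a level
usable if it carries an `ε/(2L)` share of the energy and `inner` is nearly all of `outer`. A usable
level beyond `j0` has many columns, hence a critical subsampling level `ℓ` at which about `T =
L²/ε²` of them survive. By Chebyshev's inequality the level actually used is `ℓ` or `ℓ - 1`, so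
`mTilde` is at least a constant times the energy of the level (`Usable.le_mTilde`). Levels that are
not usable cannot do harm: `mTilde` is at most a constant times the energy, or negligible when the
noise is not resolved (`mTilde_le_of_clean`, `mTilde_le_of_not_clean`). So the `mTilde` add up to a
constant times `M`. Almost all of the drawing mass is accurate (`le_sum_accDraw`), and a column
recovered at level `l` is drawn with probability at least `2^l ‖f(A_i)‖² / (18 M)` (`le_accDraw`).

Dependence between survival and choice of level. It remains to see that column `i` survives at the
level used with probability of order `2^-ℓ`. The choice between `ℓ` and `ℓ - 1` depends on whether
`i` itself survives, so the two events cannot simply be multiplied. Instead the usability of `ℓ` is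
evaluated with `i` deleted from level `ℓ`, which is independent of `i`; putting `i` back can only
help unless noise or a bucket collision intervenes. Whatever the probability `v` of the modified
event, the two cases contribute about `v` and `1 - v` times `2^-ℓ`
(`IsRun.le_measure_keep_usedLevel`). For this reason all concentration bounds are proved relative to
an arbitrary event about the survival of one column.

The random scale. Columns are lost if they are tiny, lie in a level of little energy, or are
irregular: near the end of a level, or in a level with many columns near an end. The number of
columns up to an end is monotone in the scale, and a bounded monotone function rarely jumps over
short intervals; applied to its logarithm this makes irregularity unlikely for each column
(`scaleLaw_real_irregular_le`). Averaging over columns, most scales have most energy in good columns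
(`le_scaleLaw_real_goodCols`), and the columns good for half of the scales carry all but `6ε` of the
energy (`exists_frequently_good`). As the scale is independent of the rest of the seed, integrating
the bounds for fixed scale gives both claims (`IsRun.integral_seed`). -/

lemma f_nonneg (x : ℝ) : 0 ≤ f x := Real.log_nonneg (by linarith [abs_nonneg x])

@[simp] lemma f_neg (x : ℝ) : f (-x) = f x := by simp [f]

lemma f_pos {x : ℝ} (hx : x ≠ 0) : 0 < f x := Real.log_pos (by linarith [abs_pos.mpr hx])

lemma f_add_le (x y : ℝ) : f (x + y) ≤ f x + f y := by
  unfold f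
  rw [← Real.log_mul (by positivity) (by positivity)]
  apply Real.log_le_log (by positivity)
  nlinarith [abs_add_le x y, mul_nonneg (abs_nonneg x) (abs_nonneg y)]

lemma energy_nonneg {n : ℕ} (x : Fin n → ℝ) : 0 ≤ energy x :=
  Finset.sum_nonneg fun _ _ => sq_nonneg _

lemma energy_neg {n : ℕ} (x : Fin n → ℝ) : energy (-x) = energy x := by simp [energy]

lemma energy_unit_smul {n : ℕ} (u : ℤˣ) (x : Fin n → ℝ) :
    energy (fun k => ((u : ℤ) : ℝ) * x k) = energy x := by
  rcases Int.units_eq_one_or u with rfl | rfl <;> simp [energy]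

lemma sqrt_energy_eq_norm {n : ℕ} (x : Fin n → ℝ) :
    √(energy x) = ‖WithLp.toLp 2 (fun k => f (x k))‖ := by
  simp [EuclideanSpace.norm_eq, energy]

lemma sqrt_energy_add_le {n : ℕ} (x y : Fin n → ℝ) :
    √(energy (x + y)) ≤ √(energy x) + √(energy y) := by
  rw [sqrt_energy_eq_norm x, sqrt_energy_eq_norm y]
  refine le_trans ?_ (norm_add_le _ _)
  rw [EuclideanSpace.norm_eq]
  apply Real.sqrt_le_sqrt
  apply Finset.sum_le_sum
  intro k _
  simp only [PiLp.add_apply, Pi.add_apply, Real.norm_eq_abs, sq_abs]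
  exact pow_le_pow_left₀ (f_nonneg _) (f_add_le _ _) 2

lemma abs_sqrt_energy_add_sub_le {n : ℕ} (x y : Fin n → ℝ) :
    |√(energy (x + y)) - √(energy x)| ≤ √(energy y) := by
  rw [abs_le]
  constructor
  · have h := sqrt_energy_add_le (x + y) (-y)
    rw [add_neg_cancel_right, energy_neg] at h
    linarith
  · linarith [sqrt_energy_add_le x y]

/-- The concave function `g` with `g (x²) = f(x)²`. -/
def logSq (y : ℝ) : ℝ := Real.log (1 + √y) ^ 2

lemma f_sq (x : ℝ) : f x ^ 2 = logSq (x ^ 2) := by simp [f, logSq, Real.sqrt_sq_eq_abs]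

lemma logSq_nonneg (y : ℝ) : 0 ≤ logSq y := sq_nonneg _

lemma continuous_logSq : Continuous logSq := by
  unfold logSq
  refine (Continuous.log (by fun_prop) fun y => ?_).pow 2
  positivity

/-- This is the slope of the chord of the concave function `log` from `1` to `1 + u`. -/
lemma antitoneOn_log_one_add_div : AntitoneOn (fun u : ℝ => Real.log (1 + u) / u) (Set.Ioi 0) := by
  intro u hu v hv huv
  have hu : 0 < u := hu
  have hv : 0 < v := hv
  have hc : (1 - u / v) • Real.log 1 + (u / v) • Real.log (1 + v) ≤
      Real.log ((1 - u / v) • 1 + (u / v) • (1 + v)) :=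
    strictConcaveOn_log_Ioi.concaveOn.2 (by simp) (by simp; linarith)
      (by rw [sub_nonneg, div_le_one hv]; exact huv) (by positivity) (by ring)
  simp only [smul_eq_mul, Real.log_one, mul_zero, zero_add, mul_one] at hc
  have e : 1 - u / v + u / v * (1 + v) = 1 + u := by field_simp; ring
  rw [e] at hc
  simp only
  rw [div_le_div_iff₀ hv hu]
  have : u / v * Real.log (1 + v) * v = Real.log (1 + v) * u := by field_simp
  nlinarith

lemma hasDerivAt_logSq {y : ℝ} (hy : 0 < y) :
    HasDerivAt logSq (Real.log (1 + √y) / √y * (1 + √y)⁻¹) y := by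
  have hs : 0 < √y := Real.sqrt_pos.mpr hy
  have h1 := ((Real.hasDerivAt_sqrt hy.ne').const_add 1).log (by positivity)
  refine (h1.pow 2).congr_deriv ?_
  simp
  field_simp

/-- The derivative is a product of two nonnegative decreasing functions of `√y`. -/
lemma concaveOn_logSq : ConcaveOn ℝ (Set.Ici 0) logSq := by
  refine AntitoneOn.concaveOn_of_deriv (convex_Ici 0) continuous_logSq.continuousOn ?_ ?_
  · rw [interior_Ici]
    exact fun y hy => (hasDerivAt_logSq hy).differentiableAt.differentiableWithinAt
  · rw [interior_Ici]
    intro x hx y hy hxy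
    have hx' : 0 < √x := Real.sqrt_pos.mpr hx
    have hy' : 0 < √y := Real.sqrt_pos.mpr hy
    have hs : √x ≤ √y := Real.sqrt_le_sqrt hxy
    rw [(hasDerivAt_logSq hx).deriv, (hasDerivAt_logSq hy).deriv]
    refine mul_le_mul (antitoneOn_log_one_add_div hx' hy' hs) ?_ (by positivity) ?_
    · exact inv_anti₀ (by positivity) (by linarith)
    · exact div_nonneg (Real.log_nonneg (by linarith)) hx'.le

/-- Concavity together with the value `0` at `0` gives each part `t` of `x + y` at least the share
`t / (x + y)` of `logSq (x + y)`. -/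
lemma logSq_add_le {x y : ℝ} (hx : 0 ≤ x) (hy : 0 ≤ y) : logSq (x + y) ≤ logSq x + logSq y := by
  rcases hx.eq_or_lt with rfl | hx'
  · simp [logSq_nonneg]
  have hs : 0 < x + y := by linarith
  have key : ∀ t, 0 ≤ t → t ≤ x + y → t / (x + y) * logSq (x + y) ≤ logSq t := by
    intro t ht hts
    have hc : (1 - t / (x + y)) • logSq 0 + (t / (x + y)) • logSq (x + y) ≤
        logSq ((1 - t / (x + y)) • 0 + (t / (x + y)) • (x + y)) :=
      concaveOn_logSq.2 (by simp) (by simpa using hs.le)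
        (by rw [sub_nonneg, div_le_one hs]; exact hts) (by positivity) (by ring)
    simp only [smul_eq_mul, mul_zero, zero_add] at hc
    rw [div_mul_cancel₀ _ hs.ne'] at hc
    have : logSq 0 = 0 := by simp [logSq]
    rw [this] at hc
    linarith
  have h1 := key x hx (by linarith)
  have h2 := key y hy (by linarith)
  have : x / (x + y) * logSq (x + y) + y / (x + y) * logSq (x + y) = logSq (x + y) := by
    field_simp
  linarith

lemma logSq_sum_le {ι : Type*} (s : Finset ι) (x : ι → ℝ) (hx : ∀ i ∈ s, 0 ≤ x i) :
    logSq (∑ i ∈ s, x i) ≤ ∑ i ∈ s, logSq (x i) := by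
  classical
  induction s using Finset.induction_on with
  | empty => simp [logSq]
  | insert a s ha ih =>
    rw [Finset.sum_insert ha, Finset.sum_insert ha]
    have h1 := ih fun i hi => hx i (Finset.mem_insert_of_mem hi)
    have h2 := logSq_add_le (hx a (Finset.mem_insert_self a s))
      (Finset.sum_nonneg fun i hi => hx i (Finset.mem_insert_of_mem hi))
    linarith

/-! ### Finitely valued random variables -/

section FinitelyValued

variable {Ω V : Type*} [Fintype V]

/-- Everything the algorithm computes, apart from its use of the scale, is a function of finitely
valued data. Measurability of the fibres therefore settles measurability of every such quantity,
with no structure on `V`. -/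
lemma measurable_comp_of_finite {m : MeasurableSpace Ω} {X : Ω → V}
    (hX : ∀ v, MeasurableSet[m] {ω | X ω = v}) {β : Type*} [MeasurableSpace β] (F : V → β) :
    Measurable[m] fun ω => F (X ω) := by
  intro s _
  have : (fun ω => F (X ω)) ⁻¹' s = ⋃ v ∈ {v | F v ∈ s}, {ω | X ω = v} := by
    ext ω; simp
  rw [this]
  exact MeasurableSet.biUnion (Set.to_countable _) fun v _ => hX v

lemma measurableSet_of_finite {m : MeasurableSpace Ω} {X : Ω → V}
    (hX : ∀ v, MeasurableSet[m] {ω | X ω = v}) (Q : V → Prop) : MeasurableSet[m] {ω | Q (X ω)} := by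
  have : {ω | Q (X ω)} = ⋃ v ∈ {v | Q v}, {ω | X ω = v} := by
    ext ω; simp
  rw [this]
  exact MeasurableSet.biUnion (Set.to_countable _) fun v _ => hX v

variable [m0 : MeasurableSpace Ω] {μ : Measure Ω} [IsProbabilityMeasure μ]

lemma integrable_comp_of_finite {X : Ω → V} (hX : ∀ v, MeasurableSet {ω | X ω = v}) (F : V → ℝ) :
    Integrable (fun ω => F (X ω)) μ := by
  refine Integrable.of_bound (measurable_comp_of_finite hX F).aestronglyMeasurable
    (∑ v, |F v|) (ae_of_all _ fun ω => ?_)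
  exact Finset.single_le_sum (f := fun v => |F v|) (fun _ _ => abs_nonneg _) (Finset.mem_univ (X ω))

lemma integral_comp_of_finite {X : Ω → V} (hX : ∀ v, MeasurableSet {ω | X ω = v}) (F : V → ℝ) :
    ∫ ω, F (X ω) ∂μ = ∑ v, μ.real {ω | X ω = v} * F v := by
  classical
  have h : ∀ ω, F (X ω) = ∑ v, Set.indicator {ω | X ω = v} (fun _ => F v) ω := by
    intro ω
    simp [Set.indicator_apply]
  simp_rw [h]
  rw [integral_finsetSum _ fun v _ => (integrable_const _).indicator (hX v)]
  exact Finset.sum_congr rfl fun v _ => by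
    rw [integral_indicator (hX v)]; simp [Measure.real, mul_comm]

/-- Fubini for a finitely valued random variable that is independent of everything else. -/
lemma integral_eq_sum_of_indep {mX mY : MeasurableSpace Ω} (hmX : mX ≤ m0) (hmY : mY ≤ m0)
    (hind : Indep mX mY μ) {X : Ω → V} (hX : ∀ v, MeasurableSet[mX] {ω | X ω = v})
    {G : V → Ω → ℝ} (hG : ∀ v, Measurable[mY] (G v)) (hGi : ∀ v, Integrable (G v) μ) :
    ∫ ω, G (X ω) ω ∂μ = ∑ v, μ.real {ω | X ω = v} * ∫ ω, G v ω ∂μ := by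
  classical
  have h : ∀ ω, G (X ω) ω = ∑ v, Set.indicator {ω | X ω = v} (G v) ω := by
    intro ω
    simp [Set.indicator_apply]
  simp_rw [h]
  rw [integral_finsetSum _ fun v _ => (hGi v).indicator (hmX _ (hX v))]
  refine Finset.sum_congr rfl fun v _ => ?_
  rw [integral_indicator (hmX _ (hX v))]
  have hi : Indep mX (MeasurableSpace.comap (G v) inferInstance) μ :=
    indep_of_indep_of_le_right hind (hG v).comap_le
  have := Indep.setIntegral_eq_mul (X := G v) (f := id) hmX hi
    ((hG v).mono hmY le_rfl).aemeasurable (hX v) measurable_id.aestronglyMeasurable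
  simpa using this

end FinitelyValued

/-! ### Medians -/

/-- In sorted order `R / 2 + 1` indices sit at or before the median position and `R - R / 2` at or
after it. Both numbers exceed the number of bad indices. -/
lemma exists_good_around_median {R : ℕ} (hR : 0 < R) (x : Fin R → ℝ) (bad : Fin R → Prop)
    [DecidablePred bad] (hbad : 2 * (Finset.univ.filter bad).card < R) :
    (∃ r, ¬ bad r ∧ x r ≤ x (medianIndex hR x)) ∧ ∃ r, ¬ bad r ∧ x (medianIndex hR x) ≤ x r := by
  have hmono := Tuple.monotone_sort x
  set p : Fin R := ⟨R / 2, Nat.div_lt_self hR one_lt_two⟩ with hp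
  have hmed : medianIndex hR x = Tuple.sort x p := rfl
  constructor
  · by_contra! hcon
    have hsub : (Finset.Iic p).map (Tuple.sort x).toEmbedding ⊆ Finset.univ.filter bad := by
      intro r hr
      simp only [Finset.mem_map, Finset.mem_Iic, Equiv.coe_toEmbedding] at hr
      obtain ⟨q, hq, rfl⟩ := hr
      simp only [Finset.mem_filter, Finset.mem_univ, true_and]
      by_contra hb
      have h1 := hcon _ hb
      have h2 := hmono hq
      simp only [Function.comp] at h2
      rw [hmed] at h1
      linarith
    have h := Finset.card_le_card hsub
    rw [Finset.card_map, Fin.card_Iic] at h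
    simp only [hp] at h
    omega
  · by_contra! hcon
    have hsub : (Finset.Ici p).map (Tuple.sort x).toEmbedding ⊆ Finset.univ.filter bad := by
      intro r hr
      simp only [Finset.mem_map, Finset.mem_Ici, Equiv.coe_toEmbedding] at hr
      obtain ⟨q, hq, rfl⟩ := hr
      simp only [Finset.mem_filter, Finset.mem_univ, true_and]
      by_contra hb
      have h1 := hcon _ hb
      have h2 := hmono hq
      simp only [Function.comp] at h2
      rw [hmed] at h1
      linarith
    have h := Finset.card_le_card hsub
    rw [Finset.card_map, Fin.card_Ici] at h
    simp only [hp] at h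
    omega

/-- The noise seen by column `i` in one hash table: the signed sum of the other surviving columns
in its bucket. -/
def noise {n w : ℕ} (A : Matrix (Fin n) (Fin n) ℝ) (κ : Fin n → Bool) (h : Fin n → Fin w)
    (σ : Fin n → ℤˣ) (i : Fin n) : Fin n → ℝ :=
  fun k => ∑ m with m ≠ i ∧ κ m = true ∧ h m = h i, ((σ m : ℤ) : ℝ) * A k m

lemma lookup_eq {n : ℕ} {P : Params n} (s : Seed P) (A : Matrix (Fin n) (Fin n) ℝ)
    (l : Fin (P.Lhat + 1)) (i : Fin n) (r : Fin P.R) (hi : s.keep l i = true) :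
    s.lookup A l i r = (fun k => ((s.sign l r i : ℤ) : ℝ) * col A i k) +
      noise A (s.keep l) (s.hash l r) (s.sign l r) i := by
  funext k
  simp only [Seed.lookup, Seed.bucket, noise, Pi.add_apply, col]
  rw [← Finset.add_sum_erase _ _ (show i ∈ _ from by simp [hi])]
  congr 1
  apply Finset.sum_congr _ fun _ _ => rfl
  ext m
  simp

/-- In repetition `r` of level `l` the noise seen by column `i`, computed with the survival
indicators `κ`, has energy larger than `τ`. -/
def NoisyRep {n : ℕ} {P : Params n} (A : Matrix (Fin n) (Fin n) ℝ) (s : Seed P) (κ : Fin n → Bool)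
    (τ : ℝ) (l : Fin (P.Lhat + 1)) (i : Fin n) (r : Fin P.R) : Prop :=
  τ < energy (noise A κ (s.hash l r) (s.sign l r) i)

open Classical in
/-- At least half of the repetitions of level `l` are noisy for the column `i`. -/
def Noisy {n : ℕ} {P : Params n} (A : Matrix (Fin n) (Fin n) ℝ) (s : Seed P) (κ : Fin n → Bool)
    (τ : ℝ) (l : Fin (P.Lhat + 1)) (i : Fin n) : Prop :=
  P.R ≤ 2 * (Finset.univ.filter fun r => NoisyRep A s κ τ l i r).card

/-- The median lies between the lookups of two quiet repetitions, and each of these is within `√τ`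
of the truth by the triangle inequality for `√energy`. -/
lemma abs_sqrt_est_sub_le {n : ℕ} {P : Params n} (s : Seed P) (A : Matrix (Fin n) (Fin n) ℝ)
    (l : Fin (P.Lhat + 1)) (i : Fin n) (hi : s.keep l i = true) {τ : ℝ}
    (h : ¬ Noisy A s (s.keep l) τ l i) :
    |√(s.est A l i) - √(energy (col A i))| ≤ √τ := by
  classical
  have key : ∀ r, ¬ NoisyRep A s (s.keep l) τ l i r →
      |√(energy (s.lookup A l i r)) - √(energy (col A i))| ≤ √τ := by
    intro r hr
    unfold NoisyRep at hr
    rw [lookup_eq s A l i r hi]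
    have := abs_sqrt_energy_add_sub_le (fun k => ((s.sign l r i : ℤ) : ℝ) * col A i k)
      (noise A (s.keep l) (s.hash l r) (s.sign l r) i)
    rw [energy_unit_smul] at this
    exact this.trans (Real.sqrt_le_sqrt (not_lt.mp hr))
  unfold Noisy at h
  obtain ⟨⟨r, hr, hr'⟩, ⟨q, hq, hq'⟩⟩ := exists_good_around_median
    (lt_of_lt_of_le Nat.one_pos (le_max_left 1 _)) (fun r => energy (s.lookup A l i r))
    (fun r => NoisyRep A s (s.keep l) τ l i r) (not_le.mp h)
  have h1 := abs_le.mp (key r hr)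
  have h2 := abs_le.mp (key q hq)
  have h3 := Real.sqrt_le_sqrt hr'
  have h4 := Real.sqrt_le_sqrt hq'
  rw [abs_le]
  exact ⟨le_trans (by linarith [h1.1]) (sub_le_sub_right h3 _),
    (sub_le_sub_right h4 _).trans h2.2⟩

/-! ### Random signs and hash functions -/

section RandomTable

variable {Ω : Type*} {mX mY : MeasurableSpace Ω} [m0 : MeasurableSpace Ω] {μ : Measure Ω} [IsProbabilityMeasure μ] {n : ℕ}

lemma measure_pair_of_kWise {k : ℕ} (hk : 2 ≤ k) {ι β : Type*} [Fintype β] {X : Ω → ι → β}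
    (hX : KWiseUniform μ k X) {i j : ι} (hij : i ≠ j) (u v : β) :
    μ.real {ω | X ω i = u ∧ X ω j = v} = (1 / (Fintype.card β : ℝ)) ^ 2 := by
  classical
  have := hX {i, j} (by rw [Finset.card_pair hij]; exact hk) fun m => if m = i then u else v
  rw [Finset.card_pair hij] at this
  rw [← this]
  congr 1
  ext ω
  simp [hij.symm]

lemma integral_sign_mul_sign {σ : Ω → Fin n → ℤˣ} (hm : ∀ v, MeasurableSet {ω | σ ω = v})
    (hσ : KWiseUniform μ 4 σ) {i j : Fin n} (hij : i ≠ j) :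
    ∫ ω, ((σ ω i : ℤ) : ℝ) * ((σ ω j : ℤ) : ℝ) ∂μ = 0 := by
  have hpm : ∀ v : ℤˣ × ℤˣ, MeasurableSet {ω | (σ ω i, σ ω j) = v} := fun v =>
    measurableSet_of_finite hm fun x => (x i, x j) = v
  rw [integral_comp_of_finite hpm fun v : ℤˣ × ℤˣ => ((v.1 : ℤ) : ℝ) * ((v.2 : ℤ) : ℝ)]
  have : ∀ v : ℤˣ × ℤˣ, μ.real {ω | (σ ω i, σ ω j) = v} = 1 / 4 := by
    rintro ⟨u, v⟩
    have := measure_pair_of_kWise (by norm_num) hσ hij u v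
    simp only [Prod.mk.injEq]
    rw [this]
    norm_num
  simp_rw [this]
  rw [← Finset.mul_sum, Fintype.sum_prod_type]
  simp [← Finset.mul_sum]

lemma integral_sq_signed_sum {σ : Ω → Fin n → ℤˣ} (hm : ∀ v, MeasurableSet {ω | σ ω = v})
    (hσ : KWiseUniform μ 4 σ) (G : Finset (Fin n)) (a : Fin n → ℝ) :
    ∫ ω, (∑ m ∈ G, ((σ ω m : ℤ) : ℝ) * a m) ^ 2 ∂μ = ∑ m ∈ G, a m ^ 2 := by
  have hint : ∀ i j, Integrable (fun ω => ((σ ω i : ℤ) : ℝ) * a i * (((σ ω j : ℤ) : ℝ) * a j)) μ :=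
    fun i j => integrable_comp_of_finite hm
      fun x => ((x i : ℤ) : ℝ) * a i * (((x j : ℤ) : ℝ) * a j)
  simp_rw [sq (∑ m ∈ G, _), Finset.sum_mul_sum]
  rw [integral_finsetSum _ fun i _ => integrable_finsetSum _ fun j _ => hint i j]
  refine Finset.sum_congr rfl fun i hi => ?_
  rw [integral_finsetSum _ fun j _ => hint i j, Finset.sum_eq_single_of_mem i hi]
  · have : ∀ ω, ((σ ω i : ℤ) : ℝ) * a i * (((σ ω i : ℤ) : ℝ) * a i) = a i ^ 2 := by
      intro ω
      rcases Int.units_eq_one_or (σ ω i) with h | h <;> simp [h, sq]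
    simp [this]
  · intro j _ hj
    have : ∀ ω, ((σ ω i : ℤ) : ℝ) * a i * (((σ ω j : ℤ) : ℝ) * a j) =
        (a i * a j) * (((σ ω i : ℤ) : ℝ) * ((σ ω j : ℤ) : ℝ)) := fun ω => by ring
    simp_rw [this]
    rw [integral_const_mul, integral_sign_mul_sign hm hσ hj.symm, mul_zero]

/-- Coordinatewise, with `g = logSq` and `X` the signed sum: `E g(X²) ≤ g(E X²) = g(∑ a²) ≤ ∑
g(a²)`. The first step is Jensen, the last is subadditivity. -/
lemma integral_energy_signed_sum_le {σ : Ω → Fin n → ℤˣ} (hm : ∀ v, MeasurableSet {ω | σ ω = v})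
    (hσ : KWiseUniform μ 4 σ) (G : Finset (Fin n)) (A : Matrix (Fin n) (Fin n) ℝ) :
    ∫ ω, energy (fun k => ∑ m ∈ G, ((σ ω m : ℤ) : ℝ) * A k m) ∂μ ≤ ∑ m ∈ G, energy (col A m) := by
  unfold energy
  rw [Finset.sum_comm, integral_finsetSum _ fun k _ => integrable_comp_of_finite hm
    fun x => f (∑ m ∈ G, ((x m : ℤ) : ℝ) * A k m) ^ 2]
  refine Finset.sum_le_sum fun k _ => ?_
  simp_rw [f_sq]
  refine (concaveOn_logSq.le_map_integral continuous_logSq.continuousOn isClosed_Ici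
    (ae_of_all _ fun ω => Set.mem_Ici.mpr (sq_nonneg _))
    (integrable_comp_of_finite hm fun x => (∑ m ∈ G, ((x m : ℤ) : ℝ) * A k m) ^ 2)
    (integrable_comp_of_finite hm
      fun x => logSq ((∑ m ∈ G, ((x m : ℤ) : ℝ) * A k m) ^ 2))).trans ?_
  rw [integral_sq_signed_sum hm hσ]
  exact logSq_sum_le _ _ fun _ _ => sq_nonneg _

lemma measure_collision {w : ℕ} {h : Ω → Fin n → Fin w} (hm : ∀ v, MeasurableSet {ω | h ω = v})
    (hh : KWiseUniform μ 2 h) {i j : Fin n} (hij : i ≠ j) :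
    μ.real {ω | h ω i = h ω j} = 1 / w := by
  have e : {ω | h ω i = h ω j} = ⋃ v ∈ (Finset.univ : Finset (Fin w)),
      {ω | h ω i = v ∧ h ω j = v} := by
    ext ω; simp [eq_comm]
  rw [e, measureReal_biUnion_finset]
  · simp_rw [measure_pair_of_kWise le_rfl hh hij]
    simp only [Finset.sum_const, Finset.card_univ, Fintype.card_fin, nsmul_eq_mul]
    rcases Nat.eq_zero_or_pos w with rfl | hw
    · simp
    · field_simp
  · intro u _ v _ huv
    rw [Function.onFun, Set.disjoint_left]
    rintro ω ⟨h1, _⟩ ⟨h2, _⟩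
    exact huv (h1.symm.trans h2)
  · exact fun v _ => measurableSet_of_finite hm fun x => x i = v ∧ x j = v

/-- For a fixed hash function the signs reduce the expected energy to that of the colliding columns,
and each other column collides with `i` with probability `1/w`. The survival pattern `κ` is
deterministic here, so that it can be conditioned on, or altered, later. -/
lemma integral_noise_le {w : ℕ} (hmX : mX ≤ m0) (hmY : mY ≤ m0)
    (hind : Indep mX mY μ) {h : Ω → Fin n → Fin w} {σ : Ω → Fin n → ℤˣ}
    (hhm : ∀ v, MeasurableSet[mX] {ω | h ω = v}) (hσm : ∀ v, MeasurableSet[mY] {ω | σ ω = v})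
    (hh : KWiseUniform μ 2 h) (hσ : KWiseUniform μ 4 σ) (A : Matrix (Fin n) (Fin n) ℝ)
    (κ : Fin n → Bool) (i : Fin n) :
    ∫ ω, energy (noise A κ (h ω) (σ ω) i) ∂μ ≤ (∑ m with κ m = true, energy (col A m)) / w := by
  have hhm' : ∀ v, MeasurableSet {ω | h ω = v} := fun v => hmX _ (hhm v)
  have hσm' : ∀ v, MeasurableSet {ω | σ ω = v} := fun v => hmY _ (hσm v)
  rw [integral_eq_sum_of_indep hmX hmY hind hhm
    (G := fun v ω => energy (noise A κ v (σ ω) i))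
    (fun v => measurable_comp_of_finite hσm fun x => energy (noise A κ v x i))
    (fun v => integrable_comp_of_finite hσm' fun x => energy (noise A κ v x i))]
  have h1 : ∀ v : Fin n → Fin w, ∫ ω, energy (noise A κ v (σ ω) i) ∂μ ≤
      ∑ m with m ≠ i ∧ κ m = true, if v m = v i then energy (col A m) else 0 := by
    intro v
    rw [← Finset.sum_filter, Finset.filter_filter]
    simp only [and_assoc]
    exact integral_energy_signed_sum_le hσm' hσ _ A
  refine (Finset.sum_le_sum fun v _ => mul_le_mul_of_nonneg_left (h1 v) measureReal_nonneg).trans ?_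
  rw [← integral_comp_of_finite hhm' fun v => ∑ m with m ≠ i ∧ κ m = true,
    if v m = v i then energy (col A m) else 0]
  rw [integral_finsetSum _ fun m _ => integrable_comp_of_finite hhm'
    fun v => if v m = v i then energy (col A m) else 0]
  have h2 : ∀ m, m ≠ i → ∫ ω, (if h ω m = h ω i then energy (col A m) else 0) ∂μ =
      energy (col A m) / w := by
    intro m hmi
    have e : (fun ω => if h ω m = h ω i then energy (col A m) else 0) =
        Set.indicator {ω | h ω m = h ω i} fun _ => energy (col A m) := by
      ext ω; simp [Set.indicator_apply]
    rw [e, integral_indicator (measurableSet_of_finite hhm' fun x => x m = x i),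
      setIntegral_const, measure_collision hhm' hh hmi]
    simp [div_eq_inv_mul]
  rw [Finset.sum_div]
  rw [Finset.sum_congr rfl fun m hm => h2 m (Finset.mem_filter.mp hm).2.1]
  refine Finset.sum_le_sum_of_subset_of_nonneg ?_ fun m _ _ =>
    div_nonneg (energy_nonneg _) (Nat.cast_nonneg _)
  intro m
  simp

/-- Among `R` independent events of probability at most `q²`, it is exponentially unlikely that at
least half occur. -/
lemma measure_half_le {R : ℕ} {B : Fin R → Set Ω} {q : ℝ} (hq : 0 ≤ q) (hq1 : q ≤ 1)
    (hB : ∀ t : Finset (Fin R), μ.real (⋂ r ∈ t, B r) ≤ ∏ r ∈ t, μ.real (B r))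
    (hp : ∀ r, μ.real (B r) ≤ q ^ 2) [∀ ω, DecidablePred fun r => ω ∈ B r] :
    μ.real {ω | R ≤ 2 * (Finset.univ.filter fun r => ω ∈ B r).card} ≤ (2 * q) ^ R := by
  -- Union bound over the index sets of size at least `R/2`. There are at most `2^R` of them, and
  -- each has probability at most `(q²)^(R/2) = q^R`.
  have hsub : {ω | R ≤ 2 * (Finset.univ.filter fun r => ω ∈ B r).card} ⊆
      ⋃ t ∈ (Finset.univ : Finset (Finset (Fin R))).filter (fun t => R ≤ 2 * t.card),
        ⋂ r ∈ t, B r := by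
    intro ω hω
    simp only [Set.mem_ofPred_eq] at hω
    simp only [Set.mem_iUnion, Set.mem_iInter, Finset.mem_filter, Finset.mem_univ, true_and]
    exact ⟨_, hω, fun r hr => by simpa using hr⟩
  refine (measureReal_mono hsub (measure_ne_top _ _)).trans ((measureReal_biUnion_finset_le _ _).trans ?_)
  have h1 : ∀ t ∈ (Finset.univ : Finset (Finset (Fin R))).filter (fun t => R ≤ 2 * t.card),
      μ.real (⋂ r ∈ t, B r) ≤ q ^ R := by
    intro t ht
    simp only [Finset.mem_filter, Finset.mem_univ, true_and] at ht
    calc μ.real (⋂ r ∈ t, B r) ≤ ∏ r ∈ t, μ.real (B r) := hB t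
      _ ≤ ∏ r ∈ t, q ^ 2 := Finset.prod_le_prod (fun _ _ => measureReal_nonneg) fun r _ => hp r
      _ = q ^ (2 * t.card) := by rw [Finset.prod_const, pow_mul]
      _ ≤ q ^ R := pow_le_pow_of_le_one hq hq1 ht
  refine (Finset.sum_le_card_nsmul _ _ _ h1).trans ?_
  rw [nsmul_eq_mul, mul_pow]
  refine mul_le_mul_of_nonneg_right ?_ (by positivity)
  have : ((Finset.univ : Finset (Finset (Fin R))).filter (fun t => R ≤ 2 * t.card)).card ≤ 2 ^ R := by
    refine (Finset.card_filter_le _ _).trans ?_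
    simp
  exact_mod_cast this

end RandomTable

/-! ### Conditioning on an independent finitely valued variable -/

/-- Splitting according to the value of `X` and using independence on each piece. It turns bounds
for a fixed survival pattern into bounds relative to an event about the random pattern. -/
lemma measureReal_le_of_indep {Ω V : Type*} {mX mY : MeasurableSpace Ω} [m0 : MeasurableSpace Ω]
    {μ : Measure Ω} [IsProbabilityMeasure μ] [Fintype V] (hmX : mX ≤ m0) (hmY : mY ≤ m0)
    (hind : Indep mX mY μ) {X : Ω → V} (hX : ∀ v, MeasurableSet[mX] {ω | X ω = v})
    {B : V → Set Ω} (hB : ∀ v, MeasurableSet[mY] (B v)) (Q : V → Prop) {b : ℝ}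
    (hb : ∀ v, Q v → μ.real (B v) ≤ b) :
    μ.real {ω | Q (X ω) ∧ ω ∈ B (X ω)} ≤ b * μ.real {ω | Q (X ω)} := by
  classical
  have hX' : ∀ v, MeasurableSet {ω | X ω = v} := fun v => hmX _ (hX v)
  have e1 : {ω | Q (X ω) ∧ ω ∈ B (X ω)} =
      ⋃ v ∈ Finset.univ.filter Q, {ω | X ω = v} ∩ B v := by
    ext ω; simp
  have e2 : {ω | Q (X ω)} = ⋃ v ∈ Finset.univ.filter Q, {ω | X ω = v} := by
    ext ω; simp
  have hd : ∀ u v : V, u ≠ v → Disjoint {ω | X ω = u} {ω | X ω = v} := by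
    intro u v huv
    rw [Set.disjoint_left]
    intro ω h1 h2
    exact huv (Eq.trans (Eq.symm h1) h2)
  rw [e1, e2, measureReal_biUnion_finset, measureReal_biUnion_finset, Finset.mul_sum]
  · refine Finset.sum_le_sum fun v hv => ?_
    have := (Indep_iff _ _ _).mp hind _ _ (hX v) (hB v)
    rw [measureReal_def, this, ENNReal.toReal_mul, mul_comm]
    exact mul_le_mul_of_nonneg_right (hb v (Finset.mem_filter.mp hv).2) ENNReal.toReal_nonneg
  · exact fun u _ v _ huv => hd u v huv
  · exact fun v _ => hX' v
  · exact fun u _ v _ huv => (hd u v huv).mono Set.inter_subset_left Set.inter_subset_left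
  · exact fun v _ => (hX' v).inter (hmY _ (hB v))

/-! ### The σ-algebras generated by the components of a run -/

/-- The σ-algebra generated by a set of components of the seed. -/
@[reducible] def compSigma {n : ℕ} {P : Params n} {Ω : Type*} (seed : Ω → Seed P) (S : Set (Component P)) :
    MeasurableSpace Ω := ⨆ k ∈ S, k.sigma seed

/-- The components that carry the subsampling. -/
def columnComps {n : ℕ} (P : Params n) : Set (Component P) := Set.range Component.column

/-- The components that carry the hash tables. -/
def tableComps {n : ℕ} (P : Params n) : Set (Component P) :=
  {k | (∃ l r, k = .hash l r) ∨ ∃ l r, k = .sign l r}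

section Run

variable {n : ℕ} {P : Params n} {A : Matrix (Fin n) (Fin n) ℝ} {Ω : Type*}
  [m0 : MeasurableSpace Ω] {μ : Measure Ω} [IsProbabilityMeasure μ] {seed : Ω → Seed P}
  {draw : Ω → Option (Fin (P.L + 1) × Fin n)}

lemma IsRun.compSigma_le (H : IsRun P A μ seed draw) (S : Set (Component P)) :
    compSigma seed S ≤ m0 := iSup₂_le fun k _ => H.measurable_seed k

lemma sigma_le_compSigma {S : Set (Component P)} {k : Component P} (h : k ∈ S) :
    k.sigma seed ≤ compSigma seed S := le_biSup (fun k => Component.sigma seed k) h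

lemma IsRun.indep_compSigma (H : IsRun P A μ seed draw) {S T : Set (Component P)}
    (h : Disjoint S T) : Indep (compSigma seed S) (compSigma seed T) μ :=
  indep_iSup_of_disjoint H.measurable_seed H.indep h

lemma measurableSet_column {S : Set (Component P)} {i : Fin n} (h : Component.column i ∈ S)
    (p : Fin (P.Lhat + 1) → Bool) :
    MeasurableSet[compSigma seed S] {ω | (fun l => (seed ω).keep l i) = p} :=
  sigma_le_compSigma h _ ⟨{p}, trivial, rfl⟩

lemma measurableSet_hash {S : Set (Component P)} {l : Fin (P.Lhat + 1)} {r : Fin P.R}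
    (h : Component.hash l r ∈ S) (v : Fin n → Fin (P.w l)) :
    MeasurableSet[compSigma seed S] {ω | (seed ω).hash l r = v} :=
  sigma_le_compSigma h _ ⟨{v}, trivial, rfl⟩

lemma measurableSet_sign {S : Set (Component P)} {l : Fin (P.Lhat + 1)} {r : Fin P.R}
    (h : Component.sign l r ∈ S) (v : Fin n → ℤˣ) :
    MeasurableSet[compSigma seed S] {ω | (seed ω).sign l r = v} :=
  sigma_le_compSigma h _ ⟨{v}, trivial, rfl⟩

lemma measurableSet_keep {S : Set (Component P)} (h : columnComps P ⊆ S)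
    (κ : Fin (P.Lhat + 1) → Fin n → Bool) :
    MeasurableSet[compSigma seed S] {ω | (seed ω).keep = κ} := by
  have : {ω | (seed ω).keep = κ} = ⋂ i, {ω | (fun l => (seed ω).keep l i) = fun l => κ l i} := by
    ext ω
    simp only [Set.mem_ofPred_eq, Set.mem_iInter]
    exact ⟨fun h i => by rw [h], fun h => funext fun l => funext fun i => congrFun (h i) l⟩
  rw [this]
  exact MeasurableSet.iInter fun i => measurableSet_column (h ⟨i, rfl⟩) _

lemma measurableSet_tables {S : Set (Component P)} (h : tableComps P ⊆ S)
    (v : ((l : Fin (P.Lhat + 1)) → Fin P.R → Fin n → Fin (P.w l)) ×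
      (Fin (P.Lhat + 1) → Fin P.R → Fin n → ℤˣ)) :
    MeasurableSet[compSigma seed S] {ω | ((seed ω).hash, (seed ω).sign) = v} := by
  have : {ω | ((seed ω).hash, (seed ω).sign) = v} =
      (⋂ l, ⋂ r, {ω | (seed ω).hash l r = v.1 l r}) ∩
        ⋂ l, ⋂ r, {ω | (seed ω).sign l r = v.2 l r} := by
    ext ω
    simp only [Set.mem_ofPred_eq, Set.mem_iInter, Set.mem_inter_iff, Prod.ext_iff, funext_iff]
  rw [this]
  refine MeasurableSet.inter (MeasurableSet.iInter fun l => MeasurableSet.iInter fun r => ?_)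
    (MeasurableSet.iInter fun l => MeasurableSet.iInter fun r => ?_)
  · exact measurableSet_hash (h (Or.inl ⟨l, r, rfl⟩)) _
  · exact measurableSet_sign (h (Or.inr ⟨l, r, rfl⟩)) _

lemma disjoint_columnComps_tableComps : Disjoint (columnComps P) (tableComps P) := by
  rw [Set.disjoint_left]
  rintro k ⟨i, rfl⟩ (⟨l, r, h⟩ | ⟨l, r, h⟩) <;> cases h

/-! ### Noise in the heavy hitter structures -/

/-- The components of one hash table. -/
def tableComp {n : ℕ} {P : Params n} (l : Fin (P.Lhat + 1)) (r : Fin P.R) : Set (Component P) :=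
  {.hash l r, .sign l r}

lemma measurableSet_noisyRep (κ : Fin n → Bool) (τ : ℝ) (l : Fin (P.Lhat + 1)) (i : Fin n)
    (r : Fin P.R) {S : Set (Component P)} (hS : tableComp l r ⊆ S) :
    MeasurableSet[compSigma seed S] {ω | NoisyRep A (seed ω) κ τ l i r} := by
  refine measurableSet_of_finite (X := fun ω => ((seed ω).hash l r, (seed ω).sign l r))
    (fun v => ?_) fun v => τ < energy (noise A κ v.1 v.2 i)
  simp only [Prod.ext_iff]
  exact (measurableSet_hash (hS (Set.mem_insert _ _)) v.1).inter (measurableSet_sign (hS (Set.mem_insert_of_mem _ (Set.mem_singleton _))) v.2)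

lemma IsRun.measure_noisyRep_le (H : IsRun P A μ seed draw) {κ : Fin n → Bool} {τ p : ℝ}
    (hτ : 0 < τ) (hp : 0 ≤ p) {l : Fin (P.Lhat + 1)}
    (hκ : ∑ m with κ m = true, energy (col A m) ≤ τ * p * P.w l) (i : Fin n) (r : Fin P.R) :
    μ.real {ω | NoisyRep A (seed ω) κ τ l i r} ≤ p := by
  have hd : Disjoint ({Component.hash l r} : Set (Component P)) {Component.sign l r} := by simp
  have h1 := integral_noise_le (H.compSigma_le _) (H.compSigma_le _) (H.indep_compSigma hd)
    (fun v => measurableSet_hash (Set.mem_singleton _) v)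
    (fun v => measurableSet_sign (Set.mem_singleton _) v)
    (H.hash_pairwise l r) (H.sign_fourwise l r) A κ i
  have hi : Integrable (fun ω => energy (noise A κ ((seed ω).hash l r) ((seed ω).sign l r) i)) μ := by
    refine integrable_comp_of_finite (X := fun ω => ((seed ω).hash l r, (seed ω).sign l r))
      (fun v => ?_) fun v => energy (noise A κ v.1 v.2 i)
    simp only [Prod.ext_iff]
    exact (H.compSigma_le _ _ (measurableSet_hash (S := Set.univ) (Set.mem_univ _) v.1)).inter
      (H.compSigma_le _ _ (measurableSet_sign (S := Set.univ) (Set.mem_univ _) v.2))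
  have h2 := mul_meas_ge_le_integral_of_nonneg
    (ae_of_all _ fun ω => energy_nonneg _) hi τ
  have h3 : μ.real {ω | NoisyRep A (seed ω) κ τ l i r} ≤
      μ.real {ω | τ ≤ energy (noise A κ ((seed ω).hash l r) ((seed ω).sign l r) i)} :=
    measureReal_mono (fun ω (h : NoisyRep A (seed ω) κ τ l i r) =>
      Set.mem_ofPred_eq ▸ (show τ < _ from h).le) (measure_ne_top _ _)
  have h4 : (∑ m with κ m = true, energy (col A m)) / P.w l ≤ τ * p := by
    rcases Nat.eq_zero_or_pos (P.w l) with h | h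
    · simp [h]; positivity
    · rw [div_le_iff₀ (by exact_mod_cast h)]; exact hκ
  refine h3.trans ?_
  have := h2.trans (h1.trans h4)
  exact le_of_mul_le_mul_left this hτ

lemma IsRun.measure_iInter_noisyRep_le (H : IsRun P A μ seed draw) (κ : Fin n → Bool) (τ : ℝ)
    (l : Fin (P.Lhat + 1)) (i : Fin n) (t : Finset (Fin P.R)) :
    μ.real (⋂ r ∈ t, {ω | NoisyRep A (seed ω) κ τ l i r}) ≤
      ∏ r ∈ t, μ.real {ω | NoisyRep A (seed ω) κ τ l i r} := by
  induction t using Finset.induction_on with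
  | empty => simp
  | insert a t ha ih =>
    rw [Finset.prod_insert ha, Finset.set_biInter_insert]
    have hd : Disjoint (tableComp (P := P) l a) (⋃ r ∈ t, tableComp l r) := by
      simp only [Set.disjoint_iUnion_right]
      intro r hr
      have : a ≠ r := by rintro rfl; exact ha hr
      simp [tableComp, this.symm]
    have hm : MeasurableSet[compSigma seed (⋃ r ∈ t, tableComp l r)]
        (⋂ r ∈ t, {ω | NoisyRep A (seed ω) κ τ l i r}) := by
      refine MeasurableSet.biInter (Set.to_countable _) fun r hr => ?_
      exact measurableSet_noisyRep κ τ l i r (Set.subset_biUnion_of_mem (u := fun r => tableComp l r) hr)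
    have := (Indep_iff _ _ _).mp (H.indep_compSigma hd) _ _
      (measurableSet_noisyRep (A := A) κ τ l i a le_rfl) hm
    rw [measureReal_def, this, ENNReal.toReal_mul]
    exact mul_le_mul_of_nonneg_left ih ENNReal.toReal_nonneg

lemma IsRun.measure_noisy_le (H : IsRun P A μ seed draw) {κ : Fin n → Bool} {τ q : ℝ}
    (hτ : 0 < τ) (hq : 0 ≤ q) (hq1 : q ≤ 1) {l : Fin (P.Lhat + 1)}
    (hκ : ∑ m with κ m = true, energy (col A m) ≤ τ * q ^ 2 * P.w l) (i : Fin n) :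
    μ.real {ω | Noisy A (seed ω) κ τ l i} ≤ (2 * q) ^ P.R := by
  classical
  have := measure_half_le (μ := μ) (B := fun r => {ω | NoisyRep A (seed ω) κ τ l i r}) hq hq1
    (fun t => H.measure_iInter_noisyRep_le κ τ l i t)
    (fun r => H.measure_noisyRep_le hτ (sq_nonneg q) hκ i r)
  refine le_trans (le_of_eq ?_) this
  congr 1

/-- Some column is noisy in some heavy hitter structure, if the survival indicators are `κ`. -/
def SomeNoisy {n : ℕ} {P : Params n} (A : Matrix (Fin n) (Fin n) ℝ)
    (τ : Fin (P.Lhat + 1) → ℝ) (s : Seed P) (κ : Fin (P.Lhat + 1) → Fin n → Bool) : Prop :=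
  ∃ l i, Noisy A s (κ l) (τ l) l i

/-- `R` is at least `log N` for `N = n / δ`, the number of pairs of a level and a column, so `N ≤
e^R ≤ 10^R`. Against the failure probability `1000^-R` of one pair this leaves `100^-R`, and `R ≥
1`. -/
lemma repetitions_suffice (hc : P.cR = 1) (hn : 0 < n) :
    (n : ℝ) * (P.Lhat + 1) * (1 / 1000 : ℝ) ^ P.R ≤ 1 / 100 := by
  set N : ℝ := n * (P.Lhat + 1) with hN
  have hn' : (1 : ℝ) ≤ n := by exact_mod_cast hn
  have hNpos : 0 < N := by positivity
  have hR1 : 1 ≤ P.R := le_max_left _ _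
  have hRN : Real.log N ≤ P.R := by
    have h1 : (⌈P.cR * Real.log (n / P.δ)⌉₊ : ℝ) ≤ P.R := by
      exact_mod_cast le_max_right 1 _
    have h2 := Nat.le_ceil (P.cR * Real.log (n / P.δ))
    rw [hc, one_mul] at h2
    rw [hc, one_mul] at h1
    have : (n : ℝ) / P.δ = N := by rw [hN, Params.δ]; simp
    rw [this] at h1 h2
    linarith
  have h1 : N ≤ (10 : ℝ) ^ P.R := by
    calc N = Real.exp (Real.log N) := (Real.exp_log hNpos).symm
      _ ≤ Real.exp P.R := Real.exp_le_exp.mpr hRN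
      _ = Real.exp 1 ^ P.R := by rw [← Real.exp_nat_mul]; simp
      _ ≤ (10 : ℝ) ^ P.R := by
        gcongr
        linarith [Real.exp_one_lt_d9]
  have h2 : (1 / 100 : ℝ) ^ P.R ≤ 1 / 100 := pow_le_of_le_one (by norm_num) (by norm_num) (by omega)
  calc N * (1 / 1000 : ℝ) ^ P.R ≤ (10 : ℝ) ^ P.R * (1 / 1000 : ℝ) ^ P.R := by gcongr
    _ = (1 / 100 : ℝ) ^ P.R := by rw [← mul_pow]; norm_num
    _ ≤ 1 / 100 := h2

lemma IsRun.measure_someNoisy_le (H : IsRun P A μ seed draw) (hc : P.cR = 1) (hn : 0 < n)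
    {κ : Fin (P.Lhat + 1) → Fin n → Bool} {τ : Fin (P.Lhat + 1) → ℝ} (hτ : ∀ l, 0 < τ l)
    (hκ : ∀ l, ∑ m with κ l m = true, energy (col A m) ≤ τ l * (1 / 2000) ^ 2 * P.w l) :
    μ.real {ω | SomeNoisy A τ (seed ω) κ} ≤ 1 / 100 := by
  have e : {ω | SomeNoisy A τ (seed ω) κ} =
      ⋃ li ∈ (Finset.univ : Finset (Fin (P.Lhat + 1) × Fin n)),
        {ω | Noisy A (seed ω) (κ li.1) (τ li.1) li.1 li.2} := by
    ext ω; simp [SomeNoisy]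
  rw [e]
  refine (measureReal_biUnion_finset_le _ _).trans ?_
  refine (Finset.sum_le_card_nsmul _ _ ((1 / 1000 : ℝ) ^ P.R) fun li _ => ?_).trans ?_
  -- The choice `q = 1/2000` makes the failure probability of one pair `(2q)^R = 1000^-R`.
  · have := H.measure_noisy_le (hτ li.1) (by norm_num) (by norm_num) (hκ li.1) li.2
    norm_num at this ⊢
    exact this
  · have := repetitions_suffice (P := P) hc hn
    simp only [Finset.card_univ, Fintype.card_prod, Fintype.card_fin, nsmul_eq_mul]
    push_cast
    linarith

lemma measurableSet_someNoisy (κ : Fin (P.Lhat + 1) → Fin n → Bool) (τ : Fin (P.Lhat + 1) → ℝ) :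
    MeasurableSet[compSigma seed (tableComps P)] {ω | SomeNoisy A τ (seed ω) κ} :=
  measurableSet_of_finite (X := fun ω => ((seed ω).hash, (seed ω).sign))
    (measurableSet_tables le_rfl)
    -- The scale and the survival indicators of this seed are dummies: the event reads only the hash
    -- functions and signs, and `κ` is supplied separately.
    fun v => SomeNoisy A τ ⟨0, fun _ _ => true, v.1, v.2⟩ κ

/-- Noise is unlikely, even if the survival indicators are altered afterwards. -/
lemma IsRun.measure_and_someNoisy_le (H : IsRun P A μ seed draw) (hc : P.cR = 1) (hn : 0 < n)
    {τ : Fin (P.Lhat + 1) → ℝ} (hτ : ∀ l, 0 < τ l)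
    (Φ : (Fin (P.Lhat + 1) → Fin n → Bool) → Fin (P.Lhat + 1) → Fin n → Bool)
    (Q : (Fin (P.Lhat + 1) → Fin n → Bool) → Prop)
    (hQ : ∀ κ, Q κ → ∀ l, ∑ m with Φ κ l m = true, energy (col A m) ≤
      τ l * (1 / 2000) ^ 2 * P.w l) :
    μ.real {ω | Q (seed ω).keep ∧ SomeNoisy A τ (seed ω) (Φ (seed ω).keep)} ≤
      1 / 100 * μ.real {ω | Q (seed ω).keep} :=
  measureReal_le_of_indep (H.compSigma_le _) (H.compSigma_le _)
    (H.indep_compSigma disjoint_columnComps_tableComps) (X := fun ω => (seed ω).keep)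
    (measurableSet_keep le_rfl) (B := fun κ => {ω | SomeNoisy A τ (seed ω) (Φ κ)})
    (fun κ => measurableSet_someNoisy (Φ κ) τ) Q
    fun κ hκ => H.measure_someNoisy_le hc hn hτ (hQ κ hκ)

end Run

/-! ### Numerical facts about the parameters -/

/-- The standing assumptions on the parameters of a call of the sampler. -/
structure Setting {n : ℕ} (P : Params n) (A : Matrix (Fin n) (Fin n) ℝ) : Prop where
  n_pos : 0 < n
  one_le_K : 1 ≤ P.K
  ε_pos : 0 < P.ε
  ε_le : P.ε ≤ 1 / 10 ^ 6
  L_ge : 10 ^ 5 ≤ (P.L : ℝ)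
  M_pos : 0 < totalEnergy A
  le_Mhat : totalEnergy A ≤ P.Mhat
  Mhat_le : P.Mhat ≤ P.K * totalEnergy A
  cw_eq : P.cw = 10 ^ 24
  cR_eq : P.cR = 1
  cφ_eq : P.cφ = 1
  ν_eq : P.ν = 1
  cList_eq : P.cList = 200 * P.K

lemma le_two_pow_ceil_logb {x : ℝ} (hx : 0 < x) : x ≤ 2 ^ ⌈Real.logb 2 x⌉₊ := by
  calc x = (2 : ℝ) ^ Real.logb 2 x := (Real.rpow_logb (by norm_num) (by norm_num) hx).symm
    _ ≤ (2 : ℝ) ^ ((⌈Real.logb 2 x⌉₊ : ℕ) : ℝ) :=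
      Real.rpow_le_rpow_of_exponent_le (by norm_num) (Nat.le_ceil _)
    _ = _ := Real.rpow_natCast _ _

lemma two_pow_ceil_logb_le {x : ℝ} (hx : 1 ≤ x) : 2 ^ ⌈Real.logb 2 x⌉₊ ≤ 2 * x := by
  have h0 : 0 ≤ Real.logb 2 x := Real.logb_nonneg (by norm_num) hx
  calc (2 : ℝ) ^ ⌈Real.logb 2 x⌉₊ = (2 : ℝ) ^ ((⌈Real.logb 2 x⌉₊ : ℕ) : ℝ) :=
        (Real.rpow_natCast _ _).symm
    _ ≤ (2 : ℝ) ^ (Real.logb 2 x + 1) :=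
      Real.rpow_le_rpow_of_exponent_le (by norm_num) (Nat.ceil_lt_add_one h0).le
    _ = 2 * x := by
      rw [Real.rpow_add (by norm_num), Real.rpow_logb (by norm_num) (by norm_num) (by linarith)]
      simp [mul_comm]

/-- The scale `L² / ε²` of the number of columns recovered for one magnitude level. -/
def Params.T {n : ℕ} (P : Params n) : ℝ := (P.L : ℝ) ^ 2 / P.ε ^ 2

/-- The relative error of the estimates of recovered columns. -/
def Params.slack {n : ℕ} (P : Params n) : ℝ := P.ε / (10 ^ 5 * P.L)

/-- The threshold for the energy of the noise in `𝓓_l`. -/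
def tauSq {n : ℕ} (P : Params n) (A : Matrix (Fin n) (Fin n) ℝ) (l : Fin (P.Lhat + 1)) : ℝ :=
  400 * P.L * totalEnergy A / (2 ^ (l : ℕ) * (1 / 2000) ^ 2 * P.w l)

namespace Setting

variable {n : ℕ} {P : Params n} {A : Matrix (Fin n) (Fin n) ℝ} (S : Setting P A)
include S

lemma L_pos : 0 < (P.L : ℝ) := lt_of_lt_of_le (by norm_num) S.L_ge

lemma K_pos : 0 < P.K := lt_of_lt_of_le one_pos S.one_le_K

lemma Mhat_pos : 0 < P.Mhat := S.M_pos.trans_le S.le_Mhat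

lemma ε_lt_one : P.ε < 1 := S.ε_le.trans_lt (by norm_num)

lemma one_le_n : (1 : ℝ) ≤ n := by exact_mod_cast S.n_pos

lemma T_pos : 0 < P.T := div_pos (pow_pos S.L_pos 2) (pow_pos S.ε_pos 2)

lemma le_two_pow_L : P.K * n / P.ε ≤ 2 ^ P.L := by
  have := S.one_le_n
  exact le_two_pow_ceil_logb (div_pos (mul_pos S.K_pos (by linarith)) S.ε_pos)

lemma n_le : (n : ℝ) ≤ 2 ^ P.Lhat := le_two_pow_ceil_logb (by linarith [S.one_le_n])

lemma Lhat_le : P.Lhat ≤ P.L := by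
  apply Nat.ceil_le_ceil
  have h1 := S.one_le_n
  apply Real.logb_le_logb_of_le (by norm_num) (by linarith)
  rw [le_div_iff₀ S.ε_pos]
  nlinarith [S.one_le_K, S.ε_lt_one, S.ε_pos, mul_nonneg (by linarith : (0 : ℝ) ≤ n)
    (sub_nonneg.mpr S.one_le_K)]

lemma log_inv_ε_le : Real.log (1 / P.ε) ≤ P.L := by
  have h1 := S.one_le_n
  have hε := S.ε_pos
  have hε1 := S.ε_lt_one
  have h2 : Real.logb 2 (P.K * n / P.ε) ≤ P.L := Nat.le_ceil _
  have h3 : Real.logb 2 (1 / P.ε) ≤ Real.logb 2 (P.K * n / P.ε) := by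
    apply Real.logb_le_logb_of_le (by norm_num) (by positivity)
    gcongr
    nlinarith [S.one_le_K]
  have h4 : Real.log (1 / P.ε) ≤ Real.logb 2 (1 / P.ε) := by
    unfold Real.logb
    have h5 : 0 ≤ Real.log (1 / P.ε) := Real.log_nonneg (by rw [le_div_iff₀ hε]; linarith)
    rw [le_div_iff₀ (Real.log_pos (by norm_num))]
    nlinarith [Real.log_two_lt_d9]
  linarith

lemma one_le_j0_arg : 1 ≤ 4 * P.K * (P.L : ℝ) ^ 3 / P.ε ^ 3 := by
  rw [le_div_iff₀ (pow_pos S.ε_pos 3), one_mul]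
  have h1 : P.ε ^ 3 ≤ 1 := pow_le_one₀ S.ε_pos.le S.ε_lt_one.le
  have h2 : (1 : ℝ) ≤ (P.L : ℝ) ^ 3 := one_le_pow₀ (le_trans (by norm_num) S.L_ge)
  nlinarith [S.one_le_K]

lemma le_two_pow_j0 : 4 * P.K * (P.L : ℝ) ^ 3 / P.ε ^ 3 ≤ 2 ^ P.j0 :=
  le_two_pow_ceil_logb (lt_of_lt_of_le one_pos S.one_le_j0_arg)

lemma two_pow_j0_le : 2 ^ P.j0 ≤ 8 * P.K * (P.L : ℝ) ^ 3 / P.ε ^ 3 := by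
  refine (two_pow_ceil_logb_le S.one_le_j0_arg).trans (le_of_eq ?_)
  ring

lemma le_w (l : Fin (P.Lhat + 1)) : 10 ^ 24 * (P.L : ℝ) ^ 6 / P.ε ^ 6 ≤ P.w l := by
  refine le_trans ?_ (Nat.le_ceil _)
  have hL := S.L_pos
  have hε := S.ε_pos
  have hK := S.K_pos
  rw [S.cw_eq, S.ν_eq]
  unfold Params.φ
  rw [S.cφ_eq]
  split_ifs
  · have h1 : (1 : ℝ) ≤ P.K ^ 2 := one_le_pow₀ S.one_le_K
    calc 10 ^ 24 * (P.L : ℝ) ^ 6 / P.ε ^ 6 ≤ P.K ^ 2 * (10 ^ 24 * (P.L : ℝ) ^ 6 / P.ε ^ 6) :=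
          le_mul_of_one_le_left (by positivity) h1
      _ = _ := by field_simp
  · apply le_of_eq
    field_simp

lemma le_w_zero : 10 ^ 24 * P.K ^ 2 * (P.L : ℝ) ^ 6 / P.ε ^ 6 ≤ P.w 0 := by
  refine le_trans ?_ (Nat.le_ceil _)
  have hL := S.L_pos
  have hε := S.ε_pos
  have hK := S.K_pos
  rw [S.cw_eq, S.ν_eq]
  unfold Params.φ
  rw [S.cφ_eq, if_pos rfl]
  apply le_of_eq
  field_simp

lemma w_pos (l : Fin (P.Lhat + 1)) : 0 < (P.w l : ℝ) := by
  have hL := S.L_pos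
  have hε := S.ε_pos
  exact lt_of_lt_of_le (by positivity) (S.le_w l)

lemma le_listSize : 200 * P.K * (P.L : ℝ) ^ 3 / P.ε ^ 3 ≤ P.listSize := by
  have := Nat.le_ceil (P.cList * (P.L : ℝ) ^ 3 / P.ε ^ 3)
  rw [S.cList_eq] at this
  refine this.trans (le_of_eq ?_)
  rw [Params.listSize, S.cList_eq]

lemma R_le : (P.R : ℝ) ≤ 3 * P.L := by
  have h1 := S.one_le_n
  have hL := S.L_ge
  have e : (n : ℝ) / P.δ = n * (P.Lhat + 1) := by rw [Params.δ]; simp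
  have h2 : Real.log n ≤ P.Lhat := by
    calc Real.log n ≤ Real.log (2 ^ P.Lhat) := Real.log_le_log (by linarith) S.n_le
      _ = P.Lhat * Real.log 2 := Real.log_pow _ _
      _ ≤ P.Lhat * 1 := by gcongr; linarith [Real.log_two_lt_d9]
      _ = P.Lhat := mul_one _
  have h3 : Real.log ((P.Lhat : ℝ) + 1) ≤ P.Lhat := by
    have := Real.log_le_sub_one_of_pos (x := (P.Lhat : ℝ) + 1) (by positivity)
    linarith
  have h4 : Real.log (n * ((P.Lhat : ℝ) + 1)) ≤ 2 * P.L := by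
    rw [Real.log_mul (by positivity) (by positivity)]
    have : (P.Lhat : ℝ) ≤ P.L := by exact_mod_cast S.Lhat_le
    linarith
  have h5 : 0 ≤ Real.log (n * ((P.Lhat : ℝ) + 1)) := Real.log_nonneg (by nlinarith [Nat.cast_nonneg (α := ℝ) P.Lhat])
  have h6 := (Nat.ceil_lt_add_one h5).le
  unfold Params.R
  rw [S.cR_eq, one_mul, e]
  push_cast
  rw [max_le_iff]
  constructor <;> linarith

lemma tauSq_pos (l : Fin (P.Lhat + 1)) : 0 < tauSq P A l := by
  have := S.w_pos l
  have := S.L_pos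
  have := S.M_pos
  unfold tauSq
  positivity

/-- Of the factor `L⁶/ε⁶` in the number of buckets, one `L` pays for the factor `400 L` allowed in
the surviving energy. -/
lemma tauSq_le (l : Fin (P.Lhat + 1)) :
    tauSq P A l ≤ 2 / 10 ^ 15 * P.ε ^ 6 / (P.L : ℝ) ^ 5 * (totalEnergy A / 2 ^ (l : ℕ)) := by
  have hL := S.L_pos
  have hε := S.ε_pos
  have hM := S.M_pos
  have hw := S.le_w l
  unfold tauSq
  calc 400 * P.L * totalEnergy A / (2 ^ (l : ℕ) * (1 / 2000) ^ 2 * P.w l)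
      ≤ 400 * P.L * totalEnergy A /
          (2 ^ (l : ℕ) * (1 / 2000) ^ 2 * (10 ^ 24 * (P.L : ℝ) ^ 6 / P.ε ^ 6)) := by gcongr
    _ = (400 * 2000 ^ 2 / 10 ^ 24) *
        (P.ε ^ 6 / (P.L : ℝ) ^ 5 * (totalEnergy A / 2 ^ (l : ℕ))) := by
      field_simp
    _ ≤ 2 / 10 ^ 15 * (P.ε ^ 6 / (P.L : ℝ) ^ 5 * (totalEnergy A / 2 ^ (l : ℕ))) :=
      mul_le_mul_of_nonneg_right (by norm_num) (by positivity)
    _ = _ := by ring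

/-- The extra `K²` is needed because the magnitudes handled at level `0` are only known to exceed a
multiple of `ε³ M / (K L³)`. -/
lemma tauSq_zero_le :
    tauSq P A 0 ≤ 2 / 10 ^ 15 * P.ε ^ 6 / (P.L : ℝ) ^ 5 * (totalEnergy A / P.K ^ 2) := by
  have hL := S.L_pos
  have hε := S.ε_pos
  have hM := S.M_pos
  have hK := S.K_pos
  have hw := S.le_w_zero
  unfold tauSq
  calc 400 * P.L * totalEnergy A / (2 ^ ((0 : Fin (P.Lhat + 1)) : ℕ) * (1 / 2000) ^ 2 * P.w 0)
      ≤ 400 * P.L * totalEnergy A / (2 ^ ((0 : Fin (P.Lhat + 1)) : ℕ) * (1 / 2000) ^ 2 *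
          (10 ^ 24 * P.K ^ 2 * (P.L : ℝ) ^ 6 / P.ε ^ 6)) := by gcongr
    _ = (400 * 2000 ^ 2 / 10 ^ 24) *
        (P.ε ^ 6 / (P.L : ℝ) ^ 5 * (totalEnergy A / P.K ^ 2)) := by
      simp only [Fin.val_zero, pow_zero]
      field_simp
    _ ≤ 2 / 10 ^ 15 * (P.ε ^ 6 / (P.L : ℝ) ^ 5 * (totalEnergy A / P.K ^ 2)) :=
      mul_le_mul_of_nonneg_right (by norm_num) (by positivity)
    _ = _ := by ring

lemma slack_pos : 0 < P.slack := by
  have hL := S.L_pos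
  have hε := S.ε_pos
  unfold Params.slack
  positivity

lemma slack_le : P.slack ≤ P.ε / 10 ^ 10 := by
  have hε := S.ε_pos
  unfold Params.slack
  have := S.L_ge
  gcongr
  linarith

end Setting

/-! ### Magnitude levels -/

section Magnitudes

variable {n : ℕ} (P : Params n) (A : Matrix (Fin n) (Fin n) ℝ)

/-- The lower end of magnitude level `j`. -/
def mag (z : ℝ) (j : ℕ) : ℝ := z * P.Mhat / 2 ^ j

/-- The columns that can possibly be recovered for magnitude level `j`. -/
def outer (z : ℝ) (j : ℕ) : Finset (Fin n) :=
  {k | (1 + P.ε - P.slack) * mag P z j ≤ energy (col A k) ∧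
    energy (col A k) ≤ (2 - P.ε + P.slack) * mag P z j}

/-- The columns that are recovered for magnitude level `j` when they survive. -/
def inner (z : ℝ) (j : ℕ) : Finset (Fin n) :=
  {k | (1 + P.ε + P.slack) * mag P z j ≤ energy (col A k) ∧
    energy (col A k) ≤ (2 - P.ε - P.slack) * mag P z j}

/-- The columns whose energy is not far below magnitude level `j`, or larger. -/
def above (z : ℝ) (j : ℕ) : Finset (Fin n) := {k | mag P z j / 2 ≤ energy (col A k)}

variable {P}

/-- The number of columns of `G` that survive at level `l`. -/
def surv (κ : Fin (P.Lhat + 1) → Fin n → Bool) (l : Fin (P.Lhat + 1)) (G : Finset (Fin n)) : ℕ :=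
  (G.filter fun k => κ l k = true).card

/-- The survival indicators behave as expected. -/
structure GoodSample (z : ℝ) (κ : Fin (P.Lhat + 1) → Fin n → Bool) : Prop where
  zero : ∀ k, κ 0 k = true
  mass : ∀ l : Fin (P.Lhat + 1), ∑ m with κ l m = true, energy (col A m) ≤ 400 * P.L * totalEnergy A / 2 ^ (l : ℕ)
  outer_le : ∀ l : Fin (P.Lhat + 1), ∀ j ≤ P.L,
    (surv κ l (outer P A z j) : ℝ) ≤ 2 * ((outer P A z j).card / 2 ^ (l : ℕ)) + P.T / 4
  above_le : ∀ l : Fin (P.Lhat + 1), ∀ j ≤ P.L,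
    (surv κ l (above P A z j) : ℝ) ≤ 2 * ((above P A z j).card / 2 ^ (l : ℕ)) + P.T / 4
  outer_dev : ∀ l : Fin (P.Lhat + 1), ∀ j ≤ P.L, ((outer P A z j).card / 2 ^ (l : ℕ) : ℝ) ≤ 4 * P.T →
    |(surv κ l (outer P A z j) : ℝ) - (outer P A z j).card / 2 ^ (l : ℕ)| ≤ P.ε * P.T / 2
  inner_dev : ∀ l : Fin (P.Lhat + 1), ∀ j ≤ P.L, ((inner P A z j).card / 2 ^ (l : ℕ) : ℝ) ≤ 4 * P.T →
    |(surv κ l (inner P A z j) : ℝ) - (inner P A z j).card / 2 ^ (l : ℕ)| ≤ P.ε * P.T / 2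

/-- The random choices of the seed behave as expected. -/
structure Good (s : Seed P) : Prop where
  scale : s.ζ ∈ Set.Icc (1 / 2 : ℝ) 1
  sample : GoodSample A s.ζ s.keep
  noise : ¬ SomeNoisy A (tauSq P A) s s.keep

/-- The noise of `𝓓_l` is small enough for magnitude level `j`. -/
def Resolvable (z : ℝ) (l : Fin (P.Lhat + 1)) (j : ℕ) : Prop :=
  tauSq P A l ≤ (P.slack / 4) ^ 2 * mag P z j

end Magnitudes

/-- Factor `x - y = (√x - √y)(√x + √y)`; the second factor is at most `4 √a` once `x ≤ 2 a`. Only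
one of the two numbers needs an upper bound, so the lemma serves both for a known estimate and for a
known energy. -/
lemma abs_sub_le_of_abs_sqrt_sub_le {x y a c : ℝ} (hx : 0 ≤ x) (hy : 0 ≤ y) (ha : 0 ≤ a)
    (hc : 0 ≤ c) (hc1 : c ≤ 1) (h : |√x - √y| ≤ c / 4 * √a) (hxa : x ≤ 2 * a) :
    |x - y| ≤ c * a := by
  have hs := Real.sqrt_nonneg a
  have hu := Real.sqrt_nonneg x
  have hv := Real.sqrt_nonneg y
  have hu2 : √x ≤ 3 / 2 * √a := by
    rw [← abs_of_nonneg hu, ← abs_of_nonneg (by positivity : 0 ≤ 3 / 2 * √a), ← sq_le_sq,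
      Real.sq_sqrt hx, mul_pow, Real.sq_sqrt ha]
    linarith
  have hv2 : √y ≤ 7 / 4 * √a := by
    have := (abs_le.mp h).1
    nlinarith
  have e : x - y = (√x - √y) * (√x + √y) := by
    ring_nf
    rw [Real.sq_sqrt hx, Real.sq_sqrt hy]
  rw [e, abs_mul, abs_of_nonneg (by positivity : 0 ≤ √x + √y)]
  calc |√x - √y| * (√x + √y) ≤ (c / 4 * √a) * (4 * √a) := by
        apply mul_le_mul h (by linarith) (by positivity) (by positivity)
    _ = c * √a ^ 2 := by ring
    _ = c * a := by rw [Real.sq_sqrt ha]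

/-! ### Which columns are recovered on a good seed -/

section Recovery

variable {n : ℕ} {P : Params n} {A : Matrix (Fin n) (Fin n) ℝ} (S : Setting P A)
include S

lemma Setting.mag_pos {z : ℝ} (hz : z ∈ Set.Icc (1 / 2 : ℝ) 1) (j : ℕ) : 0 < mag P z j := by
  have := S.Mhat_pos
  have : 0 < z := by linarith [hz.1]
  unfold mag
  positivity

variable {s : Seed P} (hs : Good A s)
include hs

lemma Good.abs_sqrt_sub_le {l : Fin (P.Lhat + 1)} {j : ℕ} (hr : Resolvable A s.ζ l j)
    {k : Fin n} (hk : s.keep l k = true) :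
    |√(s.est A l k) - √(energy (col A k))| ≤ P.slack / 4 * √(mag P s.ζ j) := by
  have h1 := abs_sqrt_est_sub_le s A l k hk (τ := tauSq P A l) fun h => hs.noise ⟨l, k, h⟩
  refine h1.trans ?_
  have := S.slack_pos
  rw [← Real.sqrt_sq (by positivity : 0 ≤ P.slack / 4), ← Real.sqrt_mul (sq_nonneg _)]
  exact Real.sqrt_le_sqrt hr

lemma Good.abs_sub_le_of_est_le {l : Fin (P.Lhat + 1)} {j : ℕ} (hr : Resolvable A s.ζ l j)
    {k : Fin n} (hk : s.keep l k = true) (h : s.est A l k ≤ 2 * mag P s.ζ j) :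
    |s.est A l k - energy (col A k)| ≤ P.slack * mag P s.ζ j :=
  abs_sub_le_of_abs_sqrt_sub_le (energy_nonneg _) (energy_nonneg _) (S.mag_pos hs.scale j).le
    S.slack_pos.le (by linarith [S.slack_le, S.ε_lt_one, S.ε_pos]) (hs.abs_sqrt_sub_le S hr hk) h

lemma Good.abs_sub_le_of_energy_le {l : Fin (P.Lhat + 1)} {j : ℕ} (hr : Resolvable A s.ζ l j)
    {k : Fin n} (hk : s.keep l k = true) (h : energy (col A k) ≤ 2 * mag P s.ζ j) :
    |s.est A l k - energy (col A k)| ≤ P.slack * mag P s.ζ j := by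
  rw [abs_sub_comm]
  refine abs_sub_le_of_abs_sqrt_sub_le (energy_nonneg _) (energy_nonneg _)
    (S.mag_pos hs.scale j).le
    S.slack_pos.le (by linarith [S.slack_le, S.ε_lt_one, S.ε_pos]) ?_ h
  rw [abs_sub_comm]
  exact hs.abs_sqrt_sub_le S hr hk

lemma keep_of_mem_heavy {l : Fin (P.Lhat + 1)} {k : Fin n} (h : k ∈ s.heavy A l) :
    s.keep l k = true := by
  simp only [Seed.heavy, Finset.mem_filter] at h
  exact h.2.1

omit S hs in
lemma mem_band_iff {l : Fin (P.Lhat + 1)} {j : ℕ} {k : Fin n} : k ∈ s.band A l j ↔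
    k ∈ s.heavy A l ∧ (1 + P.ε) * mag P s.ζ j ≤ s.est A l k ∧
      s.est A l k ≤ (2 - P.ε) * mag P s.ζ j := by
  simp only [Seed.band, Finset.mem_filter, mag]
  refine and_congr_right fun _ => ?_
  rw [show (1 + P.ε) * s.ζ * P.Mhat / 2 ^ j = (1 + P.ε) * (s.ζ * P.Mhat / 2 ^ j) by ring,
    show (2 - P.ε) * s.ζ * P.Mhat / 2 ^ j = (2 - P.ε) * (s.ζ * P.Mhat / 2 ^ j) by ring]

lemma Good.abs_sub_le_of_mem_band {l : Fin (P.Lhat + 1)} {j : ℕ} (hr : Resolvable A s.ζ l j)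
    {k : Fin n} (hk : k ∈ s.band A l j) :
    |s.est A l k - energy (col A k)| ≤ P.slack * mag P s.ζ j := by
  rw [mem_band_iff] at hk
  refine hs.abs_sub_le_of_est_le S hr (keep_of_mem_heavy S hs hk.1) (hk.2.2.trans ?_)
  have := S.mag_pos hs.scale j
  have := S.ε_pos
  nlinarith

/-- One half of the sandwich between the survivors of `inner` and of `outer`; the other half is
`Good.mem_band`, which also needs the list to be long enough. -/
lemma Good.band_subset {l : Fin (P.Lhat + 1)} {j : ℕ} (hr : Resolvable A s.ζ l j) :
    s.band A l j ⊆ (outer P A s.ζ j).filter fun k => s.keep l k = true := by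
  intro k hk
  have h1 := abs_le.mp (hs.abs_sub_le_of_mem_band S hr hk)
  rw [mem_band_iff] at hk
  simp only [outer, Finset.mem_filter, Finset.mem_univ, true_and]
  refine ⟨⟨?_, ?_⟩, keep_of_mem_heavy S hs hk.1⟩
  · linarith [h1.2]
  · linarith [h1.1]

/-- Any column ranked before `k` also has an estimate of at least `mag`, hence `√energy ≥ (3/4)
√mag`, and `9/16 > 1/2` puts it in `above`. So the rank of `k` is less than the list size. -/
lemma Good.mem_heavy {l : Fin (P.Lhat + 1)} {j : ℕ} (hr : Resolvable A s.ζ l j)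
    (hsize : surv s.keep l (above P A s.ζ j) < P.listSize) {k : Fin n} (hk : s.keep l k = true)
    (h : mag P s.ζ j ≤ s.est A l k) : k ∈ s.heavy A l := by
  classical
  simp only [Seed.heavy, Finset.mem_filter, Finset.mem_univ, true_and]
  refine ⟨hk, lt_of_le_of_lt (Finset.card_le_card ?_) hsize⟩
  intro m hm
  simp only [above, Finset.mem_filter, Finset.mem_univ, true_and] at hm ⊢
  refine ⟨?_, hm.1⟩
  have h1 : mag P s.ζ j ≤ s.est A l m := by
    rcases hm.2 with h2 | h2
    · linarith
    · linarith [h2.1]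
  have h3 := (abs_le.mp (hs.abs_sqrt_sub_le S hr hm.1)).2
  have ha := S.mag_pos hs.scale j
  have hsl := S.slack_pos
  have h4 : √(mag P s.ζ j) ≤ √(s.est A l m) := Real.sqrt_le_sqrt h1
  have h5 : 3 / 4 * √(mag P s.ζ j) ≤ √(energy (col A m)) := by
    have : P.slack ≤ 1 := by linarith [S.slack_le, S.ε_lt_one, S.ε_pos]
    nlinarith [Real.sqrt_nonneg (mag P s.ζ j)]
  have h6 := pow_le_pow_left₀ (by positivity) h5 2
  rw [Real.sq_sqrt (energy_nonneg _), mul_pow, Real.sq_sqrt ha.le] at h6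
  linarith

lemma Good.mem_band {l : Fin (P.Lhat + 1)} {j : ℕ} (hr : Resolvable A s.ζ l j)
    (hsize : surv s.keep l (above P A s.ζ j) < P.listSize) {k : Fin n} (hk : s.keep l k = true)
    (h : k ∈ inner P A s.ζ j) : k ∈ s.band A l j := by
  have ha := S.mag_pos hs.scale j
  have hε := S.ε_pos
  have hsl := S.slack_pos
  simp only [inner, Finset.mem_filter, Finset.mem_univ, true_and] at h
  have h1 := abs_le.mp (hs.abs_sub_le_of_energy_le S hr hk (by nlinarith))
  have h2 : (1 + P.ε) * mag P s.ζ j ≤ s.est A l k := by linarith [h1.1]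
  rw [mem_band_iff]
  exact ⟨hs.mem_heavy S hr hsize hk (by nlinarith), h2, by linarith [h1.2]⟩

end Recovery

/-! ### Sums over magnitude levels -/

section Levels

variable {n : ℕ} {P : Params n} {A : Matrix (Fin n) (Fin n) ℝ} (S : Setting P A)
include S

omit S in
lemma mag_two_mul_le {z : ℝ} (hz : 0 ≤ z * P.Mhat) {j j' : ℕ} (h : j < j') :
    2 * mag P z j' ≤ mag P z j := by
  unfold mag
  rw [← mul_div_assoc, div_le_div_iff₀ (by positivity) (by positivity)]
  have : (2 : ℝ) ^ (j + 1) ≤ 2 ^ j' := pow_le_pow_right₀ (by norm_num) h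
  calc 2 * (z * P.Mhat) * 2 ^ j = z * P.Mhat * 2 ^ (j + 1) := by ring
    _ ≤ z * P.Mhat * 2 ^ j' := mul_le_mul_of_nonneg_left this hz

variable {z : ℝ} (hz : z ∈ Set.Icc (1 / 2 : ℝ) 1)
include hz

lemma Setting.scale_mul_Mhat_pos : 0 < z * P.Mhat :=
  mul_pos (by linarith [hz.1]) S.Mhat_pos

lemma mem_outer_bounds {j : ℕ} {k : Fin n} (hk : k ∈ outer P A z j) :
    mag P z j < energy (col A k) ∧ energy (col A k) < 2 * mag P z j := by
  have ha := S.mag_pos hz j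
  have hsl := S.slack_le
  have hε := S.ε_pos
  simp only [outer, Finset.mem_filter, Finset.mem_univ, true_and] at hk
  constructor <;> nlinarith [hk.1, hk.2]

lemma inner_subset_outer (j : ℕ) : inner P A z j ⊆ outer P A z j := by
  intro k hk
  have ha := S.mag_pos hz j
  have hsl := S.slack_pos
  simp only [outer, inner, Finset.mem_filter, Finset.mem_univ, true_and] at hk ⊢
  constructor <;> nlinarith [hk.1, hk.2]

lemma disjoint_outer {j j' : ℕ} (h : j ≠ j') : Disjoint (outer P A z j) (outer P A z j') := by
  wlog hlt : j < j' generalizing j j'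
  · exact (this h.symm (lt_of_le_of_ne (not_lt.mp hlt) h.symm)).symm
  rw [Finset.disjoint_left]
  intro k h1 h2
  have h3 := mem_outer_bounds S hz h1
  have h4 := mem_outer_bounds S hz h2
  have h5 := mag_two_mul_le (P := P) (S.scale_mul_Mhat_pos hz).le hlt
  linarith [h3.1, h4.2]

lemma sum_outer_le (J : Finset ℕ) :
    ∑ j ∈ J, ∑ k ∈ outer P A z j, energy (col A k) ≤ totalEnergy A := by
  rw [← Finset.sum_biUnion fun j _ j' _ h => disjoint_outer S hz h]
  exact Finset.sum_le_sum_of_subset_of_nonneg (Finset.subset_univ _) fun _ _ _ => energy_nonneg _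

lemma card_outer_mul_mag_le (j : ℕ) :
    (outer P A z j).card * mag P z j ≤ ∑ k ∈ outer P A z j, energy (col A k) := by
  rw [← nsmul_eq_mul]
  exact Finset.card_nsmul_le_sum _ _ _ fun k hk => (mem_outer_bounds S hz hk).1.le

lemma sum_outer_le_card (j : ℕ) :
    ∑ k ∈ outer P A z j, energy (col A k) ≤ 2 * ((outer P A z j).card * mag P z j) := by
  have := Finset.sum_le_card_nsmul _ _ _ fun k hk =>
    (mem_outer_bounds S hz (A := A) (j := j) hk).2.le
  rw [nsmul_eq_mul] at this
  linarith

lemma card_outer_mul_mag_le_total (j : ℕ) :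
    (outer P A z j).card * mag P z j ≤ totalEnergy A := by
  have := sum_outer_le S hz {j}
  rw [Finset.sum_singleton] at this
  exact (card_outer_mul_mag_le S hz j).trans this

lemma card_above_mul_mag_le (j : ℕ) :
    (above P A z j).card * mag P z j ≤ 2 * totalEnergy A := by
  have h1 := Finset.card_nsmul_le_sum (above P A z j) (fun k => energy (col A k)) (mag P z j / 2)
    fun k hk => by simpa [above] using hk
  have h2 : ∑ k ∈ above P A z j, energy (col A k) ≤ totalEnergy A :=
    Finset.sum_le_sum_of_subset_of_nonneg (Finset.subset_univ _) fun _ _ _ => energy_nonneg _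
  rw [nsmul_eq_mul] at h1
  linarith

omit S hz in
lemma surv_le_card (κ : Fin (P.Lhat + 1) → Fin n → Bool) (l : Fin (P.Lhat + 1))
    (G : Finset (Fin n)) : surv κ l G ≤ G.card := Finset.card_filter_le _ _

/-! ### Level `0` -/

lemma mag_ge_of_le_j0 {j : ℕ} (hj : j ≤ P.j0) :
    P.ε ^ 3 / (16 * P.K * (P.L : ℝ) ^ 3) * totalEnergy A ≤ mag P z j := by
  have hε := S.ε_pos
  have hL := S.L_pos
  have hK := S.K_pos
  have hM := S.M_pos
  have h1 : (2 : ℝ) ^ j ≤ 8 * P.K * (P.L : ℝ) ^ 3 / P.ε ^ 3 :=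
    (pow_le_pow_right₀ (by norm_num) hj).trans S.two_pow_j0_le
  unfold mag
  rw [le_div_iff₀ (by positivity)]
  calc P.ε ^ 3 / (16 * P.K * (P.L : ℝ) ^ 3) * totalEnergy A * 2 ^ j
      ≤ P.ε ^ 3 / (16 * P.K * (P.L : ℝ) ^ 3) * totalEnergy A *
        (8 * P.K * (P.L : ℝ) ^ 3 / P.ε ^ 3) := by gcongr
    _ = 1 / 2 * totalEnergy A := by field_simp; norm_num
    _ ≤ z * P.Mhat := mul_le_mul hz.1 S.le_Mhat hM.le (by linarith [hz.1])

/-- For `j ≤ j0` the magnitude is at least `ε³ M / (16 K L³)`; times `slack²`, of order `ε²/L²`,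
this still dominates the noise threshold, of order `ε⁶ M / (K² L⁵)`. -/
lemma resolvable_zero {j : ℕ} (hj : j ≤ P.j0) : Resolvable (P := P) A z 0 j := by
  have hε := S.ε_pos
  have hL := S.L_pos
  have hK := S.K_pos
  have hM := S.M_pos
  unfold Resolvable
  refine S.tauSq_zero_le.trans ?_
  refine le_trans ?_ (mul_le_mul_of_nonneg_left (mag_ge_of_le_j0 S hz hj) (sq_nonneg _))
  have e1 : 2 / 10 ^ 15 * P.ε ^ 6 / (P.L : ℝ) ^ 5 * (totalEnergy A / P.K ^ 2) =
      (2 / 10 ^ 15 * (P.ε / P.K)) * (P.ε ^ 5 / (P.K * (P.L : ℝ) ^ 5) * totalEnergy A) := by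
    field_simp
  have e2 : (P.slack / 4) ^ 2 * (P.ε ^ 3 / (16 * P.K * (P.L : ℝ) ^ 3) * totalEnergy A) =
      (1 / (10 ^ 10 * 256)) * (P.ε ^ 5 / (P.K * (P.L : ℝ) ^ 5) * totalEnergy A) := by
    unfold Params.slack
    field_simp
    norm_num
  rw [e1, e2]
  refine mul_le_mul_of_nonneg_right ?_ (by positivity)
  have : P.ε / P.K ≤ 1 / 10 ^ 6 := by
    rw [div_le_iff₀ hK]
    linarith [S.ε_le, S.one_le_K]
  linarith

/-- Nothing is gained from subsampling at level `0`: the total number of columns above the magnitude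
is already at most `32 K L³/ε³`. This is why the list size is proportional to `K`. -/
lemma surv_above_zero_lt {j : ℕ} (hj : j ≤ P.j0) (κ : Fin (P.Lhat + 1) → Fin n → Bool) :
    surv κ 0 (above P A z j) < P.listSize := by
  have hε := S.ε_pos
  have hL := S.L_pos
  have hK := S.K_pos
  have hM := S.M_pos
  have h1 := card_above_mul_mag_le S hz j
  have h2 := mag_ge_of_le_j0 S hz hj
  have h3 : ((above P A z j).card : ℝ) ≤ 32 * P.K * (P.L : ℝ) ^ 3 / P.ε ^ 3 := by
    have h4 := (mul_le_mul_of_nonneg_left h2 (Nat.cast_nonneg (above P A z j).card)).trans h1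
    have e : ((above P A z j).card : ℝ) * (P.ε ^ 3 / (16 * P.K * (P.L : ℝ) ^ 3) * totalEnergy A) =
      ((above P A z j).card * (P.ε ^ 3 / (16 * P.K * (P.L : ℝ) ^ 3))) * totalEnergy A := by ring
    rw [e] at h4
    have h5 := le_of_mul_le_mul_right h4 hM
    rw [← mul_div_assoc, div_le_iff₀ (by positivity)] at h5
    rw [le_div_iff₀ (by positivity)]
    linarith
  have h6 := S.le_listSize
  have h7 : 32 * P.K * (P.L : ℝ) ^ 3 / P.ε ^ 3 < 200 * P.K * (P.L : ℝ) ^ 3 / P.ε ^ 3 := by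
    gcongr
    norm_num
  have h8 : ((above P A z j).card : ℝ) < P.listSize := by linarith
  exact lt_of_le_of_lt (surv_le_card κ 0 _) (by exact_mod_cast h8)

/-! ### Usable magnitude levels -/

omit S hz in
/-- Magnitude level `j` contributes substantially, and few columns are near its ends. -/
structure Usable {n : ℕ} (P : Params n) (A : Matrix (Fin n) (Fin n) ℝ) (z : ℝ) (j : ℕ) : Prop where
  le_sum : P.ε / (2 * P.L) * totalEnergy A ≤ ∑ k ∈ outer P A z j, energy (col A k)
  le_card : (1 - P.ε) * (outer P A z j).card ≤ (inner P A z j).card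

lemma Usable.total_le {j : ℕ} (hu : Usable P A z j) :
    totalEnergy A ≤ 4 * P.L / P.ε * ((outer P A z j).card * mag P z j) := by
  have hε := S.ε_pos
  have hL := S.L_pos
  have h := hu.le_sum.trans (sum_outer_le_card S hz j)
  rw [div_mul_eq_mul_div, div_le_iff₀ (by positivity)] at h
  rw [div_mul_eq_mul_div, le_div_iff₀ (by positivity)]
  linarith

/-- Beyond `j0` a column has energy of order at most `ε³ M / L³`, so a level that carries `ε M /
(2L)` must contain at least `2 L²/ε²` columns. -/
lemma Usable.two_mul_T_le {j : ℕ} (hu : Usable P A z j) (hj : P.j0 < j) :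
    2 * P.T ≤ (outer P A z j).card := by
  have hε := S.ε_pos
  have hL := S.L_pos
  have hK := S.K_pos
  have hM := S.M_pos
  have h1 := hu.total_le S hz
  have h2 : mag P z j ≤ P.ε ^ 3 / (8 * (P.L : ℝ) ^ 3) * totalEnergy A := by
    unfold mag
    rw [div_le_iff₀ (by positivity)]
    have h3 : 8 * P.K * (P.L : ℝ) ^ 3 / P.ε ^ 3 ≤ 2 ^ j := by
      calc 8 * P.K * (P.L : ℝ) ^ 3 / P.ε ^ 3 = 2 * (4 * P.K * (P.L : ℝ) ^ 3 / P.ε ^ 3) := by ring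
        _ ≤ 2 * 2 ^ P.j0 := by gcongr; exact S.le_two_pow_j0
        _ = 2 ^ (P.j0 + 1) := by ring
        _ ≤ 2 ^ j := pow_le_pow_right₀ (by norm_num) hj
    calc z * P.Mhat ≤ 1 * (P.K * totalEnergy A) :=
          mul_le_mul hz.2 S.Mhat_le S.Mhat_pos.le (by norm_num)
      _ = P.ε ^ 3 / (8 * (P.L : ℝ) ^ 3) * totalEnergy A * (8 * P.K * (P.L : ℝ) ^ 3 / P.ε ^ 3) := by
        field_simp
      _ ≤ _ := by gcongr
  have h4 : totalEnergy A ≤ (4 * P.L / P.ε * (outer P A z j).card *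
      (P.ε ^ 3 / (8 * (P.L : ℝ) ^ 3))) * totalEnergy A := by
    refine h1.trans ?_
    calc 4 * P.L / P.ε * ((outer P A z j).card * mag P z j) ≤ 4 * P.L / P.ε *
        ((outer P A z j).card * (P.ε ^ 3 / (8 * (P.L : ℝ) ^ 3) * totalEnergy A)) := by gcongr
      _ = _ := by ring
  have h5 : 1 ≤ 4 * P.L / P.ε * (outer P A z j).card * (P.ε ^ 3 / (8 * (P.L : ℝ) ^ 3)) := by
    by_contra hcon
    push Not at hcon
    nlinarith
  have e : 4 * P.L / P.ε * (outer P A z j).card * (P.ε ^ 3 / (8 * (P.L : ℝ) ^ 3)) =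
      (outer P A z j).card / (2 * P.T) := by
    unfold Params.T
    field_simp
    ring
  rw [e, le_div_iff₀ (by have := S.T_pos; positivity), one_mul] at h5
  exact h5

/-- The subsampling level `ℓ` at which the number of surviving columns of magnitude level `j` is
comparable to `T`. -/
def IsCritical {n : ℕ} (P : Params n) (A : Matrix (Fin n) (Fin n) ℝ) (z : ℝ) (j ℓ : ℕ) : Prop :=
  1 ≤ ℓ ∧ ℓ ≤ P.Lhat ∧ (1 - 6 * P.ε) * P.T * 2 ^ ℓ ≤ (outer P A z j).card ∧
    (outer P A z j).card < (1 - 6 * P.ε) * P.T * 2 ^ (ℓ + 1)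

omit hz in
lemma Setting.le_ε_mul_T : 10 ^ 6 ≤ P.ε * P.T := by
  have hε := S.ε_pos
  have hL := S.L_ge
  unfold Params.T
  rw [← mul_div_assoc, le_div_iff₀ (by positivity)]
  have h1 : P.ε ^ 2 * 10 ^ 6 ≤ P.ε * 1 := by nlinarith [S.ε_le]
  have h2 : (1 : ℝ) ≤ (P.L : ℝ) ^ 2 := one_le_pow₀ (by linarith)
  nlinarith

/-- Locate the size of `outer` between consecutive powers of two times `(1 - 6ε) T`. That there are
at least `2T` columns excludes `ℓ = 0`, and that there are at most `n ≤ 2^Lhat` keeps `ℓ` within the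
available levels. -/
lemma Usable.exists_isCritical {j : ℕ} (hu : Usable P A z j) (hj : P.j0 < j) :
    ∃ ℓ, IsCritical P A z j ℓ := by
  have hε := S.ε_pos
  have hε1 := S.ε_le
  have hT := S.T_pos
  have h1 := hu.two_mul_T_le S hz hj
  have hεT := S.le_ε_mul_T
  set D := (1 - 6 * P.ε) * P.T with hD
  have hDpos : 0 < D := mul_pos (by linarith) hT
  have hDT : D ≤ P.T := by nlinarith
  have hD1 : 1 ≤ D := by nlinarith
  obtain ⟨ℓ, h2, h3⟩ := exists_nat_pow_near (x := (outer P A z j).card / D) (y := 2)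
    (by rw [le_div_iff₀ hDpos]; linarith) (by norm_num)
  rw [le_div_iff₀ hDpos, mul_comm] at h2
  rw [div_lt_iff₀ hDpos, mul_comm] at h3
  refine ⟨ℓ, ?_, ?_, h2, h3⟩
  · by_contra hcon
    have : ℓ = 0 := by omega
    subst this
    simp only [zero_add, pow_one] at h3
    linarith
  · by_contra hcon
    have h4 : (2 : ℝ) ^ (P.Lhat + 1) ≤ 2 ^ ℓ := pow_le_pow_right₀ (by norm_num) (by omega)
    have h5 : ((outer P A z j).card : ℝ) ≤ n := by
      exact_mod_cast (Finset.card_le_univ _).trans (by simp)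
    have h6 := S.n_le
    have h7 : (2 : ℝ) ^ ℓ ≤ D * 2 ^ ℓ := le_mul_of_one_le_left (by positivity) hD1
    have h8 : (0 : ℝ) < 2 ^ P.Lhat := by positivity
    rw [pow_succ] at h4
    linarith

variable {j ℓ : ℕ}

lemma IsCritical.card_div_le (hc : IsCritical P A z j ℓ) {l : ℕ} (hl : ℓ ≤ l + 1) :
    ((outer P A z j).card : ℝ) / 2 ^ l ≤ 4 * P.T := by
  have hε := S.ε_pos
  have hT := S.T_pos
  rw [div_le_iff₀ (by positivity)]
  have h1 : (2 : ℝ) ^ (ℓ + 1) ≤ 2 ^ (l + 2) := pow_le_pow_right₀ (by norm_num) (by omega)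
  have h2 := hc.2.2.2
  calc ((outer P A z j).card : ℝ) ≤ (1 - 6 * P.ε) * P.T * 2 ^ (ℓ + 1) := h2.le
    _ ≤ 1 * P.T * 2 ^ (l + 2) := by
      refine mul_le_mul ?_ h1 (by positivity) (by positivity)
      exact mul_le_mul_of_nonneg_right (by linarith) hT.le
    _ = 4 * P.T * 2 ^ l := by ring

lemma Usable.total_div_le (hu : Usable P A z j) (hc : IsCritical P A z j ℓ) {l : ℕ}
    (hl : ℓ ≤ l + 1) :
    totalEnergy A / 2 ^ l ≤ 16 * (P.L : ℝ) ^ 3 / P.ε ^ 3 * mag P z j := by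
  have hε := S.ε_pos
  have hL := S.L_pos
  have ha := S.mag_pos hz j
  have h1 := hc.card_div_le S hz hl
  calc totalEnergy A / 2 ^ l
      ≤ (4 * P.L / P.ε * ((outer P A z j).card * mag P z j)) / 2 ^ l := by
        gcongr; exact hu.total_le S hz
    _ = 4 * P.L / P.ε * mag P z j * ((outer P A z j).card / 2 ^ l) := by ring
    _ ≤ 4 * P.L / P.ε * mag P z j * (4 * P.T) := by gcongr
    _ = _ := by unfold Params.T; field_simp; norm_num

/-- The bound reaches down to `ℓ - 1`, since that level may be used as well. There `M / 2^l` is at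
most `16 L³/ε³` magnitudes, so the threshold is of order `ε³/L²` magnitudes, below `slack²`. -/
lemma Usable.resolvable (hu : Usable P A z j) (hc : IsCritical P A z j ℓ)
    {l : Fin (P.Lhat + 1)} (hl : ℓ ≤ l + 1) : Resolvable A z l j := by
  have hε := S.ε_pos
  have hL := S.L_pos
  have ha := S.mag_pos hz j
  refine (S.tauSq_le l).trans ?_
  calc 2 / 10 ^ 15 * P.ε ^ 6 / (P.L : ℝ) ^ 5 * (totalEnergy A / 2 ^ (l : ℕ))
      ≤ 2 / 10 ^ 15 * P.ε ^ 6 / (P.L : ℝ) ^ 5 * (16 * (P.L : ℝ) ^ 3 / P.ε ^ 3 * mag P z j) := by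
        gcongr; exact hu.total_div_le S hz hc hl
    _ = (2 / 10 ^ 15 * 16 * P.ε) * (P.ε ^ 2 / (P.L : ℝ) ^ 2 * mag P z j) := by field_simp
    _ ≤ (1 / (10 ^ 10 * 16)) * (P.ε ^ 2 / (P.L : ℝ) ^ 2 * mag P z j) := by
        refine mul_le_mul_of_nonneg_right ?_ (by positivity)
        linarith [S.ε_le]
    _ = _ := by unfold Params.slack; field_simp; norm_num

end Levels

/-! ### The subsampling level used for a usable magnitude level -/

section GoodSeed

variable {n : ℕ} {P : Params n} {A : Matrix (Fin n) (Fin n) ℝ} (S : Setting P A)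
  {s : Seed P} (hs : Good A s) {j ℓ : ℕ}
include S hs

/-- At most `32 L³/ε³` columns of `above` are expected to survive; twice this plus `T/4` stays below
`200 K L³/ε³`. -/
lemma Usable.surv_above_lt (hu : Usable P A s.ζ j) (hc : IsCritical P A s.ζ j ℓ) (hj : j ≤ P.L)
    {l : Fin (P.Lhat + 1)} (hl : ℓ ≤ l + 1) :
    surv s.keep l (above P A s.ζ j) < P.listSize := by
  have hε := S.ε_pos
  have hL := S.L_ge
  have hK := S.one_le_K
  have ha := S.mag_pos hs.scale j
  have hX : 0 < (P.L : ℝ) ^ 3 / P.ε ^ 3 := by have := S.L_pos; positivity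
  have h1 := hs.sample.above_le l j hj
  have h2 : ((above P A s.ζ j).card : ℝ) / 2 ^ (l : ℕ) ≤ 32 * ((P.L : ℝ) ^ 3 / P.ε ^ 3) := by
    have h3 := card_above_mul_mag_le S hs.scale j
    have h4 := hu.total_div_le S hs.scale hc hl
    refine le_of_mul_le_mul_right ?_ ha
    calc ((above P A s.ζ j).card : ℝ) / 2 ^ (l : ℕ) * mag P s.ζ j
        = ((above P A s.ζ j).card * mag P s.ζ j) / 2 ^ (l : ℕ) := by ring
      _ ≤ (2 * totalEnergy A) / 2 ^ (l : ℕ) := by gcongr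
      _ = 2 * (totalEnergy A / 2 ^ (l : ℕ)) := by ring
      _ ≤ 2 * (16 * (P.L : ℝ) ^ 3 / P.ε ^ 3 * mag P s.ζ j) := by gcongr
      _ = _ := by ring
  have h5 : P.T ≤ (P.L : ℝ) ^ 3 / P.ε ^ 3 := by
    unfold Params.T
    rw [div_le_div_iff₀ (by positivity) (by positivity)]
    have : P.ε ≤ P.L := by linarith [S.ε_lt_one]
    calc (P.L : ℝ) ^ 2 * P.ε ^ 3 = ((P.L : ℝ) ^ 2 * P.ε ^ 2) * P.ε := by ring
      _ ≤ ((P.L : ℝ) ^ 2 * P.ε ^ 2) * P.L := by gcongr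
      _ = _ := by ring
  have h6 := S.le_listSize
  have h7 : 200 * ((P.L : ℝ) ^ 3 / P.ε ^ 3) ≤ 200 * P.K * (P.L : ℝ) ^ 3 / P.ε ^ 3 := by
    calc 200 * ((P.L : ℝ) ^ 3 / P.ε ^ 3) ≤ P.K * (200 * ((P.L : ℝ) ^ 3 / P.ε ^ 3)) :=
          le_mul_of_one_le_left (by positivity) hK
      _ = _ := by ring
  have h8 : (surv s.keep l (above P A s.ζ j) : ℝ) < P.listSize := by linarith
  exact_mod_cast h8

lemma Usable.filter_inner_subset (hu : Usable P A s.ζ j) (hc : IsCritical P A s.ζ j ℓ)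
    (hj : j ≤ P.L) {l : Fin (P.Lhat + 1)} (hl : ℓ ≤ l + 1) :
    (inner P A s.ζ j).filter (fun k => s.keep l k = true) ⊆ s.band A l j := by
  intro k hk
  rw [Finset.mem_filter] at hk
  exact hs.mem_band S (hu.resolvable S hs.scale hc hl) (hu.surv_above_lt S hs hc hj hl) hk.2 hk.1

lemma Usable.card_band_le (hu : Usable P A s.ζ j) (hc : IsCritical P A s.ζ j ℓ)
    (hj : j ≤ P.L) {l : Fin (P.Lhat + 1)} (hl : ℓ ≤ l + 1) :
    ((s.band A l j).card : ℝ) ≤ (outer P A s.ζ j).card / 2 ^ (l : ℕ) + P.ε * P.T / 2 := by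
  have h1 := Finset.card_le_card (hs.band_subset S (hu.resolvable S hs.scale hc hl))
  have h2 := (abs_le.mp (hs.sample.outer_dev l j hj (hc.card_div_le S hs.scale hl))).2
  have h3 : ((s.band A l j).card : ℝ) ≤ surv s.keep l (outer P A s.ζ j) := by exact_mod_cast h1
  linarith

lemma Usable.le_card_band (hu : Usable P A s.ζ j) (hc : IsCritical P A s.ζ j ℓ)
    (hj : j ≤ P.L) {l : Fin (P.Lhat + 1)} (hl : ℓ ≤ l + 1) :
    (1 - P.ε) * ((outer P A s.ζ j).card / 2 ^ (l : ℕ)) - P.ε * P.T / 2 ≤ (s.band A l j).card := by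
  have h1 := Finset.card_le_card (hu.filter_inner_subset S hs hc hj hl)
  have h3 : (surv s.keep l (inner P A s.ζ j) : ℝ) ≤ (s.band A l j).card := by exact_mod_cast h1
  have h4 : ((inner P A s.ζ j).card : ℝ) / 2 ^ (l : ℕ) ≤
      (outer P A s.ζ j).card / 2 ^ (l : ℕ) := by
    gcongr
    exact inner_subset_outer S hs.scale j
  have h2 := (abs_le.mp (hs.sample.inner_dev l j hj
    (h4.trans (hc.card_div_le S hs.scale hl)))).1
  have h5 : (1 - P.ε) * ((outer P A s.ζ j).card / 2 ^ (l : ℕ)) ≤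
      (inner P A s.ζ j).card / 2 ^ (l : ℕ) := by
    rw [← mul_div_assoc]
    gcongr
    exact hu.le_card
  linarith

omit S hs in
lemma sqrt_twenty_bounds : (44 / 10 : ℝ) < √20 ∧ √20 < 45 / 10 :=
  ⟨Real.lt_sqrt_of_sq_lt (by norm_num), (Real.sqrt_lt' (by norm_num)).mpr (by norm_num)⟩

omit hs in
lemma inRange_iff {l : Fin (P.Lhat + 1)} : s.InRange A j l ↔
    (1 - √20 * P.ε) * P.T ≤ (s.band A l j).card ∧
      ((s.band A l j).card : ℝ) ≤ 2 * (1 + √20 * P.ε) * P.T := by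
  simp only [Seed.InRange, Params.T, mul_div_assoc]

/-- Past the critical level at most `(1 - 6ε) T` columns are expected. The gap between `6` and `√20`
exceeds the deviation `ε T / 2`, so the band stays below the lower end of the range. -/
lemma Usable.not_inRange (hu : Usable P A s.ζ j) (hc : IsCritical P A s.ζ j ℓ)
    (hj : j ≤ P.L) {l : Fin (P.Lhat + 1)} (hl : ℓ < l) : ¬ s.InRange A j l := by
  have hε := S.ε_pos
  have hT := S.T_pos
  have h20 := sqrt_twenty_bounds
  rw [inRange_iff S]
  rintro ⟨h1, -⟩
  have h2 := hu.card_band_le S hs hc hj (l := l) (by omega)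
  have h3 : ((outer P A s.ζ j).card : ℝ) / 2 ^ (l : ℕ) ≤ (1 - 6 * P.ε) * P.T := by
    rw [div_le_iff₀ (by positivity)]
    refine hc.2.2.2.le.trans ?_
    have : (2 : ℝ) ^ (ℓ + 1) ≤ 2 ^ (l : ℕ) := pow_le_pow_right₀ (by norm_num) hl
    have h4 : 0 ≤ (1 - 6 * P.ε) * P.T := mul_nonneg (by linarith [S.ε_le]) hT.le
    gcongr
  have hεT : 0 < P.ε * P.T := by positivity
  nlinarith

/-- At the critical level the band cannot be too large, so a failure means that it is too small, and
then the expected number `x` lies between `(1 - 6ε) T` and `(1 - 2ε) T`. One level earlier the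
expectation is `2x`, which is inside the range with room for all errors. -/
lemma Usable.inRange_of_not_inRange (hu : Usable P A s.ζ j) (hc : IsCritical P A s.ζ j ℓ)
    (hj : j ≤ P.L) {l l' : Fin (P.Lhat + 1)} (hl : (l : ℕ) = ℓ) (hl' : (l' : ℕ) + 1 = ℓ)
    (h : ¬ s.InRange A j l) : s.InRange A j l' := by
  have hε := S.ε_pos
  have hε1 := S.ε_le
  have hT := S.T_pos
  have h20 := sqrt_twenty_bounds
  have hεT : 0 < P.ε * P.T := by positivity
  have hεεT : P.ε * (P.ε * P.T) ≤ 1 / 10 ^ 6 * (P.ε * P.T) := by gcongr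
  have a1 := hu.card_band_le S hs hc hj (l := l) (by omega)
  have a2 := hu.le_card_band S hs hc hj (l := l) (by omega)
  have b1 := hu.card_band_le S hs hc hj (l := l') (by omega)
  have b2 := hu.le_card_band S hs hc hj (l := l') (by omega)
  set x := ((outer P A s.ζ j).card : ℝ) / 2 ^ (l : ℕ) with hx
  have hx' : ((outer P A s.ζ j).card : ℝ) / 2 ^ (l' : ℕ) = 2 * x := by
    rw [hx, hl, ← hl', pow_succ]
    field_simp
  have hx1 : (1 - 6 * P.ε) * P.T ≤ x := by
    rw [hx, le_div_iff₀ (by positivity), hl]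
    exact hc.2.2.1
  have hx2 : x < 2 * ((1 - 6 * P.ε) * P.T) := by
    rw [hx, div_lt_iff₀ (by positivity), hl]
    refine hc.2.2.2.trans_le (le_of_eq ?_)
    ring
  rw [hx'] at b1 b2
  rw [inRange_iff S] at h ⊢
  have hup : ((s.band A l j).card : ℝ) ≤ 2 * (1 + √20 * P.ε) * P.T := by nlinarith
  have hlow : ((s.band A l j).card : ℝ) < (1 - √20 * P.ε) * P.T := by
    by_contra hcon
    exact h ⟨not_lt.mp hcon, hup⟩
  have hx3 : x < (1 - 2 * P.ε) * P.T := by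
    by_contra hcon
    push Not at hcon
    nlinarith
  constructor
  · nlinarith
  · nlinarith

omit S hs in
lemma usedLevel_eq_some {l : Fin (P.Lhat + 1)} (h : s.usedLevel A j = some l) :
    (j ≤ P.j0 ∧ l = 0) ∨ (P.j0 < j ∧ s.InRange A j l ∧ ∀ l', s.InRange A j l' → l' ≤ l) := by
  classical
  unfold Seed.usedLevel at h
  split_ifs at h with h1 h2
  · left
    exact ⟨h1, by simpa using h.symm⟩
  · right
    simp only [Option.some.injEq] at h
    have h3 := Finset.max'_mem _ h2
    refine ⟨not_le.mp h1, ?_, fun l' hl' => ?_⟩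
    · rw [h] at h3
      exact (Finset.mem_filter.mp h3).2
    · rw [← h]
      exact Finset.le_max' _ _ (by simpa using hl')

omit S hs in
lemma usedLevel_zero (h : j ≤ P.j0) : s.usedLevel A j = some 0 := by
  unfold Seed.usedLevel
  rw [if_pos h]

omit S hs in
lemma usedLevel_of_isGreatest (h : P.j0 < j) {l : Fin (P.Lhat + 1)} (hl : s.InRange A j l)
    (hmax : ∀ l', s.InRange A j l' → l' ≤ l) : s.usedLevel A j = some l := by
  classical
  cases hu : s.usedLevel A j with
  | none =>
    exfalso
    unfold Seed.usedLevel at hu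
    rw [if_neg (not_le.mpr h)] at hu
    have hne : (Finset.univ.filter fun l => s.InRange A j l).Nonempty := ⟨l, by simpa using hl⟩
    rw [dif_pos hne] at hu
    cases hu
  | some l' =>
    rcases usedLevel_eq_some hu with h' | ⟨_, h1, h2⟩
    · omega
    · rw [le_antisymm (hmax l' h1) (h2 l hl)]

lemma Usable.usedLevel_eq (hu : Usable P A s.ζ j) (hc : IsCritical P A s.ζ j ℓ)
    (hj : j ≤ P.L) (hj0 : P.j0 < j) {l : Fin (P.Lhat + 1)} (hl : (l : ℕ) = ℓ)
    (h : s.InRange A j l) : s.usedLevel A j = some l :=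
  usedLevel_of_isGreatest hj0 h fun l' hl' => by
    by_contra hcon
    exact hu.not_inRange S hs hc hj (l := l') (by rw [← hl]; exact not_le.mp hcon) hl'

lemma Usable.usedLevel_eq_pred (hu : Usable P A s.ζ j) (hc : IsCritical P A s.ζ j ℓ)
    (hj : j ≤ P.L) (hj0 : P.j0 < j) {l l' : Fin (P.Lhat + 1)} (hl : (l : ℕ) = ℓ)
    (hl' : (l' : ℕ) + 1 = ℓ) (h : ¬ s.InRange A j l) : s.usedLevel A j = some l' :=
  usedLevel_of_isGreatest hj0 (hu.inRange_of_not_inRange S hs hc hj hl hl' h) fun k hk => by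
    by_contra hcon
    have h1 : (l' : ℕ) < k := not_le.mp hcon
    rcases Nat.lt_or_ge ℓ k with h2 | h2
    · exact hu.not_inRange S hs hc hj h2 hk
    · have : k = l := Fin.ext (by omega)
      exact h (this ▸ hk)

end GoodSeed

/-! ### The final draw -/

section Draw

variable {n : ℕ} {P : Params n} {A : Matrix (Fin n) (Fin n) ℝ}

open Classical in
/-- The probability, given the seed, of drawing `(j, i)`, set to zero if the vector returned for `i`
is not accurate. -/
def accDraw (A : Matrix (Fin n) (Fin n) ℝ) (η : ℝ) (s : Seed P) (j : Fin (P.L + 1))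
    (i : Fin n) : ℝ :=
  if (1 - η) * energy (col A i) ≤ energy (s.levelQuery A j i) ∧
    energy (s.levelQuery A j i) ≤ (1 + η) * energy (col A i) then s.drawProb A j i else 0

variable {s : Seed P} {j : ℕ} {l : Fin (P.Lhat + 1)}

lemma est_nonneg (l : Fin (P.Lhat + 1)) (i : Fin n) : 0 ≤ s.est A l i := energy_nonneg _

lemma recovered_eq (h : s.usedLevel A j = some l) : s.recovered A j = s.band A l j := by
  simp [Seed.recovered, h]

lemma levelEst_eq (h : s.usedLevel A j = some l) (i : Fin n) : s.levelEst A j i = s.est A l i := by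
  simp [Seed.levelEst, h]

lemma energy_levelQuery_eq (h : s.usedLevel A j = some l) (i : Fin n) :
    energy (s.levelQuery A j i) = s.est A l i := by
  simp [Seed.levelQuery, h, Seed.est]

lemma mTilde_eq (h : s.usedLevel A j = some l) :
    s.mTilde A j = (∑ i ∈ s.band A l j, s.est A l i) * 2 ^ (l : ℕ) := by
  simp [Seed.mTilde, h]

lemma mTilde_eq_zero (h : s.usedLevel A j = none) : s.mTilde A j = 0 := by
  simp [Seed.mTilde, h]

lemma mTilde_nonneg (s : Seed P) (j : ℕ) : 0 ≤ s.mTilde A j := by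
  cases h : s.usedLevel A j with
  | none => rw [mTilde_eq_zero h]
  | some l =>
    rw [mTilde_eq h]
    exact mul_nonneg (Finset.sum_nonneg fun i _ => est_nonneg l i) (by positivity)

lemma levelEst_nonneg (s : Seed P) (j : ℕ) (i : Fin n) : 0 ≤ s.levelEst A j i := by
  cases h : s.usedLevel A j with
  | none => simp [Seed.levelEst, h]
  | some l => rw [levelEst_eq h]; exact est_nonneg l i

lemma drawProb_nonneg (s : Seed P) (j : Fin (P.L + 1)) (i : Fin n) : 0 ≤ s.drawProb A j i := by
  unfold Seed.drawProb
  split_ifs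
  · exact mul_nonneg (div_nonneg (mTilde_nonneg s _)
      (Finset.sum_nonneg fun j' _ => mTilde_nonneg s _))
      (div_nonneg (levelEst_nonneg s _ _) (Finset.sum_nonneg fun i' _ => levelEst_nonneg s _ _))
  · exact le_rfl

lemma accDraw_nonneg (η : ℝ) (s : Seed P) (j : Fin (P.L + 1)) (i : Fin n) :
    0 ≤ accDraw A η s j i := by
  unfold accDraw
  split_ifs
  exacts [drawProb_nonneg s j i, le_rfl]

lemma sum_drawProb (s : Seed P) (j : Fin (P.L + 1)) :
    ∑ i, s.drawProb A j i = s.mTilde A j / ∑ j' : Fin (P.L + 1), s.mTilde A j' := by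
  classical
  unfold Seed.drawProb
  rw [← Finset.sum_filter, ← Finset.mul_sum, ← Finset.sum_div]
  rw [Finset.filter_mem_eq_inter, Finset.univ_inter]
  by_cases h0 : ∑ i ∈ s.recovered A j, s.levelEst A j i = 0
  · have : s.mTilde A j = 0 := by
      cases h : s.usedLevel A j with
      | none => exact mTilde_eq_zero h
      | some l =>
        rw [recovered_eq h] at h0
        simp_rw [levelEst_eq h] at h0
        rw [mTilde_eq h, h0, zero_mul]
    simp [this]
  · rw [div_self h0, mul_one]

variable (S : Setting P A) (hs : Good A s)
include S hs

lemma accurate_of_mem_band (hr : Resolvable A s.ζ l j) {i : Fin n} (hi : i ∈ s.band A l j) :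
    (1 - P.ε) * energy (col A i) ≤ s.est A l i ∧ s.est A l i ≤ (1 + P.ε) * energy (col A i) := by
  have h1 := abs_le.mp (hs.abs_sub_le_of_mem_band S hr hi)
  have h2 := hs.band_subset S hr hi
  have h3 := mem_outer_bounds S hs.scale (Finset.mem_filter.mp h2).1
  have ha := S.mag_pos hs.scale j
  have hε := S.ε_pos
  have h4 : P.slack * mag P s.ζ j ≤ P.ε * energy (col A i) :=
    mul_le_mul (by linarith [S.slack_le]) h3.1.le ha.le hε.le
  constructor <;> linarith [h1.1, h1.2]

lemma sum_est_band_le : ∑ i ∈ s.band A l j, s.est A l i ≤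
    (s.band A l j).card * (2 * mag P s.ζ j) := by
  have ha := S.mag_pos hs.scale j
  have hε := S.ε_pos
  rw [← nsmul_eq_mul]
  refine Finset.sum_le_card_nsmul _ _ _ fun i hi => ?_
  rw [mem_band_iff] at hi
  nlinarith [hi.2.2]

lemma le_sum_est_band : (s.band A l j).card * mag P s.ζ j ≤ ∑ i ∈ s.band A l j, s.est A l i := by
  have ha := S.mag_pos hs.scale j
  have hε := S.ε_pos
  rw [← nsmul_eq_mul]
  refine Finset.card_nsmul_le_sum _ _ _ fun i hi => ?_
  rw [mem_band_iff] at hi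
  nlinarith [hi.2.1]

/-- Magnitude level `j` is estimated reliably. -/
def Clean {n : ℕ} {P : Params n} (A : Matrix (Fin n) (Fin n) ℝ) (s : Seed P) (j : ℕ) : Prop :=
  ∀ l, s.usedLevel A j = some l → Resolvable A s.ζ l j

/-- Valid for any level that happens to be used, critical or not. The lower end of the range gives
`card ≥ T/2`, which absorbs the additive error in `card ≤ 2x + T/4` and leaves `card ≤ 4x`, with `x`
the expected number of survivors of `outer`. -/
lemma mTilde_le_of_clean (hj : j ≤ P.L) (hc : Clean A s j) :
    s.mTilde A j ≤ 8 * ∑ k ∈ outer P A s.ζ j, energy (col A k) := by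
  have ha := S.mag_pos hs.scale j
  have hε := S.ε_pos
  have hε1 := S.ε_le
  have hT := S.T_pos
  have h20 := sqrt_twenty_bounds
  have hE := card_outer_mul_mag_le S hs.scale j
  cases h : s.usedLevel A j with
  | none =>
    rw [mTilde_eq_zero h]
    exact mul_nonneg (by norm_num) (Finset.sum_nonneg fun _ _ => energy_nonneg _)
  | some l =>
    have hr := hc l h
    rw [mTilde_eq h]
    have h1 := sum_est_band_le S hs (l := l) (j := j)
    have hsurv : ((s.band A l j).card : ℝ) ≤ surv s.keep l (outer P A s.ζ j) := by
      exact_mod_cast Finset.card_le_card (hs.band_subset S hr)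
    rcases usedLevel_eq_some h with ⟨-, rfl⟩ | ⟨-, h2, -⟩
    · have h3 : (surv s.keep 0 (outer P A s.ζ j) : ℝ) ≤ (outer P A s.ζ j).card := by
        exact_mod_cast surv_le_card _ _ _
      simp only [Fin.val_zero, pow_zero, mul_one]
      have h4 : ((s.band A 0 j).card : ℝ) * (2 * mag P s.ζ j) ≤
          (outer P A s.ζ j).card * (2 * mag P s.ζ j) :=
        mul_le_mul_of_nonneg_right (hsurv.trans h3) (by positivity)
      have h5 : 0 ≤ ((outer P A s.ζ j).card : ℝ) * mag P s.ζ j := by positivity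
      linarith
    · rw [inRange_iff S] at h2
      have h3 := hs.sample.outer_le l j hj
      set x := ((outer P A s.ζ j).card : ℝ) / 2 ^ (l : ℕ) with hx
      have h4 : P.T / 2 ≤ (s.band A l j).card := by
        refine le_trans ?_ h2.1
        have : √20 * P.ε ≤ 1 / 2 := by nlinarith
        nlinarith
      have h5 : ((s.band A l j).card : ℝ) ≤ 4 * x := by linarith
      calc (∑ i ∈ s.band A l j, s.est A l i) * 2 ^ (l : ℕ)
          ≤ ((s.band A l j).card * (2 * mag P s.ζ j)) * 2 ^ (l : ℕ) := by gcongr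
        _ ≤ ((4 * x) * (2 * mag P s.ζ j)) * 2 ^ (l : ℕ) := by gcongr
        _ = 8 * ((outer P A s.ζ j).card * mag P s.ζ j) := by rw [hx]; field_simp; ring
        _ ≤ _ := by gcongr

/-- If the noise is not resolved, then `mag` is itself tiny, of order `ε⁴/L³` times `M / 2^l`. The
range allows at most `4T` columns of that size, so even after scaling by `2^l` the contribution is
negligible. Level `0` always resolves `j ≤ j0`, so only `j > j0` is concerned. -/
lemma mTilde_le_of_not_clean (hc : ¬ Clean A s j) :
    s.mTilde A j ≤ P.ε / P.L * totalEnergy A := by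
  have ha := S.mag_pos hs.scale j
  have hL := S.L_pos
  have hM := S.M_pos
  have hε := S.ε_pos
  have hε1 := S.ε_le
  have hT := S.T_pos
  have h20 := sqrt_twenty_bounds
  unfold Clean at hc
  push Not at hc
  obtain ⟨l, h, hr⟩ := hc
  rcases usedLevel_eq_some h with ⟨h1, rfl⟩ | ⟨-, h2, -⟩
  · exact absurd (resolvable_zero S hs.scale h1) hr
  rw [inRange_iff S] at h2
  rw [mTilde_eq h]
  have h1 := sum_est_band_le S hs (l := l) (j := j)
  have h3 : ((s.band A l j).card : ℝ) ≤ 4 * P.T := by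
    refine h2.2.trans ?_
    have : √20 * P.ε ≤ 1 := by nlinarith
    nlinarith
  have h4 : mag P s.ζ j ≤ 1 / 10 ^ 3 * (P.ε ^ 4 / (P.L : ℝ) ^ 3 * (totalEnergy A / 2 ^ (l : ℕ))) := by
    unfold Resolvable at hr
    have h5 := (not_le.mp hr).le.trans (S.tauSq_le l)
    have e1 : (P.slack / 4) ^ 2 = 1 / (10 ^ 10 * 16) * (P.ε ^ 2 / (P.L : ℝ) ^ 2) := by
      unfold Params.slack
      field_simp
      norm_num
    have e2 : 2 / 10 ^ 15 * P.ε ^ 6 / (P.L : ℝ) ^ 5 * (totalEnergy A / 2 ^ (l : ℕ)) =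
        (P.ε ^ 2 / (P.L : ℝ) ^ 2) * (2 / 10 ^ 15 *
          (P.ε ^ 4 / (P.L : ℝ) ^ 3 * (totalEnergy A / 2 ^ (l : ℕ)))) := by
      field_simp
    rw [e1, e2, mul_comm (1 / (10 ^ 10 * 16) : ℝ), mul_assoc] at h5
    have h6 := le_of_mul_le_mul_left h5 (by positivity)
    have h7 : 0 ≤ P.ε ^ 4 / (P.L : ℝ) ^ 3 * (totalEnergy A / 2 ^ (l : ℕ)) := by positivity
    set Y := P.ε ^ 4 / (P.L : ℝ) ^ 3 * (totalEnergy A / 2 ^ (l : ℕ)) with hY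
    norm_num at h6 ⊢
    linarith
  calc (∑ i ∈ s.band A l j, s.est A l i) * 2 ^ (l : ℕ)
      ≤ ((s.band A l j).card * (2 * mag P s.ζ j)) * 2 ^ (l : ℕ) := by gcongr
    _ ≤ (4 * P.T * (2 * (1 / 10 ^ 3 *
        (P.ε ^ 4 / (P.L : ℝ) ^ 3 * (totalEnergy A / 2 ^ (l : ℕ)))))) * 2 ^ (l : ℕ) := by gcongr
    _ = (8 / 10 ^ 3 * P.ε) * (P.ε / P.L * totalEnergy A) := by
      unfold Params.T; field_simp; norm_num
    _ ≤ 1 * (P.ε / P.L * totalEnergy A) := by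
      refine mul_le_mul_of_nonneg_right ?_ (by positivity)
      linarith
    _ = _ := one_mul _

/-- Beyond `j0` the level used is `ℓ` or `ℓ - 1`; it is in range, so the band has at least `0.9 T`
columns while at most `4T` of `outer` are expected to survive there. Up to `j0` nothing is
subsampled and all of `inner` is found. -/
lemma Usable.le_mTilde (hu : Usable P A s.ζ j) (hj : j ≤ P.L) :
    ∑ k ∈ outer P A s.ζ j, energy (col A k) ≤ 10 * s.mTilde A j := by
  have ha := S.mag_pos hs.scale j
  have hε := S.ε_pos
  have hε1 := S.ε_le
  have hT := S.T_pos
  have h20 := sqrt_twenty_bounds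
  have hE := sum_outer_le_card S hs.scale (A := A) j
  rcases Nat.lt_or_ge P.j0 j with hj0 | hj0
  · obtain ⟨ℓ, hc⟩ := hu.exists_isCritical S hs.scale hj0
    have h1 := hc.1
    have h2 := hc.2.1
    let l : Fin (P.Lhat + 1) := ⟨ℓ, by omega⟩
    let l' : Fin (P.Lhat + 1) := ⟨ℓ - 1, by omega⟩
    have hl' : (l' : ℕ) + 1 = ℓ := by simp only [l']; omega
    obtain ⟨m, hm, hm1, hm2⟩ : ∃ m : Fin (P.Lhat + 1), s.usedLevel A j = some m ∧
        ℓ ≤ m + 1 ∧ s.InRange A j m := by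
      by_cases h : s.InRange A j l
      · exact ⟨l, hu.usedLevel_eq S hs hc hj hj0 rfl h, by simp [l], h⟩
      · exact ⟨l', hu.usedLevel_eq_pred S hs hc hj hj0 (l := l) rfl hl' h, hl'.ge,
          hu.inRange_of_not_inRange S hs hc hj (l := l) rfl hl' h⟩
    rw [mTilde_eq hm]
    rw [inRange_iff S] at hm2
    have h3 := le_sum_est_band S hs (l := m) (j := j)
    have h4 : 9 / 10 * P.T ≤ (s.band A m j).card := by
      refine le_trans ?_ hm2.1
      have : √20 * P.ε ≤ 1 / 10 := by nlinarith
      nlinarith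
    have h5 : ((outer P A s.ζ j).card : ℝ) ≤ 4 * (P.T * 2 ^ (m : ℕ)) := by
      have := hc.card_div_le S hs.scale hm1
      rw [div_le_iff₀ (by positivity)] at this
      linarith
    have h6 : (9 / 10 * P.T * mag P s.ζ j) * 2 ^ (m : ℕ) ≤
        (∑ i ∈ s.band A m j, s.est A m i) * 2 ^ (m : ℕ) := by
      refine mul_le_mul_of_nonneg_right (le_trans ?_ h3) (by positivity)
      gcongr
    have h7 := mul_le_mul_of_nonneg_right h5 ha.le
    have h8 : 0 ≤ P.T * 2 ^ (m : ℕ) * mag P s.ζ j := by positivity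
    linarith
  · have h := usedLevel_zero (s := s) (A := A) hj0
    rw [mTilde_eq h]
    simp only [Fin.val_zero, pow_zero, mul_one]
    have h3 := le_sum_est_band S hs (l := 0) (j := j)
    have h4 : inner P A s.ζ j ⊆ s.band A 0 j := fun k hk =>
      hs.mem_band S (resolvable_zero S hs.scale hj0) (surv_above_zero_lt S hs.scale hj0 _)
        (hs.sample.zero k) hk
    have h5 : ((inner P A s.ζ j).card : ℝ) ≤ (s.band A 0 j).card := by
      exact_mod_cast Finset.card_le_card h4
    have h6 : 1 / 2 * ((outer P A s.ζ j).card : ℝ) ≤ (inner P A s.ζ j).card := by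
      refine le_trans ?_ hu.le_card
      gcongr
      linarith
    have h7 := mul_le_mul_of_nonneg_right (h6.trans h5) ha.le
    have h8 : 0 ≤ ((outer P A s.ζ j).card : ℝ) * mag P s.ζ j := by positivity
    linarith

/-- The clean levels contribute at most `8 M` because the sets `outer` are disjoint, and the `L + 1`
bounds `ε M / L` for the others add at most `M`. -/
lemma sum_mTilde_le : ∑ j : Fin (P.L + 1), s.mTilde A j ≤ 9 * totalEnergy A := by
  have hL := S.L_ge
  have hM := S.M_pos
  have hε := S.ε_pos
  have hε1 := S.ε_le
  rw [Fin.sum_univ_eq_sum_range fun j => s.mTilde A j]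
  have h1 : ∀ j ∈ Finset.range (P.L + 1), s.mTilde A j ≤
      8 * ∑ k ∈ outer P A s.ζ j, energy (col A k) + P.ε / P.L * totalEnergy A := by
    intro j hj
    by_cases hc : Clean A s j
    · have := mTilde_le_of_clean S hs (Nat.lt_succ_iff.mp (Finset.mem_range.mp hj)) hc
      have : 0 ≤ P.ε / P.L * totalEnergy A := by positivity
      linarith
    · have := mTilde_le_of_not_clean S hs hc
      have : 0 ≤ ∑ k ∈ outer P A s.ζ j, energy (col A k) :=
        Finset.sum_nonneg fun _ _ => energy_nonneg _
      linarith
  refine (Finset.sum_le_sum h1).trans ?_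
  rw [Finset.sum_add_distrib, ← Finset.mul_sum, Finset.sum_const, Finset.card_range, nsmul_eq_mul]
  have h2 := sum_outer_le S hs.scale (Finset.range (P.L + 1))
  have h3 : ((P.L + 1 : ℕ) : ℝ) * (P.ε / P.L * totalEnergy A) ≤ totalEnergy A := by
    have : ((P.L + 1 : ℕ) : ℝ) * (P.ε / P.L * totalEnergy A) =
      (((P.L : ℝ) + 1) * P.ε / P.L) * totalEnergy A := by push_cast; ring
    rw [this]
    refine mul_le_of_le_one_left hM.le ?_
    rw [div_le_one (by linarith)]
    nlinarith
  linarith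

omit S hs in
open Classical in
/-- The columns that are recovered when they survive, in usable magnitude levels. -/
def goodCols {n : ℕ} (P : Params n) (A : Matrix (Fin n) (Fin n) ℝ) (z : ℝ) : Finset (Fin n) :=
  {i | ∃ j ≤ P.L, i ∈ inner P A z j ∧ Usable P A z j}

lemma le_sum_mTilde (h : totalEnergy A / 2 ≤ ∑ i ∈ goodCols P A s.ζ, energy (col A i)) :
    totalEnergy A / 20 ≤ ∑ j : Fin (P.L + 1), s.mTilde A j := by
  classical
  rw [Fin.sum_univ_eq_sum_range fun j => s.mTilde A j]
  have h1 : ∑ i ∈ goodCols P A s.ζ, energy (col A i) ≤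
      ∑ j ∈ (Finset.range (P.L + 1)).filter (fun j => Usable P A s.ζ j),
        ∑ k ∈ outer P A s.ζ j, energy (col A k) := by
    rw [← Finset.sum_biUnion fun j _ j' _ h => disjoint_outer S hs.scale h]
    refine Finset.sum_le_sum_of_subset_of_nonneg ?_ fun _ _ _ => energy_nonneg _
    intro i hi
    simp only [goodCols, Finset.mem_filter, Finset.mem_univ, true_and] at hi
    obtain ⟨j, hj, hi, hu⟩ := hi
    simp only [Finset.mem_biUnion, Finset.mem_filter, Finset.mem_range]
    exact ⟨j, ⟨by omega, hu⟩, inner_subset_outer S hs.scale j hi⟩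
  have h2 : ∑ j ∈ (Finset.range (P.L + 1)).filter (fun j => Usable P A s.ζ j),
        ∑ k ∈ outer P A s.ζ j, energy (col A k) ≤
      ∑ j ∈ Finset.range (P.L + 1), 10 * s.mTilde A j := by
    refine (Finset.sum_le_sum fun j hj => ?_).trans (Finset.sum_le_sum_of_subset_of_nonneg
      (Finset.filter_subset _ _) fun j _ _ => mul_nonneg (by norm_num) (mTilde_nonneg s j))
    rw [Finset.mem_filter, Finset.mem_range] at hj
    exact hj.2.le_mTilde S hs (by omega)
  rw [← Finset.mul_sum] at h2
  linarith

lemma accDraw_of_clean {j : Fin (P.L + 1)} (hc : Clean A s j) (i : Fin n) :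
    accDraw A P.ε s j i = s.drawProb A j i := by
  unfold accDraw
  by_cases hi : i ∈ s.recovered A j
  · cases h : s.usedLevel A j with
    | none => simp [Seed.recovered, h] at hi
    | some l =>
      rw [recovered_eq h] at hi
      rw [if_pos]
      rw [energy_levelQuery_eq h]
      exact accurate_of_mem_band S hs (hc l h) hi
  · unfold Seed.drawProb
    simp [hi]

/-- A good seed with enough energy in good columns makes an accurate sample very likely. -/
lemma le_sum_accDraw (h : totalEnergy A / 2 ≤ ∑ i ∈ goodCols P A s.ζ, energy (col A i)) :
    99 / 100 ≤ ∑ j, ∑ i, accDraw A P.ε s j i := by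
  classical
  have hL := S.L_ge
  have hM := S.M_pos
  have hε := S.ε_pos
  have hε1 := S.ε_le
  have hZ := le_sum_mTilde S hs h
  set Z := ∑ j : Fin (P.L + 1), s.mTilde A j with hZdef
  have hZpos : 0 < Z := by linarith
  -- A clean level loses nothing to inaccuracy. A level that is not clean has at most `20 ε / L` of
  -- the drawing mass, so at most `40 ε` is lost in total.
  have h1 : ∀ j : Fin (P.L + 1), s.mTilde A j / Z - P.ε / P.L * totalEnergy A / Z ≤
      ∑ i, accDraw A P.ε s j i := by
    intro j
    by_cases hc : Clean A s j
    · rw [Finset.sum_congr rfl fun i _ => accDraw_of_clean S hs hc i, sum_drawProb]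
      have : 0 ≤ P.ε / P.L * totalEnergy A / Z := by positivity
      linarith
    · have h2 := mTilde_le_of_not_clean S hs hc
      have h3 : s.mTilde A j / Z ≤ P.ε / P.L * totalEnergy A / Z := by gcongr
      have h4 : 0 ≤ ∑ i, accDraw A P.ε s j i :=
        Finset.sum_nonneg fun i _ => accDraw_nonneg _ s j i
      linarith
  refine le_trans ?_ (Finset.sum_le_sum fun j _ => h1 j)
  rw [Finset.sum_sub_distrib, ← Finset.sum_div, ← hZdef, div_self hZpos.ne', Finset.sum_const,
    Finset.card_univ, Fintype.card_fin, nsmul_eq_mul]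
  have h5 : P.ε / P.L * totalEnergy A / Z ≤ P.ε / P.L * 20 := by
    rw [div_le_iff₀ hZpos]
    have : 0 < P.ε / P.L := by positivity
    nlinarith
  have h6 : ((P.L + 1 : ℕ) : ℝ) * (P.ε / P.L * totalEnergy A / Z) ≤
      ((P.L + 1 : ℕ) : ℝ) * (P.ε / P.L * 20) := by gcongr
  have h7 : ((P.L + 1 : ℕ) : ℝ) * (P.ε / P.L * 20) ≤ 40 * P.ε := by
    push_cast
    rw [show ((P.L : ℝ) + 1) * (P.ε / P.L * 20) = 20 * P.ε * ((P.L + 1) / P.L) by ring]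
    have : ((P.L : ℝ) + 1) / P.L ≤ 2 := by rw [div_le_iff₀ (by linarith)]; linarith
    nlinarith
  linarith

/-- The probability of drawing a recovered column. -/
lemma le_accDraw {j : Fin (P.L + 1)} (hl : s.usedLevel A j = some l) (hr : Resolvable A s.ζ l j)
    {i : Fin n} (hi : i ∈ s.band A l j) :
    2 ^ (l : ℕ) * energy (col A i) / (18 * totalEnergy A) ≤ accDraw A P.ε s j i := by
  have hM := S.M_pos
  have hε1 := S.ε_le
  have hc : Clean A s j := by
    intro l' hl'
    rw [hl] at hl'
    rw [← Option.some.inj hl']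
    exact hr
  rw [accDraw_of_clean S hs hc]
  have hacc := accurate_of_mem_band S hs hr hi
  have hb := mem_outer_bounds S hs.scale (Finset.mem_filter.mp (hs.band_subset S hr hi)).1
  have ha := S.mag_pos hs.scale j
  have he : 0 < energy (col A i) := ha.trans hb.1
  have hest : energy (col A i) / 2 ≤ s.est A l i := by
    have : P.ε * energy (col A i) ≤ 1 / 10 ^ 6 * energy (col A i) := by gcongr
    linarith [hacc.1]
  have hsum : 0 < ∑ i ∈ s.band A l j, s.est A l i :=
    Finset.sum_pos' (fun i _ => est_nonneg l i) ⟨i, hi, (half_pos he).trans_le hest⟩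
  have hZ := sum_mTilde_le S hs
  unfold Seed.drawProb
  rw [if_pos (by rw [recovered_eq hl]; exact hi), recovered_eq hl]
  simp_rw [levelEst_eq hl]
  set Z := ∑ j : Fin (P.L + 1), s.mTilde A j with hZdef
  have hm : s.mTilde A j ≤ Z :=
    Finset.single_le_sum (f := fun j : Fin (P.L + 1) => s.mTilde A j)
      (fun j _ => mTilde_nonneg s j) (Finset.mem_univ j)
  rw [mTilde_eq hl] at hm ⊢
  have hZpos : 0 < Z := lt_of_lt_of_le (mul_pos hsum (by positivity)) hm
  -- The sum over the band cancels between the two stages of the draw.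
  have e : (∑ i ∈ s.band A l j, s.est A l i) * 2 ^ (l : ℕ) / Z *
      (s.est A l i / ∑ i' ∈ s.band A l j, s.est A l i') = 2 ^ (l : ℕ) * s.est A l i / Z := by
    field_simp
  rw [e]
  calc 2 ^ (l : ℕ) * energy (col A i) / (18 * totalEnergy A)
      = 2 ^ (l : ℕ) * (energy (col A i) / 2) / (9 * totalEnergy A) := by field_simp; norm_num
    _ ≤ 2 ^ (l : ℕ) * s.est A l i / Z := by
      have := est_nonneg (A := A) (s := s) l i
      gcongr

end Draw

/-! ### Concentration of the subsampling -/

lemma sum_div_two_pow_le {x : ℝ} (hx : 0 ≤ x) (N : ℕ) :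
    ∑ l ∈ Finset.range N, x / 2 ^ l ≤ 2 * x := by
  have h : ∀ l ∈ Finset.range N, x / 2 ^ l = x * (1 / 2 : ℝ) ^ l := fun l _ => by
    rw [one_div, inv_pow]; rfl
  rw [Finset.sum_congr rfl h, ← Finset.mul_sum, mul_comm 2 x]
  refine mul_le_mul_of_nonneg_left ?_ hx
  exact sum_geometric_two_le N

/-- Terms vanish until `x / 2^l` falls below `c`, and a geometric series starts there. The bound
depends neither on `x` nor on `N`, which saves a factor `L` when Chebyshev bounds are summed over
subsampling levels. -/
lemma sum_ite_div_two_pow_le {x c : ℝ} (hx : 0 ≤ x) (hc : 0 ≤ c) (N : ℕ) :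
    ∑ l ∈ Finset.range N, (if x / 2 ^ l ≤ c then x / 2 ^ l else 0) ≤ 2 * c := by
  induction N generalizing x with
  | zero => simpa using hc
  | succ N ih =>
    by_cases h : x ≤ c
    · refine le_trans (Finset.sum_le_sum fun l _ => ?_) ((sum_div_two_pow_le hx (N + 1)).trans
        (by linarith))
      split_ifs
      exacts [le_rfl, by positivity]
    · rw [Finset.sum_range_succ', pow_zero, div_one, if_neg h, add_zero]
      have := ih (x := x / 2) (by linarith)
      refine le_trans (le_of_eq ?_) this
      refine Finset.sum_congr rfl fun l _ => ?_
      rw [pow_succ', div_div]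

section Subsampling

variable {n : ℕ} {P : Params n} {A : Matrix (Fin n) (Fin n) ℝ} {Ω : Type*}
  [m0 : MeasurableSpace Ω] {μ : Measure Ω} [IsProbabilityMeasure μ] {seed : Ω → Seed P}
  {draw : Ω → Option (Fin (P.L + 1) × Fin n)}

lemma measurableSet_keep_eq {Sc : Set (Component P)} {k : Fin n} (h : Component.column k ∈ Sc)
    (l : Fin (P.Lhat + 1)) (b : Bool) :
    MeasurableSet[compSigma seed Sc] {ω | (seed ω).keep l k = b} :=
  measurableSet_of_finite (X := fun ω => fun l => (seed ω).keep l k) (measurableSet_column h)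
    fun p => p l = b

/-- The survival indicator of a column, as a real number. -/
def keepInd (s : Seed P) (l : Fin (P.Lhat + 1)) (k : Fin n) : ℝ :=
  if s.keep l k = true then 1 else 0

lemma surv_eq_sum (s : Seed P) (l : Fin (P.Lhat + 1)) (G : Finset (Fin n)) :
    (surv s.keep l G : ℝ) = ∑ k ∈ G, keepInd s l k := by
  simp [surv, keepInd]

lemma measurable_keepInd {Sc : Set (Component P)} {k : Fin n} (h : Component.column k ∈ Sc)
    (l : Fin (P.Lhat + 1)) : Measurable[compSigma seed Sc] fun ω => keepInd (seed ω) l k :=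
  measurable_comp_of_finite (X := fun ω => fun l => (seed ω).keep l k) (measurableSet_column h)
    fun p => if p l = true then (1 : ℝ) else 0

lemma keepInd_nonneg (s : Seed P) (l : Fin (P.Lhat + 1)) (k : Fin n) : 0 ≤ keepInd s l k := by
  unfold keepInd; split_ifs <;> norm_num

lemma keepInd_le_one (s : Seed P) (l : Fin (P.Lhat + 1)) (k : Fin n) : keepInd s l k ≤ 1 := by
  unfold keepInd; split_ifs <;> norm_num

section

variable (H : IsRun P A μ seed draw)
include H

lemma IsRun.memLp_keepInd (l : Fin (P.Lhat + 1)) (k : Fin n) :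
    MemLp (fun ω => keepInd (seed ω) l k) 2 μ := by
  refine MemLp.of_bound (((measurable_keepInd (Set.mem_univ _) l).mono (H.compSigma_le _)
    le_rfl).aestronglyMeasurable) 1 (ae_of_all _ fun ω => ?_)
  rw [Real.norm_of_nonneg (keepInd_nonneg _ _ _)]
  exact keepInd_le_one _ _ _

lemma IsRun.integral_keepInd (l : Fin (P.Lhat + 1)) (k : Fin n) :
    ∫ ω, keepInd (seed ω) l k ∂μ = (1 / 2 : ℝ) ^ (l : ℕ) := by
  rw [← H.keep_rate l k]
  have e : (fun ω => keepInd (seed ω) l k) =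
      Set.indicator {ω | (seed ω).keep l k = true} fun _ => (1 : ℝ) := by
    ext ω; simp [keepInd, Set.indicator_apply]
  rw [e, integral_indicator (H.compSigma_le _ _ (measurableSet_keep_eq (Set.mem_univ _) l true))]
  simp

/-- Chebyshev's inequality: the indicators of distinct columns are independent, and the variance of
an indicator is at most its mean. -/
lemma IsRun.measure_dev_le (l : Fin (P.Lhat + 1)) (G : Finset (Fin n)) {d : ℝ} (hd : 0 < d) :
    μ.real {ω | d ≤ |(surv (seed ω).keep l G : ℝ) - G.card / 2 ^ (l : ℕ)|} ≤
      G.card / 2 ^ (l : ℕ) / d ^ 2 := by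
  have hmem : MemLp (∑ k ∈ G, fun ω => keepInd (seed ω) l k) 2 μ :=
    memLp_finsetSum' _ fun k _ => H.memLp_keepInd l k
  have hint : ∫ ω, (∑ k ∈ G, fun ω => keepInd (seed ω) l k) ω ∂μ = G.card / 2 ^ (l : ℕ) := by
    simp only [Finset.sum_apply]
    rw [integral_finsetSum _ fun k _ => (H.memLp_keepInd l k).integrable (by norm_num)]
    simp_rw [H.integral_keepInd]
    rw [Finset.sum_const, nsmul_eq_mul, one_div, inv_pow]
    rfl
  have hvar : Var[∑ k ∈ G, fun ω => keepInd (seed ω) l k; μ] ≤ G.card / 2 ^ (l : ℕ) := by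
    rw [IndepFun.variance_sum fun k _ => H.memLp_keepInd l k]
    · have : ∀ k ∈ G, Var[fun ω => keepInd (seed ω) l k; μ] ≤ (1 / 2 : ℝ) ^ (l : ℕ) := by
        intro k _
        refine (variance_le_expectation_sq (H.memLp_keepInd l k).aestronglyMeasurable).trans ?_
        rw [← H.integral_keepInd l k]
        refine le_of_eq (integral_congr_ae (ae_of_all _ fun ω => ?_))
        simp only [Pi.pow_apply, keepInd]
        split_ifs <;> norm_num
      refine (Finset.sum_le_sum this).trans ?_
      rw [Finset.sum_const, nsmul_eq_mul, one_div, inv_pow]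
      rfl
    · intro k _ m _ hkm
      have hdis : Disjoint ({Component.column k} : Set (Component P)) {Component.column m} := by
        simp [hkm]
      exact indep_of_indep_of_le_left (indep_of_indep_of_le_right (H.indep_compSigma hdis)
        (measurable_keepInd (Set.mem_singleton _) l).comap_le)
        (measurable_keepInd (Set.mem_singleton _) l).comap_le
  have h := meas_ge_le_variance_div_sq hmem hd
  rw [hint] at h
  have h2 := ENNReal.toReal_mono ENNReal.ofReal_ne_top h
  rw [ENNReal.toReal_ofReal (div_nonneg (variance_nonneg _ _) (sq_nonneg _))] at h2
  simp only [Finset.sum_apply] at h2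
  simp_rw [surv_eq_sum]
  exact h2.trans (by gcongr)

/-- The components of the other columns. -/
def otherColumns {n : ℕ} (P : Params n) (i : Fin n) : Set (Component P) :=
  {k | ∃ m, m ≠ i ∧ k = .column m}

omit H in
lemma column_mem_otherColumns {i m : Fin n} (h : m ≠ i) : Component.column m ∈ otherColumns P i :=
  ⟨m, h, rfl⟩

omit H in
lemma column_notMem_otherColumns (i : Fin n) : Component.column i ∉ otherColumns P i := by
  rintro ⟨m, hm, h⟩
  exact hm (by injection h with h; exact h.symm)

omit H in
lemma measurableSet_surv {Sc : Set (Component P)} (l : Fin (P.Lhat + 1)) (G : Finset (Fin n))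
    (hG : ∀ k ∈ G, Component.column k ∈ Sc) (B : Set ℝ) (hB : MeasurableSet B) :
    MeasurableSet[compSigma seed Sc] {ω | (surv (seed ω).keep l G : ℝ) ∈ B} := by
  have : Measurable[compSigma seed Sc] fun ω => (surv (seed ω).keep l G : ℝ) := by
    simp_rw [surv_eq_sum]
    exact Finset.measurable_fun_sum _ fun k hk => measurable_keepInd (hG k hk) l
  exact this hB

variable (i : Fin n) (Q : (Fin (P.Lhat + 1) → Bool) → Prop)

/-- Events about the survival of column `i` are independent of the other components. -/
lemma IsRun.measure_column_and {Sc : Set (Component P)} (hSc : Component.column i ∉ Sc) (B : Set Ω)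
    (hB : MeasurableSet[compSigma seed Sc] B) :
    μ.real {ω | Q (fun l => (seed ω).keep l i) ∧ ω ∈ B} =
      μ.real {ω | Q fun l => (seed ω).keep l i} * μ.real B := by
  have hdis : Disjoint ({Component.column i} : Set (Component P)) Sc :=
    Set.disjoint_singleton_left.mpr hSc
  have hE : MeasurableSet[compSigma seed {Component.column i}]
      {ω | Q fun l => (seed ω).keep l i} :=
    measurableSet_of_finite (measurableSet_column (Set.mem_singleton _)) Q
  have := (Indep_iff _ _ _).mp (H.indep_compSigma hdis) _ _ hE hB
  rw [measureReal_def, measureReal_def, measureReal_def, ← ENNReal.toReal_mul, ← this]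
  rfl

/-- For a set that omits `i`, the deviation is independent of the fate of column `i`. -/
lemma IsRun.measure_column_and_dev_le (l : Fin (P.Lhat + 1)) {G : Finset (Fin n)} (hi : i ∉ G)
    {d : ℝ} (hd : 0 < d) :
    μ.real {ω | Q (fun l => (seed ω).keep l i) ∧
      d ≤ |(surv (seed ω).keep l G : ℝ) - G.card / 2 ^ (l : ℕ)|} ≤
      G.card / 2 ^ (l : ℕ) / d ^ 2 * μ.real {ω | Q fun l => (seed ω).keep l i} := by
  have hB : MeasurableSet[compSigma seed (otherColumns P i)]
      {ω | d ≤ |(surv (seed ω).keep l G : ℝ) - G.card / 2 ^ (l : ℕ)|} :=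
    measurableSet_surv l G (fun k hk => column_mem_otherColumns (ne_of_mem_of_not_mem hk hi))
      {x | d ≤ |x - G.card / 2 ^ (l : ℕ)|} (measurableSet_le (by fun_prop) (by fun_prop))
  have := H.measure_column_and i Q (column_notMem_otherColumns i) _ hB
  simp only [Set.mem_ofPred_eq] at this
  rw [this, mul_comm]
  exact mul_le_mul_of_nonneg_right (H.measure_dev_le l G hd) measureReal_nonneg

omit H in
lemma surv_erase (κ : Fin (P.Lhat + 1) → Fin n → Bool) (l : Fin (P.Lhat + 1))
    (G : Finset (Fin n)) :
    (surv κ l (G.erase i) : ℝ) ≤ surv κ l G ∧ (surv κ l G : ℝ) ≤ surv κ l (G.erase i) + 1 := by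
  unfold surv
  rw [Finset.filter_erase]
  constructor
  · exact_mod_cast Finset.card_erase_le
  · have := Finset.pred_card_le_card_erase (s := G.filter fun k => κ l k = true) (a := i)
    exact_mod_cast (by omega)

omit H in
lemma card_erase_div (l : Fin (P.Lhat + 1)) (G : Finset (Fin n)) :
    ((G.erase i).card : ℝ) / 2 ^ (l : ℕ) ≤ G.card / 2 ^ (l : ℕ) ∧
      (G.card : ℝ) / 2 ^ (l : ℕ) ≤ (G.erase i).card / 2 ^ (l : ℕ) + 1 := by
  constructor
  · gcongr
    exact Finset.erase_subset _ _
  · have h1 : (G.card : ℝ) ≤ (G.erase i).card + 1 := by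
      have := Finset.pred_card_le_card_erase (s := G) (a := i)
      exact_mod_cast (by omega)
    have h2 : (1 : ℝ) / 2 ^ (l : ℕ) ≤ 1 := by
      rw [div_le_one (by positivity)]
      exact one_le_pow₀ (by norm_num)
    calc (G.card : ℝ) / 2 ^ (l : ℕ) ≤ ((G.erase i).card + 1) / 2 ^ (l : ℕ) := by gcongr
      _ = (G.erase i).card / 2 ^ (l : ℕ) + 1 / 2 ^ (l : ℕ) := add_div _ _ _
      _ ≤ _ := by linarith

/-- Deleting `i` from `G` restores independence and changes the count by at most one, which half of
the additive term `t/4` absorbs. -/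
lemma IsRun.measure_column_and_surv_gt_le (l : Fin (P.Lhat + 1)) (G : Finset (Fin n)) {t : ℝ}
    (ht : 8 ≤ t) :
    μ.real {ω | Q (fun l => (seed ω).keep l i) ∧
      2 * ((G.card : ℝ) / 2 ^ (l : ℕ)) + t / 4 < surv (seed ω).keep l G} ≤
      2 / t * μ.real {ω | Q fun l => (seed ω).keep l i} := by
  set x := ((G.erase i).card : ℝ) / 2 ^ (l : ℕ) with hx
  have hx0 : 0 ≤ x := by positivity
  have h1 := H.measure_column_and_dev_le i Q l (G.notMem_erase i) (d := x + t / 8) (by positivity)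
  refine le_trans (measureReal_mono ?_ (measure_ne_top _ _)) (h1.trans ?_)
  · rintro ω ⟨hQ, h2⟩
    refine ⟨hQ, ?_⟩
    have h3 := surv_erase i (seed ω).keep l G
    have h4 := card_erase_div (P := P) i l G
    rw [← hx] at h4 ⊢
    refine le_trans ?_ (le_abs_self _)
    linarith [h3.2, h4.1]
  · refine mul_le_mul_of_nonneg_right ?_ measureReal_nonneg
    rw [← hx, div_le_div_iff₀ (by positivity) (by positivity)]
    -- The inequality `(x + t/8)² ≥ 4 x (t/8)` bounds the Chebyshev quotient by `2/t`, uniformly in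
    -- `x`.
    nlinarith [sq_nonneg (x - t / 8)]

lemma IsRun.measure_column_and_dev_gt_le (l : Fin (P.Lhat + 1)) (G : Finset (Fin n)) {c D : ℝ}
    (hD : 2 ≤ D) :
    μ.real {ω | Q (fun l => (seed ω).keep l i) ∧ (G.card : ℝ) / 2 ^ (l : ℕ) ≤ c ∧
      D < |(surv (seed ω).keep l G : ℝ) - G.card / 2 ^ (l : ℕ)|} ≤
      (if ((G.erase i).card : ℝ) / 2 ^ (l : ℕ) ≤ c then ((G.erase i).card : ℝ) / 2 ^ (l : ℕ) else 0)
        * (4 / D ^ 2) * μ.real {ω | Q fun l => (seed ω).keep l i} := by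
  have h4 := card_erase_div (P := P) i l G
  have h1 := H.measure_column_and_dev_le i Q l (G.notMem_erase i) (d := D / 2) (by positivity)
  split_ifs with hc
  · refine le_trans (measureReal_mono ?_ (measure_ne_top _ _)) (h1.trans (le_of_eq ?_))
    · rintro ω ⟨hQ, -, h2⟩
      refine ⟨hQ, ?_⟩
      have h3 := surv_erase i (seed ω).keep l G
      have h5 : |(surv (seed ω).keep l G : ℝ) - G.card / 2 ^ (l : ℕ)| ≤
          |(surv (seed ω).keep l (G.erase i) : ℝ) - (G.erase i).card / 2 ^ (l : ℕ)| + 1 := by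
        rw [abs_le]
        constructor
        · linarith [neg_abs_le
            ((surv (seed ω).keep l (G.erase i) : ℝ) - (G.erase i).card / 2 ^ (l : ℕ))]
        · linarith [le_abs_self
            ((surv (seed ω).keep l (G.erase i) : ℝ) - (G.erase i).card / 2 ^ (l : ℕ))]
      linarith
    · ring
  · have : {ω | Q (fun l => (seed ω).keep l i) ∧ (G.card : ℝ) / 2 ^ (l : ℕ) ≤ c ∧
        D < |(surv (seed ω).keep l G : ℝ) - G.card / 2 ^ (l : ℕ)|} = ∅ := by
      ext ω
      simp only [Set.mem_ofPred_eq, Set.mem_empty_iff_false, iff_false]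
      rintro ⟨-, h, -⟩
      exact hc (h4.1.trans h)
    rw [this]
    simp

lemma IsRun.measure_keep_zero (k : Fin n) : μ.real {ω | ¬ (seed ω).keep 0 k = true} = 0 := by
  have h := H.keep_rate 0 k
  have h2 := probReal_compl_eq_one_sub (μ := μ)
    (H.compSigma_le _ _ (measurableSet_keep_eq (Set.mem_univ (Component.column k)) 0 true))
  rw [h] at h2
  simp only [Fin.val_zero, pow_zero, sub_self] at h2
  exact h2

/-- The expected energy of the surviving columns, on an event about column `i`. -/
lemma IsRun.measure_column_and_mass_le (S : Setting P A) (l : Fin (P.Lhat + 1))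
    (hQ : energy (col A i) ≤ totalEnergy A * μ.real {ω | Q fun l => (seed ω).keep l i}) :
    μ.real {ω | Q (fun l => (seed ω).keep l i) ∧ 400 * P.L * totalEnergy A / 2 ^ (l : ℕ) <
        ∑ m with (seed ω).keep l m = true, energy (col A m)} ≤
      1 / (200 * P.L) * μ.real {ω | Q fun l => (seed ω).keep l i} := by
  classical
  have hL := S.L_pos
  have hM := S.M_pos
  set E := {ω | Q fun l => (seed ω).keep l i} with hE
  have hEm : MeasurableSet E := H.compSigma_le Set.univ _
    (measurableSet_of_finite (measurableSet_column (Set.mem_univ _)) Q)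
  have hkm : ∀ m, MeasurableSet {ω | (seed ω).keep l m = true} := fun m =>
    H.compSigma_le Set.univ _ (measurableSet_keep_eq (Set.mem_univ _) l true)
  let F : Ω → ℝ := fun ω => ∑ m, Set.indicator (E ∩ {ω | (seed ω).keep l m = true})
    (fun _ => energy (col A m)) ω
  have hFi : ∀ m, Integrable (Set.indicator (E ∩ {ω | (seed ω).keep l m = true})
    (fun _ => energy (col A m))) μ := fun m => (integrable_const _).indicator (hEm.inter (hkm m))
  have hF0 : ∀ ω, 0 ≤ F ω := fun ω => Finset.sum_nonneg fun m _ =>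
    Set.indicator_nonneg (fun _ _ => energy_nonneg _) ω
  have hFE : ∀ ω ∈ E, F ω = ∑ m with (seed ω).keep l m = true, energy (col A m) := by
    intro ω hω
    simp only [F, Set.indicator_apply, Set.mem_inter_iff, hω, true_and, Set.mem_ofPred_eq]
    rw [Finset.sum_filter]
  have hint : ∫ ω, F ω ∂μ ≤ 2 * (totalEnergy A / 2 ^ (l : ℕ)) * μ.real E := by
    simp only [F]
    rw [integral_finsetSum _ fun m _ => hFi m]
    have h1 : ∀ m, ∫ ω, Set.indicator (E ∩ {ω | (seed ω).keep l m = true})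
        (fun _ => energy (col A m)) ω ∂μ =
        μ.real (E ∩ {ω | (seed ω).keep l m = true}) * energy (col A m) := by
      intro m
      rw [integral_indicator (hEm.inter (hkm m)), setIntegral_const, smul_eq_mul]
    simp_rw [h1]
    have e2 : (1 / 2 : ℝ) ^ (l : ℕ) = 1 / 2 ^ (l : ℕ) := by rw [one_div, one_div, inv_pow]
    have h2 : ∀ m, m ≠ i → μ.real (E ∩ {ω | (seed ω).keep l m = true}) =
        μ.real E * (1 / 2 ^ (l : ℕ)) := by
      intro m hm
      have := H.measure_column_and i Q (column_notMem_otherColumns i) {ω | (seed ω).keep l m = true}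
        (measurableSet_keep_eq (column_mem_otherColumns hm) l true)
      rw [H.keep_rate, e2] at this
      exact this
    rw [← Finset.add_sum_erase _ _ (Finset.mem_univ i)]
    -- Column `i` need not be independent of `E`. Its survival still has probability at most `2^-l`,
    -- and `hQ` supplies the missing factor `μ E`.
    have h3 : μ.real (E ∩ {ω | (seed ω).keep l i = true}) * energy (col A i) ≤
        (totalEnergy A / 2 ^ (l : ℕ)) * μ.real E := by
      have h4 : μ.real (E ∩ {ω | (seed ω).keep l i = true}) ≤ 1 / 2 ^ (l : ℕ) := by
        rw [← e2, ← H.keep_rate l i]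
        exact measureReal_mono Set.inter_subset_right (measure_ne_top _ _)
      calc _ ≤ 1 / 2 ^ (l : ℕ) * (totalEnergy A * μ.real E) :=
            mul_le_mul h4 hQ (energy_nonneg _) (by positivity)
        _ = _ := by ring
    have h5 : ∑ m ∈ Finset.univ.erase i, μ.real (E ∩ {ω | (seed ω).keep l m = true}) *
        energy (col A m) ≤ (totalEnergy A / 2 ^ (l : ℕ)) * μ.real E := by
      have h6 : ∀ m ∈ Finset.univ.erase i, μ.real (E ∩ {ω | (seed ω).keep l m = true}) *
        energy (col A m) = (μ.real E * (1 / 2 ^ (l : ℕ))) * energy (col A m) := fun m hm => by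
        rw [h2 m (Finset.ne_of_mem_erase hm)]
      rw [Finset.sum_congr rfl h6, ← Finset.mul_sum]
      have h7 : ∑ m ∈ Finset.univ.erase i, energy (col A m) ≤ totalEnergy A :=
        Finset.sum_le_sum_of_subset_of_nonneg (Finset.subset_univ _) fun _ _ _ => energy_nonneg _
      calc _ ≤ μ.real E * (1 / 2 ^ (l : ℕ)) * totalEnergy A := by gcongr
        _ = _ := by ring
    linarith
  have hmarkov := mul_meas_ge_le_integral_of_nonneg (ae_of_all _ hF0)
    (integrable_finsetSum _ fun m _ => hFi m) (400 * P.L * totalEnergy A / 2 ^ (l : ℕ))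
  have hsub : μ.real {ω | Q (fun l => (seed ω).keep l i) ∧
      400 * P.L * totalEnergy A / 2 ^ (l : ℕ) <
        ∑ m with (seed ω).keep l m = true, energy (col A m)} ≤
      μ.real {ω | 400 * P.L * totalEnergy A / 2 ^ (l : ℕ) ≤ F ω} := by
    refine measureReal_mono ?_ (measure_ne_top _ _)
    rintro ω ⟨h1, h2⟩
    simp only [Set.mem_ofPred_eq]
    rw [hFE ω h1]
    exact h2.le
  refine hsub.trans ?_
  have hpos : 0 < 400 * P.L * totalEnergy A / 2 ^ (l : ℕ) := by positivity
  refine le_of_mul_le_mul_left (hmarkov.trans (hint.trans (le_of_eq ?_))) hpos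
  field_simp
  ring

end

end Subsampling

/-! ### A seed is good with high probability -/

section GoodProbability

variable {n : ℕ} {P : Params n} {A : Matrix (Fin n) (Fin n) ℝ} {Ω : Type*}
  [m0 : MeasurableSpace Ω] {μ : Measure Ω} [IsProbabilityMeasure μ] {seed : Ω → Seed P}
  {draw : Ω → Option (Fin (P.L + 1) × Fin n)} (H : IsRun P A μ seed draw) (S : Setting P A)
  (i : Fin n) (Q : (Fin (P.Lhat + 1) → Bool) → Prop)

lemma measureReal_exists_le {ι : Type*} [Fintype ι] (B : ι → Ω → Prop) :
    μ.real {ω | ∃ a, B a ω} ≤ ∑ a, μ.real {ω | B a ω} := by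
  have : {ω | ∃ a, B a ω} = ⋃ a ∈ (Finset.univ : Finset ι), {ω | B a ω} := by
    ext ω; simp
  rw [this]
  exact measureReal_biUnion_finset_le _ _

omit [IsProbabilityMeasure μ] in
lemma measureReal_or_le (B C : Ω → Prop) :
    μ.real {ω | B ω ∨ C ω} ≤ μ.real {ω | B ω} + μ.real {ω | C ω} :=
  measureReal_union_le {ω | B ω} {ω | C ω}

include H S

lemma IsRun.measure_exists_surv_gt_le (G : Fin (P.L + 1) → Finset (Fin n)) :
    μ.real {ω | ∃ lj : Fin (P.Lhat + 1) × Fin (P.L + 1), Q (fun l => (seed ω).keep l i) ∧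
      2 * (((G lj.2).card : ℝ) / 2 ^ (lj.1 : ℕ)) + P.T / 4 < surv (seed ω).keep lj.1 (G lj.2)} ≤
      1 / 200 * μ.real {ω | Q fun l => (seed ω).keep l i} := by
  have hε := S.ε_pos
  have hε1 := S.ε_le
  have hL := S.L_ge
  have hT := S.T_pos
  have hT8 : 8 ≤ P.T := by nlinarith [S.le_ε_mul_T]
  refine (measureReal_exists_le _).trans ((Finset.sum_le_card_nsmul _ _ _ fun lj _ =>
    H.measure_column_and_surv_gt_le i Q lj.1 (G lj.2) hT8).trans ?_)
  rw [nsmul_eq_mul, ← mul_assoc]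
  refine mul_le_mul_of_nonneg_right ?_ measureReal_nonneg
  simp only [Finset.card_univ, Fintype.card_prod, Fintype.card_fin]
  push_cast
  have h1 : (P.Lhat : ℝ) + 1 ≤ 2 * P.L := by
    have : (P.Lhat : ℝ) ≤ P.L := by exact_mod_cast S.Lhat_le
    linarith
  -- The `L²` in `T` pays for the union bound over pairs of levels.
  calc ((P.Lhat : ℝ) + 1) * (P.L + 1) * (2 / P.T) ≤ (2 * P.L) * (2 * P.L) * (2 / P.T) := by
        gcongr; linarith
    _ = 8 * P.ε ^ 2 := by
      unfold Params.T
      have := S.L_pos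
      field_simp
      ring
    _ ≤ 1 / 200 := by nlinarith

lemma IsRun.measure_exists_dev_gt_le (G : Fin (P.L + 1) → Finset (Fin n)) :
    μ.real {ω | ∃ jl : Fin (P.L + 1) × Fin (P.Lhat + 1), Q (fun l => (seed ω).keep l i) ∧
      ((G jl.1).card : ℝ) / 2 ^ (jl.2 : ℕ) ≤ 4 * P.T ∧ P.ε * P.T / 2 <
      |(surv (seed ω).keep jl.2 (G jl.1) : ℝ) - (G jl.1).card / 2 ^ (jl.2 : ℕ)|} ≤
      1 / 200 * μ.real {ω | Q fun l => (seed ω).keep l i} := by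
  have hε := S.ε_pos
  have hL := S.L_ge
  have hL0 := S.L_pos
  have hT := S.T_pos
  have hεT := S.le_ε_mul_T
  refine (measureReal_exists_le _).trans ((Finset.sum_le_sum fun jl _ =>
    H.measure_column_and_dev_gt_le i Q jl.2 (G jl.1) (c := 4 * P.T) (D := P.ε * P.T / 2)
      (by linarith)).trans ?_)
  rw [← Finset.sum_mul, ← Finset.sum_mul]
  refine mul_le_mul_of_nonneg_right ?_ measureReal_nonneg
  rw [Fintype.sum_prod_type]
  -- Only subsampling levels with at most `4T` expected survivors are charged, so for each `j` the
  -- sum over `l` is of order `T`, with no factor for the number of levels.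
  have h1 : ∀ j : Fin (P.L + 1), ∑ l : Fin (P.Lhat + 1),
      (if (((G j).erase i).card : ℝ) / 2 ^ (l : ℕ) ≤ 4 * P.T then
        (((G j).erase i).card : ℝ) / 2 ^ (l : ℕ) else 0) ≤ 8 * P.T := by
    intro j
    rw [Fin.sum_univ_eq_sum_range (fun l => if (((G j).erase i).card : ℝ) / 2 ^ l ≤ 4 * P.T then
        (((G j).erase i).card : ℝ) / 2 ^ l else 0)]
    refine (sum_ite_div_two_pow_le (by positivity) (by positivity) _).trans (le_of_eq ?_)
    ring
  refine (mul_le_mul_of_nonneg_right (Finset.sum_le_card_nsmul _ _ _ fun j _ => h1 j)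
    (by positivity)).trans ?_
  rw [nsmul_eq_mul]
  simp only [Finset.card_univ, Fintype.card_fin]
  push_cast
  calc ((P.L : ℝ) + 1) * (8 * P.T) * (4 / (P.ε * P.T / 2) ^ 2)
      ≤ (2 * P.L) * (8 * P.T) * (4 / (P.ε * P.T / 2) ^ 2) := by gcongr; linarith
    _ = 256 / (P.L : ℝ) := by
      unfold Params.T
      field_simp
      ring
    -- Here `L` must be large: `L ≥ 51200` is required, and `L ≥ 10^5` is ensured by the choice of
    -- `ε₀`.
    _ ≤ 1 / 200 := by
      rw [div_le_div_iff₀ hL0 (by norm_num)]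
      linarith

lemma IsRun.measure_exists_mass_le
    (hQ : energy (col A i) ≤ totalEnergy A * μ.real {ω | Q fun l => (seed ω).keep l i}) :
    μ.real {ω | ∃ l : Fin (P.Lhat + 1), Q (fun l => (seed ω).keep l i) ∧
      400 * P.L * totalEnergy A / 2 ^ (l : ℕ) <
        ∑ m with (seed ω).keep l m = true, energy (col A m)} ≤
      1 / 100 * μ.real {ω | Q fun l => (seed ω).keep l i} := by
  have hL := S.L_ge
  have hL0 := S.L_pos
  refine (measureReal_exists_le _).trans ((Finset.sum_le_card_nsmul _ _ _ fun l _ =>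
    H.measure_column_and_mass_le i Q S l hQ).trans ?_)
  rw [nsmul_eq_mul, ← mul_assoc]
  refine mul_le_mul_of_nonneg_right ?_ measureReal_nonneg
  simp only [Finset.card_univ, Fintype.card_fin]
  push_cast
  have h1 : (P.Lhat : ℝ) + 1 ≤ 2 * P.L := by
    have : (P.Lhat : ℝ) ≤ P.L := by exact_mod_cast S.Lhat_le
    linarith
  calc ((P.Lhat : ℝ) + 1) * (1 / (200 * P.L)) ≤ (2 * P.L) * (1 / (200 * P.L)) := by gcongr
    _ = 1 / 100 := by field_simp; norm_num

/-- The bound is relative to the probability of `Q`, since `Q` will be an event of probability about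
`2^-ℓ`, against which an absolute error would be useless. The loss is `1/100` for the surviving
energy and `1/200` for each of the four counts. -/
lemma IsRun.measure_not_goodSample_le (z : ℝ)
    (hQ : energy (col A i) ≤ totalEnergy A * μ.real {ω | Q fun l => (seed ω).keep l i}) :
    μ.real {ω | Q (fun l => (seed ω).keep l i) ∧ ¬ GoodSample A z (seed ω).keep} ≤
      3 / 100 * μ.real {ω | Q fun l => (seed ω).keep l i} := by
  have h0 : μ.real {ω | ∃ k, ¬ (seed ω).keep 0 k = true} ≤ 0 :=
    (measureReal_exists_le _).trans (by simp_rw [H.measure_keep_zero]; simp)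
  have h1 := H.measure_exists_mass_le S i Q hQ
  have h2 := H.measure_exists_surv_gt_le S i Q fun j => outer P A z j
  have h3 := H.measure_exists_surv_gt_le S i Q fun j => above P A z j
  have h4 := H.measure_exists_dev_gt_le S i Q fun j => outer P A z j
  have h5 := H.measure_exists_dev_gt_le S i Q fun j => inner P A z j
  have b4 := (measureReal_or_le _ _).trans (add_le_add h4 h5)
  have b3 := (measureReal_or_le _ _).trans (add_le_add h3 b4)
  have b2 := (measureReal_or_le _ _).trans (add_le_add h2 b3)
  have b1 := (measureReal_or_le _ _).trans (add_le_add h1 b2)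
  have b0 := (measureReal_or_le _ _).trans (add_le_add h0 b1)
  refine (le_trans (measureReal_mono (fun ω hω => ?_) (measure_ne_top _ _)) b0).trans
    (le_of_eq (by ring))
  obtain ⟨hq, hg⟩ := hω
  simp only [Set.mem_ofPred_eq]
  by_contra! hcon
  obtain ⟨c0, c1, c2, c3, c4, c5⟩ := hcon
  refine hg ⟨c0, fun l => c1 l hq, fun l j hj => ?_, fun l j hj => ?_, fun l j hj => ?_,
    fun l j hj => ?_⟩
  · exact c2 (l, ⟨j, by omega⟩) hq
  · exact c3 (l, ⟨j, by omega⟩) hq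
  · exact c4 (⟨j, by omega⟩, l) hq
  · exact c5 (⟨j, by omega⟩, l) hq

omit H in
lemma mass_le_tauSq {κ : Fin (P.Lhat + 1) → Fin n → Bool} {z : ℝ} (hg : GoodSample A z κ)
    {κ' : Fin (P.Lhat + 1) → Fin n → Bool} (hκ : ∀ l m, κ' l m = true → κ l m = true)
    (l : Fin (P.Lhat + 1)) :
    ∑ m with κ' l m = true, energy (col A m) ≤ tauSq P A l * (1 / 2000) ^ 2 * P.w l := by
  have h1 : ∑ m with κ' l m = true, energy (col A m) ≤ ∑ m with κ l m = true, energy (col A m) := by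
    refine Finset.sum_le_sum_of_subset_of_nonneg ?_ fun _ _ _ => energy_nonneg _
    intro m
    simpa using hκ l m
  refine h1.trans ((hg.mass l).trans (le_of_eq ?_))
  unfold tauSq
  have := S.w_pos l
  field_simp

/-- Fixing the scale of a seed. -/
def Seed.withScale {n : ℕ} {P : Params n} (s : Seed P) (z : ℝ) : Seed P := { s with ζ := z }

/-- The scale is frozen at `z`, so the event concerns only the finitely valued part of the seed.
Given a good sample, the noise is controlled by the independent tables. -/
lemma IsRun.measure_not_good_le {z : ℝ} (hz : z ∈ Set.Icc (1 / 2 : ℝ) 1)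
    (hQ : energy (col A i) ≤ totalEnergy A * μ.real {ω | Q fun l => (seed ω).keep l i}) :
    μ.real {ω | Q (fun l => (seed ω).keep l i) ∧ ¬ Good A ((seed ω).withScale z)} ≤
      4 / 100 * μ.real {ω | Q fun l => (seed ω).keep l i} := by
  have h1 := H.measure_not_goodSample_le S i Q z hQ
  have h2 := H.measure_and_someNoisy_le S.cR_eq S.n_pos (S.tauSq_pos) (fun κ => κ)
    (fun κ => Q (fun l => κ l i) ∧ GoodSample A z κ)
    (fun κ hκ l => mass_le_tauSq S hκ.2 (fun _ _ h => h) l)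
  have h3 : μ.real {ω | Q (fun l => (seed ω).keep l i) ∧ GoodSample A z (seed ω).keep} ≤
      μ.real {ω | Q fun l => (seed ω).keep l i} :=
    measureReal_mono (fun ω hω => hω.1) (measure_ne_top _ _)
  refine (le_trans (measureReal_mono (fun ω hω => ?_) (measure_ne_top _ _))
    ((measureReal_or_le _ _).trans (add_le_add h1 (h2.trans
      (mul_le_mul_of_nonneg_left h3 (by norm_num)))))).trans (le_of_eq (by ring))
  obtain ⟨hq, hg⟩ := hω
  simp only [Set.mem_ofPred_eq]
  by_cases hs : GoodSample A z (seed ω).keep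
  · right
    refine ⟨⟨hq, hs⟩, ?_⟩
    by_contra hn
    exact hg ⟨hz, hs, hn⟩
  · exact Or.inl ⟨hq, hs⟩

end GoodProbability

/-! ### The effect of one column on the level that is used -/

section Removal

variable {n : ℕ} {P : Params n} {A : Matrix (Fin n) (Fin n) ℝ}

/-- The survival indicators in which column `i` is removed from level `l`. -/
def dropKeep (κ : Fin (P.Lhat + 1) → Fin n → Bool) (l : Fin (P.Lhat + 1)) (i : Fin n) :
    Fin (P.Lhat + 1) → Fin n → Bool :=
  fun l' k => if l' = l ∧ k = i then false else κ l' k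

/-- The seed in which column `i` is removed from level `l`. -/
def Seed.drop (s : Seed P) (l : Fin (P.Lhat + 1)) (i : Fin n) : Seed P :=
  { s with keep := dropKeep s.keep l i }

variable {κ : Fin (P.Lhat + 1) → Fin n → Bool} {l : Fin (P.Lhat + 1)} {i : Fin n} {s : Seed P}

lemma keep_of_dropKeep {l' : Fin (P.Lhat + 1)} {k : Fin n} (h : dropKeep κ l i l' k = true) :
    κ l' k = true := by
  unfold dropKeep at h
  split_ifs at h
  exact h

lemma dropKeep_self {k : Fin n} : dropKeep κ l i l k = true ↔ k ≠ i ∧ κ l k = true := by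
  unfold dropKeep
  by_cases h : k = i <;> simp [h]

lemma dropKeep_of_not (h : ¬ κ l i = true) : dropKeep κ l i = κ := by
  funext l' k
  unfold dropKeep
  split_ifs with h1
  · rw [h1.1, h1.2]
    exact (by simpa using h : κ l i = false).symm
  · rfl

lemma drop_of_not (h : ¬ s.keep l i = true) : s.drop l i = s := by
  unfold Seed.drop
  rw [dropKeep_of_not h]

/-- At level `l`, column `i` shares a bucket with a surviving column of `G`. -/
def Collision (κ : Fin n → Bool) (l : Fin (P.Lhat + 1)) (G : Finset (Fin n)) (i : Fin n)
    (s : Seed P) : Prop :=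
  ∃ rk : Fin P.R × Fin n, (rk.2 ∈ G ∧ κ rk.2 = true ∧ rk.2 ≠ i) ∧
    s.hash l rk.1 rk.2 = s.hash l rk.1 i

lemma lookup_drop (r : Fin P.R) {k : Fin n} (h : s.hash l r k ≠ s.hash l r i) :
    (s.drop l i).lookup A l k r = s.lookup A l k r := by
  funext m
  simp only [Seed.lookup, Seed.bucket, Seed.drop]
  refine Finset.sum_congr ?_ fun _ _ => rfl
  ext u
  simp only [Finset.mem_filter, Finset.mem_univ, true_and, dropKeep_self]
  constructor
  · exact fun hu => ⟨hu.1.2, hu.2⟩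
  · refine fun hu => ⟨⟨?_, hu.1⟩, hu.2⟩
    rintro rfl
    exact h hu.2.symm

/-- Column `i` enters the estimate of `k` only through a shared bucket. -/
lemma est_drop {k : Fin n} (h : ∀ r, s.hash l r k ≠ s.hash l r i) :
    (s.drop l i).est A l k = s.est A l k := by
  have : (s.drop l i).lookup A l k = s.lookup A l k := funext fun r => lookup_drop r (h r)
  simp only [Seed.est, Seed.query, this]

variable (S : Setting P A) {j ℓ : ℕ}
include S

/-- A member of the band computed without `i` is close to its true energy, hence lies in `outer`.
Without collisions its estimate does not change when `i` returns, and it is then still among the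
heavy columns. Only an inclusion is claimed, as `i` itself may join the band. -/
lemma band_drop_subset (hs : Good A s) (hr : Resolvable A s.ζ l j)
    (hsize : surv s.keep l (above P A s.ζ j) < P.listSize)
    (hnoise : ¬ SomeNoisy A (tauSq P A) s (dropKeep s.keep l i))
    (hcol : ¬ Collision (s.keep l) l (outer P A s.ζ j) i s) :
    (s.drop l i).band A l j ⊆ s.band A l j := by
  intro k hk
  have ha := S.mag_pos hs.scale j
  have hε := S.ε_pos
  have hsl := S.slack_pos
  rw [mem_band_iff] at hk
  obtain ⟨hh, h1, h2⟩ := hk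
  have hkeep : dropKeep s.keep l i l k = true := by
    simp only [Seed.heavy, Finset.mem_filter] at hh
    exact hh.2.1
  change (1 + P.ε) * mag P s.ζ j ≤ (s.drop l i).est A l k at h1
  change (s.drop l i).est A l k ≤ (2 - P.ε) * mag P s.ζ j at h2
  have h3 : |√((s.drop l i).est A l k) - √(energy (col A k))| ≤
      P.slack / 4 * √(mag P s.ζ j) := by
    have h4 := abs_sqrt_est_sub_le (s.drop l i) A l k hkeep (τ := tauSq P A l)
      fun h => hnoise ⟨l, k, h⟩
    refine h4.trans ?_
    rw [← Real.sqrt_sq (by positivity : 0 ≤ P.slack / 4), ← Real.sqrt_mul (sq_nonneg _)]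
    exact Real.sqrt_le_sqrt hr
  have h5 := abs_le.mp (abs_sub_le_of_abs_sqrt_sub_le (est_nonneg _ _) (energy_nonneg _) ha.le
    hsl.le (by linarith [S.slack_le, S.ε_lt_one, S.ε_pos]) h3 (by nlinarith))
  have ho : k ∈ outer P A s.ζ j := by
    simp only [outer, Finset.mem_filter, Finset.mem_univ, true_and]
    constructor <;> linarith [h5.1, h5.2]
  rw [dropKeep_self] at hkeep
  have he : (s.drop l i).est A l k = s.est A l k :=
    est_drop fun r hrk => hcol ⟨(r, k), ⟨ho, hkeep.2, hkeep.1⟩, hrk⟩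
  rw [he] at h1 h2
  rw [mem_band_iff]
  exact ⟨hs.mem_heavy S hr hsize hkeep.2 (by nlinarith), h1, h2⟩

/-- The inclusion of bands transports the lower end of the range. The upper end needs no comparison,
because at the critical level the band is never too large on a good seed. -/
lemma Usable.inRange_of_drop (hs : Good A s) (hu : Usable P A s.ζ j) (hc : IsCritical P A s.ζ j ℓ)
    (hj : j ≤ P.L) (hl : (l : ℕ) = ℓ)
    (hnoise : ¬ SomeNoisy A (tauSq P A) s (dropKeep s.keep l i))
    (hcol : ¬ Collision (s.keep l) l (outer P A s.ζ j) i s)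
    (h : (s.drop l i).InRange A j l) : s.InRange A j l := by
  have hε := S.ε_pos
  have hT := S.T_pos
  have h20 := sqrt_twenty_bounds
  have hεT : 0 < P.ε * P.T := by positivity
  have h1 := Finset.card_le_card (band_drop_subset S hs (hu.resolvable S hs.scale hc (by omega))
    (hu.surv_above_lt S hs hc hj (by omega)) hnoise hcol)
  have h2 := hu.card_band_le S hs hc hj (l := l) (by omega)
  rw [inRange_iff S] at h ⊢
  refine ⟨h.1.trans (by exact_mod_cast h1), h2.trans ?_⟩
  have h3 : ((outer P A s.ζ j).card : ℝ) / 2 ^ (l : ℕ) ≤ (1 - 6 * P.ε) * P.T * 2 := by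
    rw [div_le_iff₀ (by positivity), hl]
    refine hc.2.2.2.le.trans (le_of_eq ?_)
    rw [pow_succ]
    ring
  nlinarith

end Removal

/-! ### Survival of one column at the level that is used -/

section Coupling

variable {n : ℕ} {P : Params n} {A : Matrix (Fin n) (Fin n) ℝ} {Ω : Type*}
  [m0 : MeasurableSpace Ω] {μ : Measure Ω} [IsProbabilityMeasure μ] {seed : Ω → Seed P}
  {draw : Ω → Option (Fin (P.L + 1) × Fin n)} (H : IsRun P A μ seed draw) (S : Setting P A)
  {i : Fin n} {z : ℝ} {j ℓ : ℕ} {l l' : Fin (P.Lhat + 1)}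
include H

lemma IsRun.measure_collision_le (κ : Fin n → Bool) (l : Fin (P.Lhat + 1)) (G : Finset (Fin n))
    (i : Fin n) : μ.real {ω | Collision κ l G i (seed ω)} ≤
      P.R * (G.filter fun k => κ k = true).card / P.w l := by
  classical
  have h1 : ∀ rk : Fin P.R × Fin n, μ.real {ω | (rk.2 ∈ G ∧ κ rk.2 = true ∧ rk.2 ≠ i) ∧
      (seed ω).hash l rk.1 rk.2 = (seed ω).hash l rk.1 i} ≤
      if rk.2 ∈ G.filter fun k => κ k = true then 1 / (P.w l : ℝ) else 0 := by
    rintro ⟨r, k⟩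
    by_cases hk : k ∈ G ∧ κ k = true ∧ k ≠ i
    · rw [if_pos (Finset.mem_filter.mpr ⟨hk.1, hk.2.1⟩),
        ← measure_collision (fun v => H.compSigma_le Set.univ _
          (measurableSet_hash (Set.mem_univ _) v)) (H.hash_pairwise l r) hk.2.2]
      exact measureReal_mono (fun ω hω => hω.2) (measure_ne_top _ _)
    · simp only [hk, false_and]
      rw [show {ω : Ω | False} = ∅ from rfl, measureReal_empty]
      split_ifs <;> positivity
  refine (measureReal_exists_le _).trans ((Finset.sum_le_sum fun rk _ => h1 rk).trans ?_)
  rw [Fintype.sum_prod_type]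
  simp only [Finset.sum_ite_mem, Finset.univ_inter, Finset.sum_const, Finset.card_univ,
    Fintype.card_fin, nsmul_eq_mul]
  exact le_of_eq (by ring)

/-- Events that do not depend on the survival of column `i`, and on the survival of the other columns
only at level `l`, are independent of column `i`. -/
lemma IsRun.measure_column_and_of_congr (Q : (Fin (P.Lhat + 1) → Bool) → Prop)
    (B : Seed P → Prop) (l : Fin (P.Lhat + 1)) (z : ℝ) (hB : ∀ s s' : Seed P,
      (∀ k, k ≠ i → s.keep l k = s'.keep l k) → s.hash = s'.hash → s.sign = s'.sign →
      s.ζ = s'.ζ → (B s ↔ B s')) :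
    μ.real {ω | Q (fun l => (seed ω).keep l i) ∧ B ((seed ω).withScale z)} =
      μ.real {ω | Q fun l => (seed ω).keep l i} * μ.real {ω | B ((seed ω).withScale z)} := by
  classical
  have hSc : Component.column i ∉ otherColumns P i ∪ tableComps P := by
    rintro (h | h)
    · exact column_notMem_otherColumns i h
    · exact Set.disjoint_left.mp disjoint_columnComps_tableComps ⟨i, rfl⟩ h
  refine H.measure_column_and i Q hSc {ω | B ((seed ω).withScale z)} ?_
  let X : Ω → (Fin n → Bool) × (((l : Fin (P.Lhat + 1)) → Fin P.R → Fin n → Fin (P.w l)) ×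
      (Fin (P.Lhat + 1) → Fin P.R → Fin n → ℤˣ)) :=
    -- The entry of column `i` is blanked, so that `X` is measurable with respect to the other
    -- columns and the tables.
    fun ω => (fun k => if k = i then false else (seed ω).keep l k, (seed ω).hash, (seed ω).sign)
  have hX : ∀ v, MeasurableSet[compSigma seed (otherColumns P i ∪ tableComps P)] {ω | X ω = v} := by
    intro v
    have e : {ω | X ω = v} =
        (⋂ k, {ω | (if k = i then false else (seed ω).keep l k) = v.1 k}) ∩
          {ω | ((seed ω).hash, (seed ω).sign) = v.2} := by
      ext ω
      simp only [X, Set.mem_inter_iff, Set.mem_iInter, Set.mem_ofPred_eq]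
      rw [Prod.ext_iff, funext_iff]
    rw [e]
    refine (MeasurableSet.iInter fun k => ?_).inter
      (measurableSet_tables Set.subset_union_right v.2)
    by_cases hk : k = i
    · simp only [hk, if_true]
      exact MeasurableSet.const _
    · simp only [hk, if_false]
      exact measurableSet_keep_eq (Set.mem_union_left _ (column_mem_otherColumns hk)) l (v.1 k)
  have e : {ω | B ((seed ω).withScale z)} =
      {ω | (fun v => B ⟨z, fun _ => v.1, v.2.1, v.2.2⟩) (X ω)} := by
    ext ω
    refine hB _ _ (fun k hk => ?_) rfl rfl rfl
    simp [X, hk, Seed.withScale]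
  rw [e]
  exact measurableSet_of_finite hX fun v => B ⟨z, fun _ => v.1, v.2.1, v.2.2⟩

omit H in
lemma band_congr {s s' : Seed P} {l : Fin (P.Lhat + 1)} (hk : s.keep l = s'.keep l)
    (hh : s.hash = s'.hash) (hσ : s.sign = s'.sign) (hz : s.ζ = s'.ζ) (j : ℕ) :
    s.band A l j = s'.band A l j := by
  obtain ⟨z, κ, h, σ⟩ := s
  obtain ⟨z', κ', h', σ'⟩ := s'
  simp only at hk hh hσ hz
  subst hh hσ hz
  have hb : ∀ r v, Seed.bucket ⟨z, κ, h, σ⟩ A l r v = Seed.bucket ⟨z, κ', h, σ⟩ A l r v :=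
    fun r v => funext fun m => by simp only [Seed.bucket, hk]
  have he : ∀ k, Seed.est ⟨z, κ, h, σ⟩ A l k = Seed.est ⟨z, κ', h, σ⟩ A l k :=
    fun k => by simp only [Seed.est, Seed.query, Seed.lookup, hb]
  simp only [Seed.band, Seed.heavy, he, hk]

omit H in
/-- The part of a seed that takes finitely many values. -/
def Seed.tables {n : ℕ} {P : Params n} (s : Seed P) : (Fin (P.Lhat + 1) → Fin n → Bool) ×
    (((l : Fin (P.Lhat + 1)) → Fin P.R → Fin n → Fin (P.w l)) ×
      (Fin (P.Lhat + 1) → Fin P.R → Fin n → ℤˣ)) := (s.keep, s.hash, s.sign)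

omit H in
lemma measurableSet_seed_tables {Sc : Set (Component P)} (h1 : columnComps P ⊆ Sc)
    (h2 : tableComps P ⊆ Sc) (v) : MeasurableSet[compSigma seed Sc] {ω | (seed ω).tables = v} := by
  have e : {ω | (seed ω).tables = v} =
      {ω | (seed ω).keep = v.1} ∩ {ω | ((seed ω).hash, (seed ω).sign) = v.2} := by
    ext ω
    simp only [Seed.tables, Set.mem_inter_iff, Set.mem_ofPred_eq]
    rw [Prod.ext_iff]
  rw [e]
  exact (measurableSet_keep h1 v.1).inter (measurableSet_tables h2 v.2)

lemma IsRun.measurableSet_withScale (z : ℝ) (Q : Seed P → Prop) :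
    MeasurableSet {ω | Q ((seed ω).withScale z)} :=
  H.compSigma_le Set.univ _ (measurableSet_of_finite
    (X := fun ω => (seed ω).tables) (measurableSet_seed_tables (Set.subset_univ _) (Set.subset_univ _))
    fun v => Q ⟨z, v.1, v.2.1, v.2.2⟩)

lemma IsRun.integrable_withScale (z : ℝ) (F : Seed P → ℝ) :
    Integrable (fun ω => F ((seed ω).withScale z)) μ :=
  integrable_comp_of_finite (X := fun ω => (seed ω).tables) (fun v => H.compSigma_le Set.univ _
    (measurableSet_seed_tables (Set.subset_univ _) (Set.subset_univ _) v))
    fun v => F ⟨z, v.1, v.2.1, v.2.2⟩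

lemma IsRun.mul_measure_le_integral (z : ℝ) {F : Seed P → ℝ} (hF : ∀ s, 0 ≤ F s) {c : ℝ}
    (hc : 0 ≤ c) {Q : Seed P → Prop} (hQ : ∀ s, Q s → c ≤ F s) :
    c * μ.real {ω | Q ((seed ω).withScale z)} ≤ ∫ ω, F ((seed ω).withScale z) ∂μ := by
  refine le_trans ?_ (mul_meas_ge_le_integral_of_nonneg (ae_of_all _ fun ω => hF _)
    (H.integrable_withScale z F) c)
  exact mul_le_mul_of_nonneg_left
    (measureReal_mono (fun ω hω => hQ _ hω) (measure_ne_top _ _)) hc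

lemma IsRun.measure_keep (hl : (l : ℕ) = ℓ) :
    μ.real {ω | (seed ω).keep l i = true} = 1 / 2 ^ ℓ := by
  rw [H.keep_rate, hl, one_div, inv_pow, one_div]

/-- Only marginal survival rates enter: `2 · 2^-ℓ` at level `ℓ - 1` minus `2^-ℓ` at level `ℓ` is a
lower bound under any joint law, nested or independent. -/
lemma IsRun.measure_keep_pred_bounds (hl : (l : ℕ) = ℓ) (hl' : (l' : ℕ) + 1 = ℓ) :
    1 / 2 ^ ℓ ≤ μ.real {ω | (seed ω).keep l' i = true ∧ ¬ (seed ω).keep l i = true} ∧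
    μ.real {ω | (seed ω).keep l' i = true ∧ ¬ (seed ω).keep l i = true} ≤ 2 * (1 / 2 ^ ℓ) := by
  have h1 := H.measure_keep (i := i) hl
  have h2 := H.measure_keep (l := l') (i := i) rfl
  have h3 : (1 : ℝ) / 2 ^ (l' : ℕ) = 2 * (1 / 2 ^ ℓ) := by
    rw [← hl', pow_succ]
    field_simp
  rw [h3] at h2
  constructor
  · have h4 : μ.real {ω | (seed ω).keep l' i = true} ≤
        μ.real {ω | (seed ω).keep l' i = true ∧ ¬ (seed ω).keep l i = true} +
          μ.real {ω | (seed ω).keep l i = true} := by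
      refine (measureReal_mono (fun ω hω => ?_) (measure_ne_top _ _)).trans
        (measureReal_or_le _ _)
      simp only [Set.mem_ofPred_eq] at hω ⊢
      tauto
    linarith
  · rw [← h2]
    exact measureReal_mono (fun ω hω => hω.1) (measure_ne_top _ _)

omit H in
include S in
-- At least `2 · 2^ℓ` columns have energy comparable to that of `i`, so `i` has at most a `2^-ℓ`
-- share of the total. This is the hypothesis under which conditioning on the survival of `i` leaves
-- the surviving energy under control.
lemma energy_le_of_isCritical (hz : z ∈ Set.Icc (1 / 2 : ℝ) 1) (hc : IsCritical P A z j ℓ)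
    (hi : i ∈ outer P A z j) : energy (col A i) ≤ totalEnergy A * (1 / 2 ^ ℓ) := by
  have h1 := (mem_outer_bounds S hz hi).2
  have h2 := card_outer_mul_mag_le_total S hz (A := A) j
  have h3 := hc.2.2.1
  have ha := S.mag_pos hz j
  have hεT := S.le_ε_mul_T
  have hε := S.ε_le
  have hε0 := S.ε_pos
  have hT := S.T_pos
  have h4 : (2 : ℝ) * 2 ^ ℓ ≤ (outer P A z j).card := by
    refine le_trans (mul_le_mul_of_nonneg_right ?_ (by positivity)) h3
    nlinarith
  rw [mul_one_div, le_div_iff₀ (by positivity)]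
  have h5 : 2 * mag P z j * 2 ^ ℓ ≤ (outer P A z j).card * mag P z j := by nlinarith
  have h6 : energy (col A i) * 2 ^ ℓ ≤ 2 * mag P z j * 2 ^ ℓ := by gcongr
  linarith

include S

/-- At most `9T` columns of `outer` survive on a good sample and there are at most `3L` repetitions.
The `27 L³/ε²` possible collisions are far fewer than the buckets. -/
lemma IsRun.measure_keep_and_collision_le (hz : z ∈ Set.Icc (1 / 2 : ℝ) 1)
    (hc : IsCritical P A z j ℓ) (hj : j ≤ P.L) (hl : (l : ℕ) = ℓ) :
    μ.real {ω | ((seed ω).keep l i = true ∧ GoodSample A z (seed ω).keep) ∧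
      Collision ((seed ω).keep l) l (outer P A z j) i (seed ω)} ≤
      1 / 100 * μ.real {ω | (seed ω).keep l i = true} := by
  have hL := S.L_ge
  have hL0 := S.L_pos
  have hε := S.ε_pos
  have hε1 := S.ε_le
  refine (measureReal_le_of_indep (b := 1 / 100) (H.compSigma_le _) (H.compSigma_le _)
    (H.indep_compSigma disjoint_columnComps_tableComps) (X := fun ω => (seed ω).keep)
    (fun v => measurableSet_keep le_rfl v)
    (B := fun κ => {ω | Collision (κ l) l (outer P A z j) i (seed ω)})
    (fun κ => measurableSet_of_finite (X := fun ω => ((seed ω).hash, (seed ω).sign))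
      (measurableSet_tables le_rfl)
      fun v => Collision (κ l) l (outer P A z j) i ⟨0, fun _ _ => true, v.1, v.2⟩)
    (fun κ => κ l i = true ∧ GoodSample A z κ) ?_).trans ?_
  · rintro κ ⟨-, hg⟩
    refine (H.measure_collision_le _ _ _ _).trans ?_
    have h1 := hg.outer_le l j hj
    have h2 := hc.card_div_le S hz (l := l) (by omega)
    have h3 : (((outer P A z j).filter fun k => κ l k = true).card : ℝ) ≤ 9 * P.T := by
      have := S.T_pos
      refine h1.trans ?_
      linarith
    have hw := S.le_w l
    have hR := S.R_le
    have hwpos := S.w_pos l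
    rw [div_le_iff₀ hwpos]
    calc (P.R : ℝ) * ((outer P A z j).filter fun k => κ l k = true).card
        ≤ (3 * P.L) * (9 * P.T) := by gcongr
      _ = 27 * (P.L : ℝ) ^ 3 / P.ε ^ 2 := by unfold Params.T; ring
      _ ≤ 1 / 100 * (10 ^ 24 * (P.L : ℝ) ^ 6 / P.ε ^ 6) := by
        rw [← mul_div_assoc, div_le_div_iff₀ (by positivity) (by positivity)]
        have e1 : (P.L : ℝ) ^ 3 ≤ (P.L : ℝ) ^ 6 := pow_le_pow_right₀ (by linarith) (by norm_num)
        have e2 : P.ε ^ 6 ≤ P.ε ^ 2 := pow_le_pow_of_le_one hε.le (by linarith) (by norm_num)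
        calc 27 * (P.L : ℝ) ^ 3 * P.ε ^ 6 ≤ 27 * (P.L : ℝ) ^ 6 * P.ε ^ 2 := by gcongr
          _ ≤ 1 / 100 * (10 ^ 24 * (P.L : ℝ) ^ 6) * P.ε ^ 2 := by
            refine mul_le_mul_of_nonneg_right ?_ (by positivity)
            have : 0 ≤ (P.L : ℝ) ^ 6 := by positivity
            linarith
      _ ≤ 1 / 100 * P.w l := by gcongr
  · exact mul_le_mul_of_nonneg_left (measureReal_mono (fun ω hω => hω.1) (measure_ne_top _ _))
      (by norm_num)

/-- Whether or not the critical level is used, column `i` has a fair chance to survive at the level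
that is used. -/
lemma IsRun.le_measure_keep_usedLevel (hz : z ∈ Set.Icc (1 / 2 : ℝ) 1) (hu : Usable P A z j)
    (hc : IsCritical P A z j ℓ) (hj : j ≤ P.L) (hi : i ∈ inner P A z j) (hl : (l : ℕ) = ℓ)
    (hl' : (l' : ℕ) + 1 = ℓ) :
    1 / 2 * (1 / 2 ^ ℓ) ≤
      μ.real {ω | (seed ω).keep l i = true ∧ ((seed ω).withScale z).InRange A j l ∧
        Good A ((seed ω).withScale z)} +
      μ.real {ω | (seed ω).keep l' i = true ∧ ¬ ((seed ω).withScale z).InRange A j l ∧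
        Good A ((seed ω).withScale z)} := by
  have he := energy_le_of_isCritical S hz hc (inner_subset_outer S hz j hi)
  have hM := S.M_pos
  have hb1 := H.measure_keep (i := i) hl
  obtain ⟨hb2, hb3⟩ := H.measure_keep_pred_bounds (i := i) hl hl'
  set b : ℝ := 1 / 2 ^ ℓ with hb
  have hbpos : 0 < b := by positivity
  -- The choice of level, recomputed as if `i` did not survive at level `l`; this version is
  -- independent of the fate of `i`.
  let B : Seed P → Prop := fun s => (s.drop l i).InRange A j l
  have hB : ∀ s s' : Seed P, (∀ k, k ≠ i → s.keep l k = s'.keep l k) → s.hash = s'.hash →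
      s.sign = s'.sign → s.ζ = s'.ζ → (B s ↔ B s') := by
    intro s s' h1 h2 h3 h4
    have hk : (s.drop l i).keep l = (s'.drop l i).keep l := by
      funext k
      change dropKeep s.keep l i l k = dropKeep s'.keep l i l k
      unfold dropKeep
      by_cases hk : k = i
      · simp [hk]
      · simp [hk, h1 k hk]
    have := band_congr (A := A) hk h2 h3 h4 j
    simp only [B, Seed.InRange, this]
  have hm1 := H.measure_column_and_of_congr (i := i) (fun p => p l = true) B l z hB
  have hm2 := H.measure_column_and_of_congr (i := i) (fun p => p l' = true ∧ ¬ p l = true) B l z hB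
  simp only [hb1] at hm1
  set v := μ.real {ω | B ((seed ω).withScale z)} with hv
  set q := μ.real {ω | (seed ω).keep l' i = true ∧ ¬ (seed ω).keep l i = true} with hq
  have hv1 : v ≤ 1 := measureReal_le_one
  have hg1 := H.measure_not_good_le S i (fun p => p l = true) hz (by rw [hb1]; exact he)
  have hg2 := H.measure_not_good_le S i (fun p => p l' = true ∧ ¬ p l = true) hz
    (he.trans (mul_le_mul_of_nonneg_left hb2 hM.le))
  have hn := H.measure_and_someNoisy_le S.cR_eq S.n_pos S.tauSq_pos (fun κ => dropKeep κ l i)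
    (fun κ => κ l i = true ∧ GoodSample A z κ)
    (fun κ hκ => mass_le_tauSq S hκ.2 fun _ _ h => keep_of_dropKeep h)
  have hn' : μ.real {ω | (seed ω).keep l i = true ∧ GoodSample A z (seed ω).keep} ≤ b := by
    rw [← hb1]
    exact measureReal_mono (fun ω hω => hω.1) (measure_ne_top _ _)
  have hcol := H.measure_keep_and_collision_le S (i := i) hz hc hj hl
  rw [hb1] at hg1 hcol
  set X1 := μ.real {ω | (seed ω).keep l i = true ∧ ((seed ω).withScale z).InRange A j l ∧
        Good A ((seed ω).withScale z)} with hX1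
  set X2 := μ.real {ω | (seed ω).keep l' i = true ∧ ¬ ((seed ω).withScale z).InRange A j l ∧
        Good A ((seed ω).withScale z)} with hX2
  -- When `i` survives at `l`, the modified event implies the true one, apart from a bad seed, noise
  -- after the removal of `i`, or a collision with `i`.
  have h1 : b * v ≤ X1 + (4 / 100 * b + (1 / 100 * b + 1 / 100 * b)) := by
    rw [← hm1]
    have c1 := (measureReal_or_le _ _).trans
      (add_le_add (hn.trans (mul_le_mul_of_nonneg_left hn' (by norm_num))) hcol)
    have c2 := (measureReal_or_le _ _).trans (add_le_add hg1 c1)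
    have c3 := (measureReal_or_le (fun ω => (seed ω).keep l i = true ∧
      ((seed ω).withScale z).InRange A j l ∧ Good A ((seed ω).withScale z)) _).trans
      (add_le_add le_rfl c2)
    refine (measureReal_mono (fun ω hω => ?_) (measure_ne_top _ _)).trans c3
    simp only [Set.mem_ofPred_eq] at hω ⊢
    by_cases hg : Good A ((seed ω).withScale z)
    · by_cases hno : SomeNoisy A (tauSq P A) (seed ω) (dropKeep (seed ω).keep l i)
      · exact Or.inr (Or.inr (Or.inl ⟨⟨hω.1, hg.sample⟩, hno⟩))
      · by_cases hco : Collision ((seed ω).keep l) l (outer P A z j) i (seed ω)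
        · exact Or.inr (Or.inr (Or.inr ⟨⟨hω.1, hg.sample⟩, hco⟩))
        · exact Or.inl ⟨hω.1, Usable.inRange_of_drop S hg hu hc hj hl hno hco hω.2, hg⟩
    · exact Or.inr (Or.inl ⟨hω.1, hg⟩)
  -- When `i` does not survive at `l`, removing it changes nothing, so the modified and the true
  -- event coincide.
  have h2 : q ≤ X2 + 4 / 100 * q + q * v := by
    rw [← hm2]
    have c2 := (measureReal_or_le (fun ω => (seed ω).keep l' i = true ∧
      ¬ ((seed ω).withScale z).InRange A j l ∧ Good A ((seed ω).withScale z)) _).trans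
      (add_le_add le_rfl hg2)
    have c3 := (measureReal_or_le _ (fun ω => ((seed ω).keep l' i = true ∧
      ¬ (seed ω).keep l i = true) ∧ B ((seed ω).withScale z))).trans (add_le_add c2 le_rfl)
    refine (measureReal_mono (fun ω hω => ?_) (measure_ne_top _ _)).trans c3
    simp only [Set.mem_ofPred_eq] at hω ⊢
    by_cases hg : Good A ((seed ω).withScale z)
    · by_cases hB' : B ((seed ω).withScale z)
      · exact Or.inr ⟨hω, hB'⟩
      · refine Or.inl (Or.inl ⟨hω.1, ?_, hg⟩)
        have e : ((seed ω).withScale z).drop l i = (seed ω).withScale z := drop_of_not hω.2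
        simp only [B, e] at hB'
        exact hB'
    · exact Or.inl (Or.inr ⟨hω, hg⟩)
  -- The unknown `v` cancels: `b v + q (1 - v) ≥ b`, and the errors amount to at most `6/100 b +
  -- 4/100 q ≤ 14/100 b`.
  have h3 : b * (1 - v) ≤ q * (1 - v) := mul_le_mul_of_nonneg_right hb2 (by linarith)
  linarith

end Coupling

/-! ### The draw for a fixed scale -/

section FixedScale

variable {n : ℕ} {P : Params n} {A : Matrix (Fin n) (Fin n) ℝ} {Ω : Type*}
  [m0 : MeasurableSpace Ω] {μ : Measure Ω} [IsProbabilityMeasure μ] {seed : Ω → Seed P}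
  {draw : Ω → Option (Fin (P.L + 1) × Fin n)} (H : IsRun P A μ seed draw) (S : Setting P A)
  {i : Fin n} {z : ℝ}
include H S

lemma IsRun.le_measure_good (hz : z ∈ Set.Icc (1 / 2 : ℝ) 1) :
    96 / 100 ≤ μ.real {ω | Good A ((seed ω).withScale z)} := by
  have h1 : μ.real {ω : Ω | True} = 1 := probReal_univ
  have h2 := H.measure_not_good_le S ⟨0, S.n_pos⟩ (fun _ => True) hz (by
    rw [h1, mul_one]
    exact Finset.single_le_sum (f := fun i => energy (col A i)) (fun _ _ => energy_nonneg _)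
      (Finset.mem_univ _))
  have h3 := measureReal_or_le (μ := μ) (fun ω => True ∧ ¬ Good A ((seed ω).withScale z))
    fun ω => Good A ((seed ω).withScale z)
  have h4 : μ.real {ω | (True ∧ ¬ Good A ((seed ω).withScale z)) ∨
      Good A ((seed ω).withScale z)} = 1 := by
    rw [← h1]
    congr 1
    ext ω
    simp only [Set.mem_ofPred_eq]
    tauto
  linarith

lemma IsRun.le_integral_sum_accDraw (hz : z ∈ Set.Icc (1 / 2 : ℝ) 1)
    (h : totalEnergy A / 2 ≤ ∑ i ∈ goodCols P A z, energy (col A i)) :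
    95 / 100 ≤ ∫ ω, ∑ j, ∑ i, accDraw A P.ε ((seed ω).withScale z) j i ∂μ := by
  have h1 := H.mul_measure_le_integral z (F := fun s => ∑ j, ∑ i, accDraw A P.ε s j i)
    (fun s => Finset.sum_nonneg fun j _ => Finset.sum_nonneg fun i _ => accDraw_nonneg _ s j i)
    (c := 99 / 100) (by norm_num) (Q := fun s => s.ζ = z ∧ Good A s)
    (fun s hs => le_sum_accDraw S hs.2 (by rw [hs.1]; exact h))
  have h2 := H.le_measure_good S hz
  have h3 : {ω | Good A ((seed ω).withScale z)} =
      {ω | ((seed ω).withScale z).ζ = z ∧ Good A ((seed ω).withScale z)} := by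
    ext ω
    simp [Seed.withScale]
  rw [h3] at h2
  linarith

lemma IsRun.le_integral_accDraw_of_le (hz : z ∈ Set.Icc (1 / 2 : ℝ) 1) {j : Fin (P.L + 1)}
    (hj : (j : ℕ) ≤ P.j0) (hi : i ∈ inner P A z j) :
    energy (col A i) / (72 * totalEnergy A) ≤
      ∫ ω, accDraw A P.ε ((seed ω).withScale z) j i ∂μ := by
  have hM := S.M_pos
  have he := energy_nonneg (col A i)
  have h1 := H.mul_measure_le_integral z (F := fun s => accDraw A P.ε s j i)
    (fun s => accDraw_nonneg _ s j i) (c := energy (col A i) / (18 * totalEnergy A))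
    (by positivity) (Q := fun s => s.ζ = z ∧ Good A s) (fun s hs => by
      obtain ⟨rfl, hs⟩ := hs
      have hr := resolvable_zero S hs.scale (A := A) hj
      have := le_accDraw S hs (usedLevel_zero (s := s) (A := A) hj) hr
        (hs.mem_band S hr (surv_above_zero_lt S hs.scale hj _) (hs.sample.zero i) hi)
      simpa using this)
  have h2 := H.le_measure_good S hz
  have h3 : {ω | Good A ((seed ω).withScale z)} =
      {ω | ((seed ω).withScale z).ζ = z ∧ Good A ((seed ω).withScale z)} := by
    ext ω
    simp [Seed.withScale]
  rw [h3] at h2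
  refine le_trans ?_ h1
  calc energy (col A i) / (72 * totalEnergy A)
      = energy (col A i) / (18 * totalEnergy A) * (1 / 4) := by field_simp; ring
    _ ≤ _ := mul_le_mul_of_nonneg_left (by linarith) (by positivity)

/-- In both cases of the coupling the level used is at least `ℓ - 1`, so the draw has probability at
least `2^(ℓ-1) ‖f(A_i)‖² / (18 M)`. The cases are disjoint with joint probability at least `2^-ℓ /
2`, and the powers of two cancel to leave `1/72`. -/
lemma IsRun.le_integral_accDraw_of_lt (hz : z ∈ Set.Icc (1 / 2 : ℝ) 1) {j : Fin (P.L + 1)}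
    (hj : P.j0 < j) (hu : Usable P A z j) (hi : i ∈ inner P A z j) :
    energy (col A i) / (72 * totalEnergy A) ≤
      ∫ ω, accDraw A P.ε ((seed ω).withScale z) j i ∂μ := by
  have hM := S.M_pos
  have he := energy_nonneg (col A i)
  have hjL : (j : ℕ) ≤ P.L := by omega
  obtain ⟨ℓ, hc⟩ := hu.exists_isCritical S hz hj
  obtain ⟨l, hl⟩ : ∃ l : Fin (P.Lhat + 1), (l : ℕ) = ℓ := ⟨⟨ℓ, by have := hc.2.1; omega⟩, rfl⟩
  obtain ⟨l', hl'⟩ : ∃ l' : Fin (P.Lhat + 1), (l' : ℕ) + 1 = ℓ :=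
    ⟨⟨ℓ - 1, by have := hc.2.1; omega⟩, by have := hc.1; simp; omega⟩
  set c := 2 ^ (l' : ℕ) * energy (col A i) / (18 * totalEnergy A) with hcdef
  have h1 := H.mul_measure_le_integral z (F := fun s => accDraw A P.ε s j i)
    (fun s => accDraw_nonneg _ s j i) (c := c)
    (by positivity) (Q := fun s => s.ζ = z ∧ ((s.keep l i = true ∧ s.InRange A j l ∧ Good A s) ∨
      (s.keep l' i = true ∧ ¬ s.InRange A j l ∧ Good A s))) (fun s hs => by
      obtain ⟨rfl, ⟨hk, hr, hs⟩ | ⟨hk, hr, hs⟩⟩ := hs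
      · refine le_trans ?_ (le_accDraw S hs (hu.usedLevel_eq S hs hc hjL hj hl hr)
          (hu.resolvable S hs.scale hc (by omega))
          (hu.filter_inner_subset S hs hc hjL (by omega) (Finset.mem_filter.mpr ⟨hi, hk⟩)))
        rw [hcdef]
        gcongr
        · norm_num
        · omega
      · exact le_accDraw S hs (hu.usedLevel_eq_pred S hs hc hjL hj hl hl' hr)
          (hu.resolvable S hs.scale hc (by omega))
          (hu.filter_inner_subset S hs hc hjL (by omega) (Finset.mem_filter.mpr ⟨hi, hk⟩)))
  have h2 := H.le_measure_keep_usedLevel S hz hu hc hjL hi hl hl'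
  have hm : MeasurableSet {ω | (seed ω).keep l' i = true ∧
      ¬ ((seed ω).withScale z).InRange A j l ∧ Good A ((seed ω).withScale z)} :=
    H.measurableSet_withScale z fun s => s.keep l' i = true ∧ ¬ s.InRange A j l ∧ Good A s
  rw [← measureReal_union (Set.disjoint_left.mpr fun ω h h' => h'.2.1 h.2.1) hm] at h2
  have h3 : {ω | (seed ω).keep l i = true ∧ ((seed ω).withScale z).InRange A j l ∧
        Good A ((seed ω).withScale z)} ∪
      {ω | (seed ω).keep l' i = true ∧ ¬ ((seed ω).withScale z).InRange A j l ∧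
        Good A ((seed ω).withScale z)} = {ω | ((seed ω).withScale z).ζ = z ∧
      ((((seed ω).withScale z).keep l i = true ∧ ((seed ω).withScale z).InRange A j l ∧
        Good A ((seed ω).withScale z)) ∨ (((seed ω).withScale z).keep l' i = true ∧
        ¬ ((seed ω).withScale z).InRange A j l ∧ Good A ((seed ω).withScale z)))} := by
    ext ω
    simp [Seed.withScale]
  rw [h3] at h2
  refine le_trans ?_ h1
  refine le_trans (le_of_eq ?_) (mul_le_mul_of_nonneg_left h2 (by positivity))
  rw [hcdef, ← hl', pow_succ]
  field_simp
  ring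

lemma IsRun.le_integral_sum_accDraw_of_mem (hz : z ∈ Set.Icc (1 / 2 : ℝ) 1)
    (hi : i ∈ goodCols P A z) :
    energy (col A i) / (72 * totalEnergy A) ≤
      ∫ ω, ∑ j, accDraw A P.ε ((seed ω).withScale z) j i ∂μ := by
  classical
  simp only [goodCols, Finset.mem_filter, Finset.mem_univ, true_and] at hi
  obtain ⟨j, hj, hin, hu⟩ := hi
  have h1 : energy (col A i) / (72 * totalEnergy A) ≤
      ∫ ω, accDraw A P.ε ((seed ω).withScale z) (⟨j, by omega⟩ : Fin (P.L + 1)) i ∂μ := by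
    rcases Nat.lt_or_ge P.j0 j with h | h
    · exact H.le_integral_accDraw_of_lt S hz (j := ⟨j, by omega⟩) h hu hin
    · exact H.le_integral_accDraw_of_le S hz (j := ⟨j, by omega⟩) h hin
  refine h1.trans (integral_mono (H.integrable_withScale z fun s => accDraw A P.ε s _ i)
    (H.integrable_withScale z fun s => ∑ j, accDraw A P.ε s j i) fun ω => ?_)
  exact Finset.single_le_sum (f := fun j => accDraw A P.ε ((seed ω).withScale z) j i)
    (fun j _ => accDraw_nonneg _ _ j i) (Finset.mem_univ _)

end FixedScale

/-! ### The random scale -/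

/-- The uniform distribution on `[1/2, 1]`. -/
def scaleLaw : Measure ℝ := ProbabilityTheory.cond volume (Set.Icc (1 / 2 : ℝ) 1)

lemma scaleLaw_eq : scaleLaw = (2 : ENNReal) • volume.restrict (Set.Icc (1 / 2 : ℝ) 1) := by
  unfold scaleLaw ProbabilityTheory.cond
  rw [Real.volume_Icc, show (1 : ℝ) - 1 / 2 = 2⁻¹ by norm_num,
    ENNReal.ofReal_inv_of_pos (by norm_num), inv_inv]
  norm_num

instance : IsProbabilityMeasure scaleLaw :=
  ProbabilityTheory.cond_isProbabilityMeasure_of_finite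
    (by rw [Real.volume_Icc]; norm_num) measure_Icc_lt_top.ne

lemma scaleLaw_real (B : Set ℝ) :
    scaleLaw.real B = 2 * (volume.restrict (Set.Icc (1 / 2 : ℝ) 1)).real B := by
  rw [scaleLaw_eq, measureReal_ennreal_smul_apply]
  norm_num

lemma ae_scaleLaw : ∀ᵐ z ∂scaleLaw, z ∈ Set.Icc (1 / 2 : ℝ) 1 := by
  rw [scaleLaw_eq]
  exact Measure.ae_smul_measure (ae_restrict_mem measurableSet_Icc) _

lemma scaleLaw_real_mono {B C : Set ℝ} (h : ∀ z ∈ Set.Icc (1 / 2 : ℝ) 1, z ∈ B → z ∈ C) :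
    scaleLaw.real B ≤ scaleLaw.real C := by
  refine ENNReal.toReal_mono (measure_ne_top _ _) (measure_mono_ae ?_)
  filter_upwards [ae_scaleLaw] with z hz
  exact h z hz

lemma scaleLaw_real_Icc_le {p q : ℝ} (h : p ≤ q) : scaleLaw.real (Set.Icc p q) ≤ 2 * (q - p) := by
  rw [scaleLaw_real, measureReal_restrict_apply measurableSet_Icc]
  refine mul_le_mul_of_nonneg_left ((measureReal_mono Set.inter_subset_left
    measure_Icc_lt_top.ne).trans (le_of_eq ?_)) (by norm_num)
  rw [Real.volume_real_Icc_of_le h]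

/-- A bounded monotone function rarely increases by much over short intervals. -/
lemma scaleLaw_real_jump_le {φ : ℝ → ℝ} (hφ : Monotone φ) {p q h t : ℝ} (hp : ∀ z, p ≤ φ z)
    (hq : ∀ z, φ z ≤ q) (hh : 0 ≤ h) (ht : 0 < t) :
    scaleLaw.real {z | t ≤ φ (z + h) - φ (z - h)} ≤ 4 * h * (q - p) / t := by
  have hi : ∀ a b, IntervalIntegrable φ volume a b := fun a b => hφ.intervalIntegrable
  have h1 : IntervalIntegrable (fun z => φ (z + h)) volume (1 / 2) 1 :=
    Monotone.intervalIntegrable fun a b hab => hφ (by linarith)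
  have h2 : IntervalIntegrable (fun z => φ (z - h)) volume (1 / 2) 1 :=
    Monotone.intervalIntegrable fun a b hab => hφ (by linarith)
  have hint : ∫ z in (1 / 2 : ℝ)..1, (φ (z + h) - φ (z - h)) ≤ 2 * h * (q - p) := by
    -- Shifting variables, the two integrals cancel except for an interval of length `2h` at either
    -- end, where the bounds `p` and `q` apply.
    rw [intervalIntegral.integral_sub h1 h2, intervalIntegral.integral_comp_add_right,
      intervalIntegral.integral_comp_sub_right,
      intervalIntegral.integral_interval_sub_interval_comm' (hi _ _) (hi _ _) (hi _ _)]
    have e1 : ∫ z in (1 - h)..(1 + h), φ z ≤ ∫ z in (1 - h)..(1 + h), q :=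
      intervalIntegral.integral_mono_on (by linarith) (hi _ _) (by simp) fun z _ => hq z
    have e2 : ∫ z in (1 / 2 - h)..(1 / 2 + h), p ≤ ∫ z in (1 / 2 - h)..(1 / 2 + h), φ z :=
      intervalIntegral.integral_mono_on (by linarith) (by simp) (hi _ _) fun z _ => hp z
    rw [intervalIntegral.integral_const, smul_eq_mul] at e1 e2
    linarith
  rw [intervalIntegral.integral_of_le (by norm_num), ← integral_Icc_eq_integral_Ioc] at hint
  have hm := mul_meas_ge_le_integral_of_nonneg (μ := volume.restrict (Set.Icc (1 / 2 : ℝ) 1))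
    (f := fun z => φ (z + h) - φ (z - h))
    (ae_of_all _ fun z => sub_nonneg.mpr (hφ (by linarith)))
    (((intervalIntegrable_iff_integrableOn_Icc_of_le (by norm_num)).mp (h1.sub h2))) t
  rw [scaleLaw_real, le_div_iff₀ ht]
  linarith

/-- Apply the jump bound to `log (m + φ)`: a growth factor `1 + ε/4` is an additive jump of at least
`ε/5`. The offset `m > 0` keeps the range of the logarithm bounded. -/
lemma scaleLaw_real_ratio_le {φ : ℝ → ℝ} {m N ε h : ℝ} (hm : 0 < m) (hε : 0 < ε) (hε1 : ε ≤ 1)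
    (hh : 0 ≤ h) (h0 : ∀ z, 0 ≤ φ z) (hN : ∀ z, φ z ≤ N) (hφ : Monotone φ) :
    scaleLaw.real {z | (1 + ε / 4) * (m + φ (z - h)) ≤ m + φ (z + h)} ≤
      20 * h * Real.log ((m + N) / m) / ε := by
  have hN0 : 0 ≤ N := (h0 0).trans (hN 0)
  have hj := scaleLaw_real_jump_le (φ := fun z => Real.log (m + φ z)) (p := Real.log m)
    (q := Real.log (m + N)) (h := h) (t := ε / 5)
    (fun a b hab => Real.log_le_log (by linarith [h0 a]) (by linarith [hφ hab]))
    (fun z => Real.log_le_log hm (by linarith [h0 z]))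
    (fun z => Real.log_le_log (by linarith [h0 z]) (by linarith [hN z])) hh (by positivity)
  rw [← Real.log_div (by positivity) hm.ne'] at hj
  refine (measureReal_mono (fun z hz => ?_) (measure_ne_top _ _)).trans
    (hj.trans (le_of_eq (by field_simp; ring)))
  have p1 : 0 < m + φ (z - h) := by linarith [h0 (z - h)]
  have hl : Real.log (1 + ε / 4) + Real.log (m + φ (z - h)) ≤ Real.log (m + φ (z + h)) := by
    rw [← Real.log_mul (by positivity) p1.ne']
    exact Real.log_le_log (by positivity) hz
  have hb := Real.one_sub_inv_le_log_of_pos (x := 1 + ε / 4) (by positivity)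
  have hb2 : ε / 5 ≤ 1 - (1 + ε / 4)⁻¹ := by
    rw [le_sub_iff_add_le, ← le_sub_iff_add_le', inv_le_comm₀ (by positivity) (by linarith),
      inv_le_iff_one_le_mul₀ (by linarith)]
    nlinarith
  change ε / 5 ≤ Real.log (m + φ (z + h)) - Real.log (m + φ (z - h))
  linarith

lemma scaleLaw_real_ratio_le_of_antitone {φ : ℝ → ℝ} {m N ε h : ℝ} (hm : 0 < m) (hε : 0 < ε)
    (hε1 : ε ≤ 1) (hh : 0 ≤ h) (h0 : ∀ z, 0 ≤ φ z) (hN : ∀ z, φ z ≤ N) (hφ : Antitone φ) :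
    scaleLaw.real {z | (1 + ε / 4) * (m + φ (z + h)) ≤ m + φ (z - h)} ≤
      20 * h * Real.log ((m + N) / m) / ε := by
  have hN0 : 0 ≤ N := (h0 0).trans (hN 0)
  have hj := scaleLaw_real_jump_le (φ := fun z => - Real.log (m + φ z)) (p := - Real.log (m + N))
    (q := - Real.log m) (h := h) (t := ε / 5)
    (fun a b hab => neg_le_neg (Real.log_le_log (by linarith [h0 b]) (by linarith [hφ hab])))
    (fun z => neg_le_neg (Real.log_le_log (by linarith [h0 z]) (by linarith [hN z])))
    (fun z => neg_le_neg (Real.log_le_log hm (by linarith [h0 z]))) hh (by positivity)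
  rw [show - Real.log m - -Real.log (m + N) = Real.log (m + N) - Real.log m by ring,
    ← Real.log_div (by positivity) hm.ne'] at hj
  refine (measureReal_mono (fun z hz => ?_) (measure_ne_top _ _)).trans
    (hj.trans (le_of_eq (by field_simp; ring)))
  have p1 : 0 < m + φ (z + h) := by linarith [h0 (z + h)]
  have hl : Real.log (1 + ε / 4) + Real.log (m + φ (z + h)) ≤ Real.log (m + φ (z - h)) := by
    rw [← Real.log_mul (by positivity) p1.ne']
    exact Real.log_le_log (by positivity) hz
  have hb := Real.one_sub_inv_le_log_of_pos (x := 1 + ε / 4) (by positivity)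
  have hb2 : ε / 5 ≤ 1 - (1 + ε / 4)⁻¹ := by
    rw [le_sub_iff_add_le, ← le_sub_iff_add_le', inv_le_comm₀ (by positivity) (by linarith),
      inv_le_iff_one_le_mul₀ (by linarith)]
    nlinarith
  change ε / 5 ≤ - Real.log (m + φ (z + h)) - - Real.log (m + φ (z - h))
  linarith

/-! ### Columns close to the ends of magnitude levels -/

section Irregular

variable {n : ℕ} {P : Params n} {A : Matrix (Fin n) (Fin n) ℝ} (S : Setting P A)

/-- Column `i` is close to the boundary of magnitude level `j`, or many columns are. -/
def Irregular (P : Params n) (A : Matrix (Fin n) (Fin n) ℝ) (i : Fin n) (j : ℕ) (z : ℝ) : Prop :=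
  mag P z j ≤ energy (col A i) ∧ energy (col A i) ≤ 2 * mag P z j ∧
    (i ∈ inner P A z j → P.ε / (2 * P.L) * totalEnergy A ≤ ∑ k ∈ outer P A z j, energy (col A k) ∧
      ((inner P A z j).card : ℝ) < (1 - P.ε) * (outer P A z j).card)

include S

lemma card_energy_ge_mul_le (x : ℝ) :
    ((Finset.univ.filter fun k => x ≤ energy (col A k)).card : ℝ) * x ≤ totalEnergy A := by
  have h1 := Finset.card_nsmul_le_sum (Finset.univ.filter fun k => x ≤ energy (col A k))
    (fun k => energy (col A k)) x fun k hk => (Finset.mem_filter.mp hk).2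
  have h2 : ∑ k with x ≤ energy (col A k), energy (col A k) ≤ totalEnergy A :=
    Finset.sum_le_sum_of_subset_of_nonneg (Finset.subset_univ _) fun _ _ _ => energy_nonneg _
  rw [nsmul_eq_mul] at h1
  linarith

/-- The offset is an `ε / (4L)` fraction of the natural unit, so the range of the logarithm is `log
(1/ε)` plus a logarithm of order `log L`, and `log (1/ε) ≤ L`. -/
lemma log_ratio_le {y : ℝ} (hy : 0 < y) {c : ℝ} (hc : 0 < c) (hc2 : c ≤ 2) :
    Real.log ((P.ε / (4 * P.L) * y + c * y) / (P.ε / (4 * P.L) * y)) ≤ 10 * P.L := by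
  have hε := S.ε_pos
  have hε1 := S.ε_lt_one
  have hL := S.L_ge
  have hL0 := S.L_pos
  have e : (P.ε / (4 * P.L) * y + c * y) / (P.ε / (4 * P.L) * y) =
      (P.ε + 4 * c * P.L) * (1 / P.ε) := by
    field_simp
  rw [e, Real.log_mul (by positivity) (by positivity)]
  have h1 := S.log_inv_ε_le
  have h2 : Real.log (P.ε + 4 * c * P.L) ≤ Real.log (9 * P.L) :=
    Real.log_le_log (by positivity) (by nlinarith)
  have h3 := Real.log_le_sub_one_of_pos (x := 9 * (P.L : ℝ)) (by positivity)
  linarith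

/-- This fixes the size of `slack`: the factor `1/L` cancels the logarithmic range `10 L`, and `ε`
cancels the size of the jump. -/
lemma slack_ratio_le : 20 * P.slack * (10 * P.L) / P.ε ≤ 2 / 1000 := by
  have hε := S.ε_pos
  have hL := S.L_pos
  unfold Params.slack
  apply le_of_eq
  field_simp
  norm_num

variable {i : Fin n} {j : ℕ} {z : ℝ}

/-- A column at the lower or the upper end of a magnitude level. -/
lemma scaleLaw_real_margin_le {x b : ℝ} (hx : 0 < x) (hb : 0 < b) (hxb : x ≤ 2 * b) :
    scaleLaw.real {z | (z * b ≤ x ∧ x < (1 + P.ε + P.slack) * (z * b)) ∨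
      (x ≤ 2 * (z * b) ∧ (2 - P.ε - P.slack) * (z * b) < x)} ≤ 1 / 1000 := by
  have hε := S.ε_pos
  have hε1 := S.ε_le
  have hsl := S.slack_pos
  have hsl1 := S.slack_le
  set e := P.ε + P.slack with he
  have he1 : e ≤ 2 / 10 ^ 6 := by linarith
  have he0 : 0 < e := by linarith
  have hy : x / b ≤ 2 := by rw [div_le_iff₀ hb]; exact hxb
  have hy0 : 0 < x / b := by positivity
  have h2e : 0 < 2 - e := by linarith
  have h1 : scaleLaw.real (Set.Icc (x / b / (1 + e)) (x / b)) ≤ 1 / 10000 := by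
    have hle : x / b / (1 + e) ≤ x / b := div_le_self hy0.le (by linarith)
    refine (scaleLaw_real_Icc_le hle).trans ?_
    have : x / b - x / b / (1 + e) = x / b * (e / (1 + e)) := by field_simp; ring
    rw [this]
    have h3 : e / (1 + e) ≤ e := div_le_self he0.le (by linarith)
    have h4 : x / b * (e / (1 + e)) ≤ 2 * e := mul_le_mul hy h3 (by positivity) (by norm_num)
    linarith
  have h2 : scaleLaw.real (Set.Icc (x / b / 2) (x / b / (2 - e))) ≤ 1 / 10000 := by
    have hle : x / b / 2 ≤ x / b / (2 - e) :=
      div_le_div_of_nonneg_left hy0.le h2e (by linarith)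
    refine (scaleLaw_real_Icc_le hle).trans ?_
    have : x / b / (2 - e) - x / b / 2 = x / b * (e / (2 * (2 - e))) := by field_simp; ring
    rw [this]
    have h3 : e / (2 * (2 - e)) ≤ e := div_le_self he0.le (by linarith)
    have h4 : x / b * (e / (2 * (2 - e))) ≤ 2 * e := mul_le_mul hy h3 (by positivity) (by norm_num)
    linarith
  refine (measureReal_mono (fun z hz => ?_) (measure_ne_top _ _)).trans
    ((measureReal_union_le (Set.Icc (x / b / (1 + e)) (x / b))
      (Set.Icc (x / b / 2) (x / b / (2 - e)))).trans (by linarith))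
  rcases hz with ⟨h, h'⟩ | ⟨h, h'⟩
  · left
    constructor
    · rw [div_div, div_le_iff₀ (by positivity)]
      nlinarith
    · rw [le_div_iff₀ hb]
      exact h
  · right
    constructor
    · rw [div_div, div_le_iff₀ (by positivity)]
      linarith
    · rw [div_div, le_div_iff₀ (by positivity)]
      nlinarith

/-- Since `m + g ≤ 2 o`, an increment above `ε o / 2` is a relative growth by at least `ε/4`. -/
lemma ratio_of_card_lt {m g g' u o : ℝ} (hm : m ≤ o) (hg : g ≤ o) (hu : P.ε / 2 * o < u)
    (h : g + u ≤ g') : (1 + P.ε / 4) * (m + g) ≤ m + g' := by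
  have hε := S.ε_pos
  nlinarith

/-- The columns between two bounds that depend on the scale. -/
def between (A : Matrix (Fin n) (Fin n) ℝ) (p q : ℝ) : Finset (Fin n) :=
  {k | p ≤ energy (col A k) ∧ energy (col A k) ≤ q}

omit S in
lemma between_subset {p q p' q' : ℝ} (hp : p' ≤ p) (hq : q ≤ q') :
    between A p q ⊆ between A p' q' := by
  intro k hk
  simp only [between, Finset.mem_filter, Finset.mem_univ, true_and] at hk ⊢
  exact ⟨hp.trans hk.1, hk.2.trans hq⟩

lemma card_between_le {x c : ℝ} (hx : 0 < x) (hc : 0 < c) (q : ℝ) :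
    ((between A (x / c) q).card : ℝ) ≤ c * (totalEnergy A / x) := by
  have h1 := card_energy_ge_mul_le S (x / c)
  have h2 : ((between A (x / c) q).card : ℝ) ≤
      (Finset.univ.filter fun k => x / c ≤ energy (col A k)).card := by
    exact_mod_cast Finset.card_le_card fun k hk => by
      simp only [between, Finset.mem_filter, Finset.mem_univ, true_and] at hk ⊢
      exact hk.1
  rw [← mul_div_assoc, le_div_iff₀ hx]
  have h3 := mul_le_mul_of_nonneg_right h2 (by positivity : 0 ≤ x / c)
  have h4 : ((between A (x / c) q).card : ℝ) * x =
      c * ((between A (x / c) q).card * (x / c)) := by field_simp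
  rw [h4]
  exact mul_le_mul_of_nonneg_left (h3.trans h1) hc.le

/-- The lower bound is anchored at the fixed energy `x` instead of at the lower end of the level, so
the count depends on the scale through one end only and is monotone in it. -/
lemma scaleLaw_real_upper_le {x b : ℝ} (hx : 0 < x) (hb : 0 < b) :
    scaleLaw.real {z | (1 + P.ε / 4) * (P.ε / (4 * P.L) * (totalEnergy A / x) +
      (between A (x / 1) ((2 - P.ε) * ((z - P.slack) * b))).card) ≤
      P.ε / (4 * P.L) * (totalEnergy A / x) +
      (between A (x / 1) ((2 - P.ε) * ((z + P.slack) * b))).card} ≤ 2 / 1000 := by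
  have hε := S.ε_pos
  have hε1 := S.ε_lt_one
  have hL := S.L_pos
  have hM := S.M_pos
  have hsl := S.slack_pos
  refine (scaleLaw_real_ratio_le (φ := fun z =>
    ((between A (x / 1) ((2 - P.ε) * (z * b))).card : ℝ)) (N := 1 * (totalEnergy A / x))
    (by positivity) hε hε1.le hsl.le (fun z => by positivity)
    (fun z => card_between_le S hx one_pos _) (fun z z' h => ?_)).trans ?_
  · have : (2 - P.ε) * (z * b) ≤ (2 - P.ε) * (z' * b) := by
      have : 0 ≤ 2 - P.ε := by linarith
      gcongr
    exact Nat.cast_le.mpr (Finset.card_le_card (between_subset le_rfl this))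
  · refine le_trans ?_ (slack_ratio_le S)
    gcongr
    exact log_ratio_le S (by positivity) one_pos (by norm_num)

/-- Here the upper bound is anchored at `x`. The cut at `x / 2` bounds the count for all `z`, and it
loses no column of a level that has `x ≤ 2 mag`. -/
lemma scaleLaw_real_lower_le {x b : ℝ} (hx : 0 < x) (hb : 0 < b) :
    scaleLaw.real {z | (1 + P.ε / 4) * (P.ε / (4 * P.L) * (totalEnergy A / x) +
      (between A (max (x / 2) ((1 + P.ε) * ((z + P.slack) * b))) x).card) ≤
      P.ε / (4 * P.L) * (totalEnergy A / x) +
      (between A (max (x / 2) ((1 + P.ε) * ((z - P.slack) * b))) x).card} ≤ 2 / 1000 := by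
  have hε := S.ε_pos
  have hε1 := S.ε_lt_one
  have hL := S.L_pos
  have hM := S.M_pos
  have hsl := S.slack_pos
  refine (scaleLaw_real_ratio_le_of_antitone (φ := fun z =>
    ((between A (max (x / 2) ((1 + P.ε) * (z * b))) x).card : ℝ)) (N := 2 * (totalEnergy A / x))
    (by positivity) hε hε1.le hsl.le (fun z => by positivity)
    (fun z => ?_) (fun z z' h => ?_)).trans ?_
  · refine le_trans ?_ (card_between_le S hx two_pos x)
    exact Nat.cast_le.mpr (Finset.card_le_card (between_subset (le_max_left _ _) le_rfl))
  · have : (1 + P.ε) * (z * b) ≤ (1 + P.ε) * (z' * b) := by gcongr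
    exact Nat.cast_le.mpr (Finset.card_le_card (between_subset (max_le_max le_rfl this) le_rfl))
  · refine le_trans ?_ (slack_ratio_le S)
    gcongr
    exact log_ratio_le S (by positivity) two_pos le_rfl

/-- Suppose `i` is in `inner` but too many columns are not. Then more than `ε/2` of `outer` lies in
one of the two margins. Energies in the lower margin are below `x` and those in the upper margin
above it, so either margin is part of the jump of a count anchored at `x` when the scale moves by
`slack`. The level's energy makes `outer` at least as large as the offset. -/
lemma scaleLaw_real_irregular_le (hx : 0 < energy (col A i))
    (hj : energy (col A i) ≤ 2 * (P.Mhat / 2 ^ j)) :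
    scaleLaw.real {z | Irregular P A i j z} ≤ 5 / 1000 := by
  classical
  have hε := S.ε_pos
  have hε1 := S.ε_le
  have hL := S.L_pos
  have hM := S.M_pos
  have hsl := S.slack_pos
  have hsl1 := S.slack_le
  set x := energy (col A i) with hxdef
  set b := P.Mhat / 2 ^ j with hbdef
  have hb : 0 < b := by have := S.Mhat_pos; positivity
  have h1 := scaleLaw_real_margin_le S hx hb hj
  have h2 := scaleLaw_real_upper_le S (A := A) hx hb
  have h3 := scaleLaw_real_lower_le S (A := A) hx hb
  have hb2 := (measureReal_union_le (μ := scaleLaw) _ _).trans (add_le_add h2 h3)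
  have hb1 := (measureReal_union_le (μ := scaleLaw) _ _).trans (add_le_add h1 hb2)
  refine (scaleLaw_real_mono fun z hz hirr => ?_).trans (hb1.trans (by norm_num))
  obtain ⟨hlo, hhi, hin⟩ := hirr
  have hmag : mag P z j = z * b := by rw [mag, hbdef, mul_div_assoc]
  rw [hmag, ← hxdef] at hlo hhi
  have ha : 0 < z * b := mul_pos (by linarith [hz.1]) hb
  simp only [Set.mem_union, Set.mem_ofPred_eq]
  by_cases hmem : i ∈ inner P A z j
  swap
  · left
    simp only [inner, Finset.mem_filter, Finset.mem_univ, true_and, hmag, ← hxdef] at hmem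
    by_contra! hcon
    exact hmem ⟨hcon.1 hlo, hcon.2 hhi⟩
  right
  obtain ⟨hsum, hcard⟩ := hin hmem
  simp only [inner, Finset.mem_filter, Finset.mem_univ, true_and, hmag, ← hxdef] at hmem
  set o : ℝ := ((outer P A z j).card : ℝ) with ho
  have hm : P.ε / (4 * P.L) * (totalEnergy A / x) ≤ o := by
    have h4 := hsum.trans (sum_outer_le_card S hz j)
    rw [hmag] at h4
    have h5 : o * (z * b) ≤ o * x := by gcongr
    rw [← mul_div_assoc, div_le_iff₀ hx]
    have h6 : P.ε / (2 * P.L) * totalEnergy A = 2 * (P.ε / (4 * P.L) * totalEnergy A) := by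
      field_simp
      norm_num
    linarith
  set low := (outer P A z j).filter fun k => energy (col A k) < (1 + P.ε + P.slack) * (z * b)
    with hlow
  set up := (outer P A z j).filter fun k => (2 - P.ε - P.slack) * (z * b) < energy (col A k)
    with hup
  have hsplit : o ≤ (inner P A z j).card + low.card + up.card := by
    have hsub : outer P A z j ⊆ inner P A z j ∪ low ∪ up := by
      intro k hk
      simp only [Finset.mem_union, hlow, hup, Finset.mem_filter, hk, true_and]
      simp only [inner, Finset.mem_filter, Finset.mem_univ, true_and, hmag]
      by_contra! hcon
      exact absurd (hcon.1.1 hcon.1.2) (not_lt.mpr hcon.2)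
    have h7 := (Finset.card_le_card hsub).trans ((Finset.card_union_le _ _).trans
      (Nat.add_le_add_right (Finset.card_union_le _ _) _))
    rw [ho]
    exact_mod_cast h7
  -- Because `z ≤ 1`, margins of width `slack * (z * b)` are covered by shifting the scale by
  -- `slack`.
  have p1 : 0 ≤ P.slack * b * (1 - z) := mul_nonneg (by positivity) (by linarith [hz.2])
  have p2 : 0 ≤ P.slack * (z * b) := by positivity
  have p3 : 0 ≤ P.ε * (P.slack * b) := by positivity
  have p4 : P.ε * (P.slack * b) ≤ P.slack * b := mul_le_of_le_one_left (by positivity) (by linarith)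
  have p5 : P.slack * (z * b) ≤ P.ε * (z * b) :=
    mul_le_mul_of_nonneg_right (by linarith) ha.le
  rcases lt_or_ge (P.ε / 2 * o) low.card with hl | hl
  · right
    refine ratio_of_card_lt S hm ?_ hl ?_
    · refine Nat.cast_le.mpr (Finset.card_le_card fun k hk => ?_)
      simp only [between, outer, Finset.mem_filter, Finset.mem_univ, true_and, hmag, max_le_iff]
        at hk ⊢
      constructor <;> linarith [hk.1.1, hk.1.2, hk.2, hmem.1, hmem.2]
    · rw [← Nat.cast_add, ← Finset.card_union_of_disjoint]
      · refine Nat.cast_le.mpr (Finset.card_le_card fun k hk => ?_)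
        simp only [between, hlow, outer, Finset.mem_union, Finset.mem_filter,
          Finset.mem_univ, true_and, max_le_iff, hmag] at hk ⊢
        rcases hk with hk | hk
        · refine ⟨⟨hk.1.1, ?_⟩, hk.2⟩
          linarith [hk.1.2]
        · refine ⟨⟨?_, ?_⟩, ?_⟩ <;> linarith [hk.1.1, hk.1.2, hk.2, hmem.1, hmem.2]
      · rw [Finset.disjoint_left]
        intro k hk hk'
        simp only [between, hlow, Finset.mem_filter, Finset.mem_univ, true_and,
          max_le_iff] at hk hk'
        linarith [hk.1.2, hk'.2]
  · left
    have hu : P.ε / 2 * o < up.card := by linarith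
    refine ratio_of_card_lt S hm ?_ hu ?_
    · refine Nat.cast_le.mpr (Finset.card_le_card fun k hk => ?_)
      simp only [between, outer, Finset.mem_filter, Finset.mem_univ, true_and, hmag, div_one]
        at hk ⊢
      constructor <;> linarith [hk.1, hk.2, hmem.1, hmem.2]
    · rw [← Nat.cast_add, ← Finset.card_union_of_disjoint]
      · refine Nat.cast_le.mpr (Finset.card_le_card fun k hk => ?_)
        simp only [between, hup, outer, Finset.mem_union, Finset.mem_filter,
          Finset.mem_univ, true_and, hmag, div_one] at hk ⊢
        rcases hk with hk | hk
        · exact ⟨hk.1, by linarith [hk.2]⟩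
        · constructor <;> linarith [hk.1.1, hk.1.2, hk.2, hmem.1, hmem.2]
      · rw [Finset.disjoint_left]
        intro k hk hk'
        simp only [between, hup, Finset.mem_filter, Finset.mem_univ, true_and] at hk hk'
        linarith [hk.2, hk'.2]

/-- As the scale runs through `[1/2, 1]`, only three consecutive levels can satisfy `mag ≤ x ≤ 2
mag`. -/
lemma scaleLaw_real_exists_irregular_le (hx : 0 < energy (col A i)) :
    scaleLaw.real {z | ∃ j, Irregular P A i j z} ≤ 15 / 1000 := by
  classical
  have hMh := S.Mhat_pos
  set x := energy (col A i) with hxdef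
  have hex : ∃ j : ℕ, P.Mhat / 2 ^ j ≤ 2 * x := by
    obtain ⟨j, hj⟩ := pow_unbounded_of_one_lt (P.Mhat / (2 * x)) (one_lt_two (α := ℝ))
    refine ⟨j, ?_⟩
    rw [div_le_iff₀ (by positivity)]
    rw [div_lt_iff₀ (by positivity)] at hj
    linarith
  set m := Nat.find hex with hm
  have hm1 : ∀ j, P.Mhat / 2 ^ j ≤ 2 * x → m ≤ j := fun j hj => Nat.find_min' hex hj
  have hm2 : P.Mhat / 2 ^ m ≤ 2 * x := Nat.find_spec hex
  have key : ∀ z ∈ Set.Icc (1 / 2 : ℝ) 1, ∀ j, Irregular P A i j z →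
      x ≤ 2 * (P.Mhat / 2 ^ j) ∧ (j = m ∨ j = m + 1 ∨ j = m + 2) := by
    intro z hz j hirr
    obtain ⟨h1, h2, -⟩ := hirr
    rw [← hxdef] at h1 h2
    have hmag : mag P z j = z * (P.Mhat / 2 ^ j) := by rw [mag, mul_div_assoc]
    rw [hmag] at h1 h2
    have hb : 0 < P.Mhat / 2 ^ j := by positivity
    have h3 : x ≤ 2 * (P.Mhat / 2 ^ j) := by nlinarith [hz.2]
    refine ⟨h3, ?_⟩
    have h4 := hm1 j (by nlinarith [hz.1])
    by_contra hcon
    have h5 : m + 3 ≤ j := by omega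
    have h6 : (2 : ℝ) ^ (m + 3) ≤ 2 ^ j := pow_le_pow_right₀ (by norm_num) h5
    have h7 : P.Mhat / 2 ^ j ≤ P.Mhat / 2 ^ (m + 3) := by gcongr
    have h8 : P.Mhat / 2 ^ (m + 3) = P.Mhat / 2 ^ m / 8 := by
      rw [pow_add, div_div]
      norm_num
    linarith
  have h1 : ∀ j, scaleLaw.real {z | x ≤ 2 * (P.Mhat / 2 ^ j) ∧ Irregular P A i j z} ≤
      5 / 1000 := by
    intro j
    by_cases hj : x ≤ 2 * (P.Mhat / 2 ^ j)
    · simp only [hj, true_and]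
      exact scaleLaw_real_irregular_le S hx hj
    · simp only [hj, false_and]
      rw [show {z : ℝ | False} = ∅ from rfl, measureReal_empty]
      norm_num
  have hb2 := (measureReal_union_le (μ := scaleLaw) _ _).trans (add_le_add (h1 (m + 1)) (h1 (m + 2)))
  have hb1 := (measureReal_union_le (μ := scaleLaw) _ _).trans (add_le_add (h1 m) hb2)
  refine (scaleLaw_real_mono fun z hz hirr => ?_).trans (hb1.trans (by norm_num))
  obtain ⟨j, hj⟩ := hirr
  obtain ⟨h3, rfl | rfl | rfl⟩ := key z hz j hj
  · exact Or.inl ⟨h3, hj⟩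
  · exact Or.inr (Or.inl ⟨h3, hj⟩)
  · exact Or.inr (Or.inr ⟨h3, hj⟩)

end Irregular

/-! ### Most of the energy lies in good columns for most scales -/

section GoodColumns

variable {n : ℕ} {P : Params n} {A : Matrix (Fin n) (Fin n) ℝ} {i : Fin n} {z : ℝ}

lemma measurable_mag (j : ℕ) : Measurable fun z => mag P z j := by
  unfold mag
  fun_prop

lemma measurableSet_finset_eq {α β : Type*} [MeasurableSpace α] [Fintype β] {G : α → Finset β}
    (h : ∀ k, MeasurableSet {z | k ∈ G z}) (F : Finset β) : MeasurableSet {z | G z = F} := by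
  have e : {z | G z = F} = ⋂ k, {z | k ∈ G z ↔ k ∈ F} := by
    ext z
    simp [Finset.ext_iff]
  rw [e]
  refine MeasurableSet.iInter fun k => ?_
  by_cases hk : k ∈ F
  · simpa [hk] using h k
  · simp only [hk, iff_false]
    exact (h k).compl

/-- The columns of the magnitude levels, as a function of the scale. -/
def levelSets (P : Params n) (A : Matrix (Fin n) (Fin n) ℝ) (z : ℝ) :
    Fin (P.L + 1) → Finset (Fin n) × Finset (Fin n) := fun j => (outer P A z j, inner P A z j)

lemma measurableSet_levelSets (v) : MeasurableSet {z | levelSets P A z = v} := by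
  have e : {z | levelSets P A z = v} =
      ⋂ j : Fin (P.L + 1), ({z | outer P A z j = (v j).1} ∩ {z | inner P A z j = (v j).2}) := by
    ext z
    simp only [levelSets, funext_iff, Prod.ext_iff, Set.mem_ofPred_eq, Set.mem_iInter,
      Set.mem_inter_iff]
  rw [e]
  refine MeasurableSet.iInter fun j => (measurableSet_finset_eq (fun k => ?_) _).inter
    (measurableSet_finset_eq (fun k => ?_) _)
  · simp only [outer, Finset.mem_filter, Finset.mem_univ, true_and]
    exact (measurableSet_le ((measurable_mag _).const_mul _) measurable_const).inter
      (measurableSet_le measurable_const ((measurable_mag _).const_mul _))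
  · simp only [inner, Finset.mem_filter, Finset.mem_univ, true_and]
    exact (measurableSet_le ((measurable_mag _).const_mul _) measurable_const).inter
      (measurableSet_le measurable_const ((measurable_mag _).const_mul _))

/-- Column `i` belongs to a magnitude level of little energy. -/
def Unimportant (P : Params n) (A : Matrix (Fin n) (Fin n) ℝ) (i : Fin n) (z : ℝ) : Prop :=
  ∃ j : Fin (P.L + 1), i ∈ outer P A z j ∧
    ∑ k ∈ outer P A z j, energy (col A k) < P.ε / (2 * P.L) * totalEnergy A

lemma measurableSet_unimportant (i : Fin n) : MeasurableSet {z | Unimportant P A i z} :=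
  measurableSet_of_finite (X := levelSets P A) measurableSet_levelSets fun v =>
    ∃ j : Fin (P.L + 1), i ∈ (v j).1 ∧
      ∑ k ∈ (v j).1, energy (col A k) < P.ε / (2 * P.L) * totalEnergy A

lemma mem_goodCols : i ∈ goodCols P A z ↔ ∃ j : Fin (P.L + 1), i ∈ inner P A z j ∧
    Usable P A z j := by
  simp only [goodCols, Finset.mem_filter, Finset.mem_univ, true_and]
  exact ⟨fun ⟨j, h1, h2⟩ => ⟨⟨j, by omega⟩, h2⟩, fun ⟨j, h⟩ => ⟨j, by omega, h⟩⟩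

lemma measurableSet_mem_goodCols (i : Fin n) : MeasurableSet {z | i ∈ goodCols P A z} := by
  have h := measurableSet_of_finite (X := levelSets P A) measurableSet_levelSets fun v =>
    ∃ j : Fin (P.L + 1), i ∈ (v j).2 ∧
      P.ε / (2 * P.L) * totalEnergy A ≤ ∑ k ∈ (v j).1, energy (col A k) ∧
      (1 - P.ε) * (v j).1.card ≤ (v j).2.card
  convert h using 1
  ext z
  simp only [Set.mem_ofPred_eq, mem_goodCols, levelSets]
  exact exists_congr fun j => and_congr_right fun _ =>
    ⟨fun h => ⟨h.le_sum, h.le_card⟩, fun h => ⟨h.1, h.2⟩⟩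

lemma integral_sum_indicator {α : Type*} [MeasurableSpace α] {ν : Measure α} [IsProbabilityMeasure ν]
    {B : Fin n → Set α} (hB : ∀ i, MeasurableSet (B i)) (e : Fin n → ℝ) :
    Integrable (fun z => ∑ i, (B i).indicator (fun _ => e i) z) ν ∧
    ∫ z, ∑ i, (B i).indicator (fun _ => e i) z ∂ν = ∑ i, e i * ν.real (B i) := by
  have h : ∀ i, Integrable ((B i).indicator fun _ => e i) ν :=
    fun i => (integrable_const _).indicator (hB i)
  refine ⟨integrable_finsetSum _ fun i _ => h i, ?_⟩
  rw [integral_finsetSum _ fun i _ => h i]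
  refine Finset.sum_congr rfl fun i _ => ?_
  rw [integral_indicator (hB i), setIntegral_const, smul_eq_mul, mul_comm]

variable (S : Setting P A)
include S

/-- There are only `L + 1` magnitude levels, each of energy below `ε M / (2L)`. -/
lemma sum_unimportant_le (hz : z ∈ Set.Icc (1 / 2 : ℝ) 1) :
    ∑ i, {z | Unimportant P A i z}.indicator (fun _ => energy (col A i)) z ≤
      6 / 10 * P.ε * totalEnergy A := by
  classical
  have hε := S.ε_pos
  have hL := S.L_ge
  have hL0 := S.L_pos
  have hM := S.M_pos
  simp only [Set.indicator_apply, Set.mem_ofPred_eq]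
  rw [← Finset.sum_filter]
  have hsub : (Finset.univ.filter fun i => Unimportant P A i z) ⊆
      (Finset.univ.filter fun j : Fin (P.L + 1) => ∑ k ∈ outer P A z j,
        energy (col A k) < P.ε / (2 * P.L) * totalEnergy A).biUnion fun j => outer P A z j := by
    intro i hi
    obtain ⟨j, hj1, hj2⟩ := (Finset.mem_filter.mp hi).2
    exact Finset.mem_biUnion.mpr ⟨j, Finset.mem_filter.mpr ⟨Finset.mem_univ _, hj2⟩, hj1⟩
  refine (Finset.sum_le_sum_of_subset_of_nonneg hsub fun _ _ _ => energy_nonneg _).trans ?_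
  rw [Finset.sum_biUnion fun j _ j' _ h => disjoint_outer S hz fun he => h (Fin.ext he)]
  refine (Finset.sum_le_card_nsmul _ _ (P.ε / (2 * P.L) * totalEnergy A) fun j hj =>
    (Finset.mem_filter.mp hj).2.le).trans ?_
  rw [nsmul_eq_mul]
  have hc : ((Finset.univ.filter fun j : Fin (P.L + 1) => ∑ k ∈ outer P A z j,
        energy (col A k) < P.ε / (2 * P.L) * totalEnergy A).card : ℝ) ≤ P.L + 1 := by
    have := Finset.card_filter_le Finset.univ fun j : Fin (P.L + 1) =>
      ∑ k ∈ outer P A z j, energy (col A k) < P.ε / (2 * P.L) * totalEnergy A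
    rw [Finset.card_univ, Fintype.card_fin] at this
    exact_mod_cast this
  refine (mul_le_mul_of_nonneg_right hc (by positivity)).trans ?_
  calc ((P.L : ℝ) + 1) * (P.ε / (2 * P.L) * totalEnergy A)
      ≤ (12 / 10 * P.L) * (P.ε / (2 * P.L) * totalEnergy A) := by gcongr; linarith
    _ = 6 / 10 * P.ε * totalEnergy A := by field_simp; ring

lemma sum_energy_mul_unimportant_le :
    ∑ i, energy (col A i) * scaleLaw.real {z | Unimportant P A i z} ≤
      6 / 10 * P.ε * totalEnergy A := by
  obtain ⟨h1, h2⟩ := integral_sum_indicator (ν := scaleLaw)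
    (fun i => measurableSet_unimportant (P := P) (A := A) i) fun i => energy (col A i)
  rw [← h2]
  have h3 := integral_mono_ae h1 (integrable_const (6 / 10 * P.ε * totalEnergy A)) (by
    filter_upwards [ae_scaleLaw] with z hz
    exact sum_unimportant_le S hz)
  simpa using h3

/-- Take the first `j` with `mag ≤ x`. It is at most `L` since the column is not tiny. Also `x ≤ 2
mag`, by minimality, or for `j = 0` because `x ≤ M ≤ Mhat` and `z ≥ 1/2`. -/
lemma mem_goodCols_or (hz : z ∈ Set.Icc (1 / 2 : ℝ) 1)
    (hi : P.ε * totalEnergy A / n < energy (col A i)) :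
    i ∈ goodCols P A z ∨ Unimportant P A i z ∨ ∃ j, Irregular P A i j z := by
  classical
  have hε := S.ε_pos
  have hM := S.M_pos
  have hK := S.K_pos
  have hn := S.one_le_n
  have hn0 : (0 : ℝ) < n := by linarith
  have hMh := S.Mhat_pos
  set x := energy (col A i) with hx
  have hmL : mag P z P.L ≤ x := by
    refine le_trans ?_ hi.le
    have h1 := S.le_two_pow_L
    have h2 : P.K * n / P.ε * (P.ε * totalEnergy A / n) = P.K * totalEnergy A := by field_simp
    unfold mag
    rw [div_le_iff₀ (by positivity)]
    calc z * P.Mhat ≤ 1 * (P.K * totalEnergy A) :=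
          mul_le_mul hz.2 S.Mhat_le hMh.le zero_le_one
      _ = P.ε * totalEnergy A / n * (P.K * n / P.ε) := by rw [one_mul, ← h2, mul_comm]
      _ ≤ P.ε * totalEnergy A / n * 2 ^ P.L := by gcongr
  have hex : ∃ j, mag P z j ≤ x := ⟨_, hmL⟩
  set j := Nat.find hex with hj
  have hjL : j ≤ P.L := Nat.find_min' hex hmL
  have hlo : mag P z j ≤ x := Nat.find_spec hex
  have hhi : x ≤ 2 * mag P z j := by
    rcases Nat.eq_zero_or_pos j with h0 | hpos
    · rw [h0]
      have h1 : x ≤ totalEnergy A := Finset.single_le_sum (f := fun i => energy (col A i))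
        (fun _ _ => energy_nonneg _) (Finset.mem_univ i)
      have h2 := S.le_Mhat
      unfold mag
      rw [pow_zero, div_one]
      nlinarith [hz.1]
    · have h1 := Nat.find_min hex (m := j - 1) (by omega)
      have h2 : mag P z (j - 1) = 2 * mag P z j := by
        unfold mag
        obtain ⟨m, hm⟩ : ∃ m, j = m + 1 := ⟨j - 1, by omega⟩
        rw [hm, Nat.add_sub_cancel, pow_succ]
        field_simp
      rw [← h2]
      exact (not_le.mp h1).le
  by_cases hin : i ∈ inner P A z j
  · by_cases hs : P.ε / (2 * P.L) * totalEnergy A ≤ ∑ k ∈ outer P A z j, energy (col A k)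
    · by_cases hc : (1 - P.ε) * (outer P A z j).card ≤ (inner P A z j).card
      · exact Or.inl (mem_goodCols.mpr ⟨⟨j, by omega⟩, hin, hs, hc⟩)
      · exact Or.inr (Or.inr ⟨j, hlo, hhi, fun _ => ⟨hs, not_le.mp hc⟩⟩)
    · exact Or.inr (Or.inl ⟨⟨j, by omega⟩, inner_subset_outer S hz j hin, not_le.mp hs⟩)
  · exact Or.inr (Or.inr ⟨j, hlo, hhi, fun h => absurd h hin⟩)

lemma scaleLaw_real_notMem_goodCols_le (hi : P.ε * totalEnergy A / n < energy (col A i)) :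
    scaleLaw.real {z | i ∉ goodCols P A z} ≤
      scaleLaw.real {z | Unimportant P A i z} + 15 / 1000 := by
  have hε := S.ε_pos
  have hM := S.M_pos
  have hn := S.one_le_n
  refine (scaleLaw_real_mono (C := {z | Unimportant P A i z} ∪ {z | ∃ j, Irregular P A i j z})
    fun z hz h => (mem_goodCols_or S hz hi).resolve_left h).trans
    ((measureReal_union_le _ _).trans (add_le_add le_rfl (scaleLaw_real_exists_irregular_le S ?_)))
  exact lt_of_le_of_lt (by positivity) hi

lemma sum_tiny_le :
    ∑ i with ¬ P.ε * totalEnergy A / n < energy (col A i), energy (col A i) ≤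
      P.ε * totalEnergy A := by
  have hε := S.ε_pos
  have hM := S.M_pos
  have hn := S.one_le_n
  have hn0 : (0 : ℝ) < n := by linarith
  refine (Finset.sum_le_card_nsmul _ _ (P.ε * totalEnergy A / n) fun i hi =>
    not_lt.mp (Finset.mem_filter.mp hi).2).trans ?_
  rw [nsmul_eq_mul]
  have hc : ((Finset.univ.filter fun i : Fin n =>
      ¬ P.ε * totalEnergy A / n < energy (col A i)).card : ℝ) ≤ n := by
    have := Finset.card_filter_le (Finset.univ : Finset (Fin n)) fun i =>
      ¬ P.ε * totalEnergy A / n < energy (col A i)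
    rw [Finset.card_univ, Fintype.card_fin] at this
    exact_mod_cast this
  refine (mul_le_mul_of_nonneg_right hc (by positivity)).trans (le_of_eq ?_)
  field_simp

/-- For most scales, at least half of the energy lies in good columns. -/
lemma le_scaleLaw_real_goodCols : 95 / 100 ≤
    scaleLaw.real {z | totalEnergy A / 2 ≤ ∑ i ∈ goodCols P A z, energy (col A i)} := by
  classical
  have hε := S.ε_pos
  have hε1 := S.ε_le
  have hM := S.M_pos
  obtain ⟨h1, h2⟩ := integral_sum_indicator (ν := scaleLaw)
    (fun i => (measurableSet_mem_goodCols (P := P) (A := A) i).compl) fun i => energy (col A i)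
  have h3 : ∑ i, energy (col A i) * scaleLaw.real {z | i ∈ goodCols P A z}ᶜ ≤
      2 / 100 * totalEnergy A := by
    have h4 : ∀ i, energy (col A i) * scaleLaw.real {z | i ∈ goodCols P A z}ᶜ ≤
        (if ¬ P.ε * totalEnergy A / n < energy (col A i) then energy (col A i) else 0) +
          (energy (col A i) * scaleLaw.real {z | Unimportant P A i z} +
            15 / 1000 * energy (col A i)) := by
      intro i
      have he := energy_nonneg (col A i)
      split_ifs with hi
      · have := scaleLaw_real_notMem_goodCols_le S hi
        have := mul_le_mul_of_nonneg_left this he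
        calc _ ≤ _ := this
          _ = _ := by ring
      · have h5 := measureReal_nonneg (μ := scaleLaw) (s := {z | Unimportant P A i z})
        have h6 : energy (col A i) * scaleLaw.real {z | i ∈ goodCols P A z}ᶜ ≤
            energy (col A i) * 1 := mul_le_mul_of_nonneg_left measureReal_le_one he
        have := mul_nonneg he h5
        linarith
    refine (Finset.sum_le_sum fun i _ => h4 i).trans ?_
    rw [Finset.sum_add_distrib, Finset.sum_add_distrib, ← Finset.sum_filter, ← Finset.mul_sum]
    have h7 := sum_tiny_le S
    have h8 := sum_energy_mul_unimportant_le S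
    have h9 : ∑ i, energy (col A i) = totalEnergy A := rfl
    rw [h9]
    nlinarith
  -- Markov's inequality: the expected energy outside the good columns is at most `2/100 M`, so it
  -- reaches `M/2` with probability at most `4/100`.
  have hm := mul_meas_ge_le_integral_of_nonneg (ae_of_all _ fun z => Finset.sum_nonneg fun i _ =>
    Set.indicator_nonneg (fun _ _ => energy_nonneg (col A i)) z) h1 (totalEnergy A / 2)
  rw [h2] at hm
  have h10 : 1 ≤ scaleLaw.real {z | totalEnergy A / 2 ≤ ∑ i ∈ goodCols P A z, energy (col A i)} +
      scaleLaw.real {z | totalEnergy A / 2 ≤ ∑ i, ({z | i ∈ goodCols P A z}ᶜ).indicator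
        (fun _ => energy (col A i)) z} := by
    rw [← probReal_univ (μ := scaleLaw)]
    refine (measureReal_mono (fun z _ => ?_) (measure_ne_top _ _)).trans (measureReal_union_le _ _)
    by_contra hcon
    simp only [Set.mem_union, Set.mem_ofPred_eq, not_or, not_le] at hcon
    have h11 : ∑ i, ({z | i ∈ goodCols P A z}ᶜ).indicator (fun _ => energy (col A i)) z =
        ∑ i with i ∉ goodCols P A z, energy (col A i) := by
      simp only [Set.indicator_apply, Set.mem_compl_iff, Set.mem_ofPred_eq]
      rw [Finset.sum_filter]
    have h12 := Finset.sum_filter_add_sum_filter_not Finset.univ (fun i => i ∈ goodCols P A z)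
      fun i => energy (col A i)
    rw [Finset.filter_univ_mem] at h12
    have h9 : ∑ i, energy (col A i) = totalEnergy A := rfl
    rw [h11] at hcon
    linarith [hcon.1, hcon.2]
  nlinarith

/-- The columns that are good for at least half of the scales carry almost all the energy. -/
lemma exists_frequently_good : ∃ I : Finset (Fin n),
    (1 - 6 * P.ε) * totalEnergy A ≤ ∑ i ∈ I, energy (col A i) ∧
      ∀ i ∈ I, 1 / 2 ≤ scaleLaw.real {z | i ∈ goodCols P A z} := by
  classical
  have hε := S.ε_pos
  have hM := S.M_pos
  refine ⟨Finset.univ.filter fun i => 1 / 2 ≤ scaleLaw.real {z | i ∈ goodCols P A z}, ?_,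
    fun i hi => (Finset.mem_filter.mp hi).2⟩
  have h12 := Finset.sum_filter_add_sum_filter_not Finset.univ
    (fun i => 1 / 2 ≤ scaleLaw.real {z | i ∈ goodCols P A z}) fun i => energy (col A i)
  have h9 : ∑ i, energy (col A i) = totalEnergy A := rfl
  rw [h9] at h12
  -- A column that is not tiny and fails for more than half of the scales is unimportant with
  -- probability at least `1/2 - 15/1000 ≥ 1/3`, whence the factor `3`. The total loss is at most `ε
  -- + 3 · 0.6 ε` times `M`.
  have h4 : ∀ i, (if ¬ 1 / 2 ≤ scaleLaw.real {z | i ∈ goodCols P A z} then energy (col A i) else 0) ≤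
      (if ¬ P.ε * totalEnergy A / n < energy (col A i) then energy (col A i) else 0) +
        3 * (energy (col A i) * scaleLaw.real {z | Unimportant P A i z}) := by
    intro i
    have he := energy_nonneg (col A i)
    have h5 := measureReal_nonneg (μ := scaleLaw) (s := {z | Unimportant P A i z})
    have h6 := mul_nonneg he h5
    by_cases h1 : 1 / 2 ≤ scaleLaw.real {z | i ∈ goodCols P A z}
    · rw [if_neg (not_not.mpr h1)]
      split_ifs <;> linarith
    · rw [if_pos h1]
      by_cases hi : P.ε * totalEnergy A / n < energy (col A i)
      · rw [if_neg (not_not.mpr hi)]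
        have h7 := scaleLaw_real_notMem_goodCols_le S hi
        have h8 : scaleLaw.real {z | i ∉ goodCols P A z} =
            1 - scaleLaw.real {z | i ∈ goodCols P A z} :=
          probReal_compl_eq_one_sub (measurableSet_mem_goodCols i)
        have h10 : 1 / 3 ≤ scaleLaw.real {z | Unimportant P A i z} := by linarith
        nlinarith
      · rw [if_pos hi]
        linarith
  have h13 := Finset.sum_le_sum fun i (_ : i ∈ Finset.univ) => h4 i
  rw [Finset.sum_add_distrib, ← Finset.sum_filter, ← Finset.sum_filter, ← Finset.mul_sum] at h13
  have h7 := sum_tiny_le S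
  have h8 := sum_energy_mul_unimportant_le S
  nlinarith

end GoodColumns

/-! ### Integration over the scale -/

section Scale

variable {n : ℕ} {P : Params n} {A : Matrix (Fin n) (Fin n) ℝ}

lemma usedLevel_congr {s s' : Seed P} {j : ℕ} (h : ∀ l, s.band A l j = s'.band A l j) :
    s.usedLevel A j = s'.usedLevel A j := by
  have e : s.InRange A j = s'.InRange A j := funext fun l => by simp only [Seed.InRange, h]
  unfold Seed.usedLevel
  -- The nonemptiness proof inside `usedLevel` depends on the predicate, which is therefore replaced
  -- as a whole.
  generalize s.InRange A j = p at e ⊢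
  subst e
  rfl

/-- The bands of a seed, as a function of the scale. -/
def bandSets (A : Matrix (Fin n) (Fin n) ℝ) (s : Seed P) (z : ℝ) :
    Fin (P.Lhat + 1) → Fin (P.L + 1) → Finset (Fin n) := fun l j => (s.withScale z).band A l j

lemma measurableSet_bandSets (s : Seed P) (v) : MeasurableSet {z | bandSets A s z = v} := by
  have e : {z | bandSets A s z = v} =
      ⋂ l : Fin (P.Lhat + 1), ⋂ j : Fin (P.L + 1), {z | (s.withScale z).band A l j = v l j} := by
    ext z
    simp only [bandSets, funext_iff, Set.mem_ofPred_eq, Set.mem_iInter]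
  rw [e]
  refine MeasurableSet.iInter fun l => MeasurableSet.iInter fun j =>
    measurableSet_finset_eq (fun k => ?_) _
  have e2 : {z | k ∈ (s.withScale z).band A l j} = {z | k ∈ s.heavy A l ∧
      ((1 + P.ε) * mag P z j ≤ s.est A l k ∧ s.est A l k ≤ (2 - P.ε) * mag P z j)} := by
    ext z
    exact mem_band_iff
  rw [e2]
  exact (MeasurableSet.const _).inter
    ((measurableSet_le ((measurable_mag _).const_mul _) measurable_const).inter
      (measurableSet_le measurable_const ((measurable_mag _).const_mul _)))

lemma levelQuery_congr {s : Seed P} {z z' : ℝ} (h : bandSets A s z = bandSets A s z')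
    (j : Fin (P.L + 1)) (i : Fin n) :
    (s.withScale z).levelQuery A j i = (s.withScale z').levelQuery A j i := by
  have hu : (s.withScale z).usedLevel A j = (s.withScale z').usedLevel A j :=
    usedLevel_congr fun l => congrFun (congrFun h l) j
  unfold Seed.levelQuery
  rw [hu]
  rfl

lemma drawProb_congr {s : Seed P} {z z' : ℝ} (h : bandSets A s z = bandSets A s z')
    (j : Fin (P.L + 1)) (i : Fin n) :
    (s.withScale z).drawProb A j i = (s.withScale z').drawProb A j i := by
  have hb : ∀ (l) (j : Fin (P.L + 1)), (s.withScale z).band A l j = (s.withScale z').band A l j :=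
    fun l j => congrFun (congrFun h l) j
  have hu : ∀ j : Fin (P.L + 1), (s.withScale z).usedLevel A j = (s.withScale z').usedLevel A j :=
    fun j => usedLevel_congr fun l => hb l j
  have he : ∀ l i, (s.withScale z).est A l i = (s.withScale z').est A l i := fun _ _ => rfl
  unfold Seed.drawProb Seed.recovered Seed.mTilde Seed.levelEst
  simp only [hu, hb, he]

lemma accDraw_congr {η : ℝ} {s : Seed P} {z z' : ℝ} (h : bandSets A s z = bandSets A s z')
    (j : Fin (P.L + 1)) (i : Fin n) :
    accDraw A η (s.withScale z) j i = accDraw A η (s.withScale z') j i := by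
  unfold accDraw
  rw [levelQuery_congr h, drawProb_congr h]

/-- Estimates do not involve the scale, so the scale acts only through the bands, which take
finitely many values on measurable sets. -/
lemma measurable_accDraw (η : ℝ) (s : Seed P) (j : Fin (P.L + 1)) (i : Fin n) :
    Measurable fun z => accDraw A η (s.withScale z) j i := by
  obtain ⟨e, he⟩ := (Function.factorsThrough_iff (f := bandSets A s)
    fun z => accDraw A η (s.withScale z) j i).mp fun z z' h => accDraw_congr h j i
  rw [he]
  exact measurable_comp_of_finite (measurableSet_bandSets s) e

/-- The returned vector is accurate. -/
def Accurate (A : Matrix (Fin n) (Fin n) ℝ) (η : ℝ) (s : Seed P) (j : Fin (P.L + 1))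
    (i : Fin n) : Prop :=
  (1 - η) * energy (col A i) ≤ energy (s.levelQuery A j i) ∧
    energy (s.levelQuery A j i) ≤ (1 + η) * energy (col A i)

lemma measurableSet_accurate (η : ℝ) (s : Seed P) (j : Fin (P.L + 1)) (i : Fin n) :
    MeasurableSet {z | Accurate A η (s.withScale z) j i} := by
  obtain ⟨e, he⟩ := (Function.factorsThrough_iff (f := bandSets A s)
    fun z => Accurate A η (s.withScale z) j i).mp fun z z' h => by
      simp only [Accurate, levelQuery_congr h]
  have h2 : {z | Accurate A η (s.withScale z) j i} = {z | e (bandSets A s z)} := by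
    ext z
    exact iff_of_eq (congrFun he z)
  rw [h2]
  exact measurableSet_of_finite (measurableSet_bandSets s) e

lemma accDraw_le_one (η : ℝ) (s : Seed P) (j : Fin (P.L + 1)) (i : Fin n) :
    accDraw A η s j i ≤ 1 := by
  have h1 : s.drawProb A j i ≤ 1 := by
    refine (Finset.single_le_sum (f := fun i => s.drawProb A j i)
      (fun i _ => drawProb_nonneg s j i) (Finset.mem_univ i)).trans ?_
    rw [sum_drawProb]
    exact div_le_one_of_le₀ (Finset.single_le_sum (f := fun j : Fin (P.L + 1) => s.mTilde A j)
      (fun j _ => mTilde_nonneg s j) (Finset.mem_univ j))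
      (Finset.sum_nonneg fun j _ => mTilde_nonneg s _)
  unfold accDraw
  split_ifs
  exacts [h1, zero_le_one]

variable {Ω : Type*} [m0 : MeasurableSpace Ω] {μ : Measure Ω} [IsProbabilityMeasure μ]
  {seed : Ω → Seed P} {draw : Ω → Option (Fin (P.L + 1) × Fin n)} (H : IsRun P A μ seed draw)

/-- The seed with given tables and scale `0`. -/
def ofTables (v : (Fin (P.Lhat + 1) → Fin n → Bool) ×
    (((l : Fin (P.Lhat + 1)) → Fin P.R → Fin n → Fin (P.w l)) ×
      (Fin (P.Lhat + 1) → Fin P.R → Fin n → ℤˣ))) : Seed P := ⟨0, v.1, v.2.1, v.2.2⟩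

lemma measurable_scale {Sc : Set (Component P)} (h : Component.scale ∈ Sc) :
    Measurable[compSigma seed Sc] fun ω => (seed ω).ζ := by
  refine Measurable.mono (measurable_iff_comap_le.mpr le_rfl) (sigma_le_compSigma h) ?_
  rw [BorelSpace.measurable_eq (α := ℝ)]

/-- Split over the finitely many values of the tables; on each piece only the scale varies. -/
lemma measurableSet_seed (Q : Seed P → Prop)
    (hQ : ∀ s : Seed P, MeasurableSet {z | Q (s.withScale z)}) :
    MeasurableSet[compSigma seed Set.univ] {ω | Q (seed ω)} := by
  have e : {ω | Q (seed ω)} = ⋃ v, {ω | (seed ω).tables = v} ∩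
      (fun ω => (seed ω).ζ) ⁻¹' {z | Q ((ofTables v).withScale z)} := by
    ext ω
    simp only [Set.mem_iUnion, Set.mem_inter_iff, Set.mem_ofPred_eq, Set.mem_preimage,
      exists_eq_left']
    rfl
  rw [e]
  exact MeasurableSet.iUnion fun v =>
    (measurableSet_seed_tables (Set.subset_univ _) (Set.subset_univ _) v).inter
      (measurable_scale (Set.mem_univ _) (hQ _))

lemma measurable_comp_seed {F : Seed P → ℝ}
    (hF : ∀ s : Seed P, Measurable fun z => F (s.withScale z)) :
    Measurable[compSigma seed Set.univ] fun ω => F (seed ω) :=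
  fun B hB => measurableSet_seed (fun s => F s ∈ B) fun s => hF s hB

include H

lemma IsRun.map_scale : μ.map (fun ω => (seed ω).ζ) = scaleLaw := H.scale_uniform

lemma IsRun.integrable_seed {F : Seed P → ℝ}
    (hF : ∀ s : Seed P, Measurable fun z => F (s.withScale z)) {C : ℝ} (hC : ∀ s, |F s| ≤ C) :
    Integrable (fun ω => F (seed ω)) μ :=
  Integrable.of_bound
    ((measurable_comp_seed hF).mono (H.compSigma_le _) le_rfl).aestronglyMeasurable C (ae_of_all _ fun _ => hC _)

/-- The scale is independent of the rest of the seed. -/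
lemma IsRun.integral_seed {F : Seed P → ℝ}
    (hF : ∀ s : Seed P, Measurable fun z => F (s.withScale z)) {C : ℝ} (hC : ∀ s, |F s| ≤ C) :
    Integrable (fun z => ∫ ω, F ((seed ω).withScale z) ∂μ) scaleLaw ∧
    ∫ ω, F (seed ω) ∂μ = ∫ z, ∫ ω, F ((seed ω).withScale z) ∂μ ∂scaleLaw := by
  have hζ : Measurable fun ω => (seed ω).ζ :=
    (measurable_scale (Set.mem_univ _)).mono (H.compSigma_le _) le_rfl
  have hX : ∀ v, MeasurableSet[compSigma seed (columnComps P ∪ tableComps P)]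
      {ω | (seed ω).tables = v} :=
    measurableSet_seed_tables Set.subset_union_left Set.subset_union_right
  have hdis : Disjoint (columnComps P ∪ tableComps P) {Component.scale} := by
    rw [Set.disjoint_singleton_right]
    rintro (⟨i, h⟩ | ⟨l, r, h⟩ | ⟨l, r, h⟩) <;> cases h
  have hint : ∀ v, Integrable (fun z => F ((ofTables v).withScale z)) scaleLaw := fun v =>
    Integrable.of_bound (hF _).aestronglyMeasurable C (ae_of_all _ fun z => hC _)
  have hz : ∀ z, ∫ ω, F ((seed ω).withScale z) ∂μ =
      ∑ v, μ.real {ω | (seed ω).tables = v} * F ((ofTables v).withScale z) := fun z =>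
    integral_comp_of_finite (X := fun ω => (seed ω).tables)
      (fun v => H.compSigma_le _ _ (hX v)) fun v => F ((ofTables v).withScale z)
  simp_rw [hz]
  refine ⟨integrable_finsetSum _ fun v _ => (hint v).const_mul _, ?_⟩
  rw [integral_finsetSum _ fun v _ => (hint v).const_mul _]
  have h1 := integral_eq_sum_of_indep (H.compSigma_le _) (H.compSigma_le _)
    (H.indep_compSigma hdis) hX (G := fun v ω => F ((ofTables v).withScale (seed ω).ζ))
    (fun v => (hF _).comp (measurable_scale (Set.mem_singleton _)))
    (fun v => Integrable.of_bound ((hF _).comp hζ).aestronglyMeasurable C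
      (ae_of_all _ fun ω => hC _))
  refine h1.trans (Finset.sum_congr rfl fun v _ => ?_)
  rw [integral_const_mul, ← H.map_scale, integral_map hζ.aemeasurable
    (hF (ofTables v)).aestronglyMeasurable]

/-- Accuracy is determined by the seed, so the conditional law of the draw may be integrated over
that event. -/
lemma IsRun.measure_draw_and_accurate (η : ℝ) (j : Fin (P.L + 1)) (i : Fin n) :
    μ.real {ω | draw ω = some (j, i) ∧ Accurate A η (seed ω) j i} =
      ∫ ω, accDraw A η (seed ω) j i ∂μ := by
  have hm : (⨆ k, Component.sigma seed k) ≤ m0 := iSup_le H.measurable_seed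
  have hacc : MeasurableSet[⨆ k, Component.sigma seed k] {ω | Accurate A η (seed ω) j i} := by
    have := measurableSet_seed (seed := seed) (fun s => Accurate A η s j i)
      fun s => measurableSet_accurate η s j i
    rwa [compSigma, iSup_univ] at this
  have hd := H.measurable_draw (some (j, i))
  have h1 := setIntegral_condExp hm ((integrable_const (1 : ℝ)).indicator hd) (μ := μ) hacc
  rw [setIntegral_congr_ae (hm _ hacc) ((H.draw_law j i).mono fun ω hω _ => hω),
    ← integral_indicator (hm _ hacc), setIntegral_indicator hd, setIntegral_const, smul_eq_mul,
    mul_one] at h1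
  rw [Set.inter_comm] at h1
  refine h1.symm.trans (integral_congr_ae (ae_of_all _ fun ω => ?_))
  simp only [Set.indicator_apply, Set.mem_ofPred_eq, accDraw, Accurate]

lemma IsRun.measurableSet_draw_and_accurate (η : ℝ) (j : Fin (P.L + 1)) (i : Fin n) :
    MeasurableSet {ω | draw ω = some (j, i) ∧ Accurate A η (seed ω) j i} :=
  (H.measurable_draw _).inter (H.compSigma_le _ _ (measurableSet_seed
    (fun s => Accurate A η s j i) fun s => measurableSet_accurate η s j i))

lemma IsRun.measure_samples (η : ℝ) (i : Fin n) :
    μ.real {ω | Samples A (seed ω) (draw ω) η i} = ∫ ω, ∑ j, accDraw A η (seed ω) j i ∂μ := by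
  rw [integral_finsetSum _ fun j _ => H.integrable_seed (fun s => measurable_accDraw η s j i)
    (C := 1) fun s => abs_le.mpr ⟨by linarith [accDraw_nonneg (A := A) η s j i],
      accDraw_le_one η s j i⟩]
  simp_rw [← H.measure_draw_and_accurate]
  rw [← measureReal_biUnion_finset _ fun j _ => H.measurableSet_draw_and_accurate η j i]
  · congr 1
    ext ω
    simp [Samples, Accurate]
  · intro j _ j' _ h
    refine Set.disjoint_left.mpr fun ω h1 h2 => h ?_
    have := h1.1.symm.trans h2.1
    simpa using this

lemma IsRun.measure_exists_samples (η : ℝ) :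
    μ.real {ω | ∃ u, Samples A (seed ω) (draw ω) η u} =
      ∫ ω, ∑ j, ∑ i, accDraw A η (seed ω) j i ∂μ := by
  have hint : ∀ j i, Integrable (fun ω => accDraw A η (seed ω) j i) μ := fun j i =>
    H.integrable_seed (fun s => measurable_accDraw η s j i)
    (C := 1) fun s => abs_le.mpr ⟨by linarith [accDraw_nonneg (A := A) η s j i],
      accDraw_le_one η s j i⟩
  rw [integral_finsetSum _ fun j _ => integrable_finsetSum _ fun i _ => hint j i]
  simp_rw [integral_finsetSum _ fun i _ => hint _ i, ← H.measure_draw_and_accurate]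
  rw [← Fintype.sum_prod_type' fun j i =>
    μ.real {ω | draw ω = some (j, i) ∧ Accurate A η (seed ω) j i}]
  rw [← measureReal_biUnion_finset _ fun p _ => H.measurableSet_draw_and_accurate η p.1 p.2]
  · congr 1
    ext ω
    simp only [Samples, Accurate, Set.mem_ofPred_eq, Set.mem_iUnion, Finset.mem_univ,
      exists_prop, true_and, Prod.exists]
    exact exists_comm
  · intro p _ p' _ h
    refine Set.disjoint_left.mpr fun ω h1 h2 => h ?_
    have := h1.1.symm.trans h2.1
    simpa using this

variable (S : Setting P A)
include S

lemma IsRun.le_measure_exists_samples :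
    0.9 ≤ μ.real {ω | ∃ u, Samples A (seed ω) (draw ω) P.ε u} := by
  have h0 : ∀ s : Seed P, 0 ≤ ∑ j, ∑ i, accDraw A P.ε s j i := fun s =>
    Finset.sum_nonneg fun j _ => Finset.sum_nonneg fun i _ => accDraw_nonneg _ s j i
  have hF : ∀ s : Seed P, Measurable fun z => ∑ j, ∑ i, accDraw A P.ε (s.withScale z) j i :=
    fun s => Finset.measurable_fun_sum _ fun j _ => Finset.measurable_fun_sum _ fun i _ =>
      measurable_accDraw P.ε s j i
  obtain ⟨h1, h2⟩ := H.integral_seed (F := fun s => ∑ j, ∑ i, accDraw A P.ε s j i) hF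
    (C := ∑ _j : Fin (P.L + 1), ∑ _i : Fin n, (1 : ℝ)) fun s => by
      rw [abs_of_nonneg (h0 s)]
      exact Finset.sum_le_sum fun j _ => Finset.sum_le_sum fun i _ => accDraw_le_one _ s j i
  rw [H.measure_exists_samples, h2]
  have h3 := mul_meas_ge_le_integral_of_nonneg
    (ae_of_all _ fun z => integral_nonneg fun ω => h0 ((seed ω).withScale z)) h1 (95 / 100)
  -- Good scales have probability `0.95` and for each of them the sampler succeeds with probability
  -- `0.95`; the product exceeds `0.9`.
  have h4 := (le_scaleLaw_real_goodCols S).trans (scaleLaw_real_mono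
    (C := {z | 95 / 100 ≤ ∫ ω, ∑ j, ∑ i, accDraw A P.ε ((seed ω).withScale z) j i ∂μ})
    fun z hz h => H.le_integral_sum_accDraw S hz h)
  refine le_trans ?_ h3
  nlinarith

lemma IsRun.le_measure_samples {i : Fin n}
    (hi : 1 / 2 ≤ scaleLaw.real {z | i ∈ goodCols P A z}) :
    1 / 144 * energy (col A i) / totalEnergy A ≤
      μ.real {ω | Samples A (seed ω) (draw ω) P.ε i} := by
  have hM := S.M_pos
  have he := energy_nonneg (col A i)
  have h0 : ∀ s : Seed P, 0 ≤ ∑ j, accDraw A P.ε s j i := fun s =>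
    Finset.sum_nonneg fun j _ => accDraw_nonneg _ s j i
  have hF : ∀ s : Seed P, Measurable fun z => ∑ j, accDraw A P.ε (s.withScale z) j i :=
    fun s => Finset.measurable_fun_sum _ fun j _ => measurable_accDraw P.ε s j i
  obtain ⟨h1, h2⟩ := H.integral_seed (F := fun s => ∑ j, accDraw A P.ε s j i) hF
    (C := ∑ _j : Fin (P.L + 1), (1 : ℝ)) fun s => by
      rw [abs_of_nonneg (h0 s)]
      exact Finset.sum_le_sum fun j _ => accDraw_le_one _ s j i
  rw [H.measure_samples, h2]
  have h3 := mul_meas_ge_le_integral_of_nonneg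
    (ae_of_all _ fun z => integral_nonneg fun ω => h0 ((seed ω).withScale z)) h1
    (energy (col A i) / (72 * totalEnergy A))
  have h4 := hi.trans (scaleLaw_real_mono
    (C := {z | energy (col A i) / (72 * totalEnergy A) ≤
      ∫ ω, ∑ j, accDraw A P.ε ((seed ω).withScale z) j i ∂μ})
    fun z hz h => H.le_integral_sum_accDraw_of_mem S hz h)
  refine le_trans (le_trans (le_of_eq ?_) (mul_le_mul_of_nonneg_left h4 (by positivity))) h3
  field_simp
  ring

end Scale

/-! ### The choice of the absolute constants -/

lemma totalEnergy_pos {n : ℕ} {A : Matrix (Fin n) (Fin n) ℝ} (hA : A ≠ 0) : 0 < totalEnergy A := by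
  obtain ⟨k, i, hki⟩ : ∃ k i, A k i ≠ 0 := by
    by_contra! h
    exact hA (Matrix.ext h)
  refine Finset.sum_pos' (fun _ _ => energy_nonneg _) ⟨i, Finset.mem_univ _, ?_⟩
  exact Finset.sum_pos' (fun _ _ => sq_nonneg _)
    ⟨k, Finset.mem_univ _, pow_pos (f_pos hki) 2⟩

/-- The bound `ε ≤ 2^(-10^5)` serves to make `L` large: `L ≥ log₂ (K n / ε) ≥ log₂ (1/ε) ≥ 10^5`. -/
lemma Setting.of_le {n : ℕ} {A : Matrix (Fin n) (Fin n) ℝ} {K ε Mhat : ℝ} (hA : A ≠ 0)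
    (hε : 0 < ε) (hε1 : ε ≤ 1 / 10 ^ 6) (hε2 : ε ≤ (2 : ℝ) ^ (-(10 ^ 5 : ℝ))) (hK : 1 ≤ K)
    (hM1 : totalEnergy A ≤ Mhat) (hM2 : Mhat ≤ K * totalEnergy A) {P : Params n}
    (hP : P = { K := K, ε := ε, Mhat := Mhat, cw := 10 ^ 24, cR := 1, cφ := 1, ν := 1,
                cList := 200 * K }) : Setting P A := by
  have hn : 0 < n := by
    rcases Nat.eq_zero_or_pos n with rfl | h
    · exact absurd (Subsingleton.elim A 0) hA
    · exact h
  subst hP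
  refine ⟨hn, hK, hε, hε1, ?_, totalEnergy_pos hA, hM1, hM2, rfl, rfl, rfl, rfl, rfl⟩
  refine le_trans ?_ (Nat.le_ceil _)
  have hn1 : (1 : ℝ) ≤ n := by exact_mod_cast hn
  have h1 : (2 : ℝ) ^ (10 ^ 5 : ℝ) ≤ 1 / ε := by
    rw [Real.rpow_neg two_pos.le] at hε2
    rw [one_div]
    exact (le_inv_comm₀ hε (Real.rpow_pos_of_pos two_pos _)).mp hε2
  have h2 : 1 / ε ≤ K * n / ε := by
    gcongr
    nlinarith
  rw [Real.le_logb_iff_rpow_le (by norm_num) (by positivity)]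
  exact h1.trans h2

end HSketch

end

theorem mainTheorem2 :
    ∃ ε₀ c C cw cR cφ ν : ℝ, 0 < ε₀ ∧ 0 < c ∧ c ≤ 1 / 2 ∧ 0 < C ∧
      0 < cw ∧ 0 < cR ∧ 0 < cφ ∧ 0 < ν ∧
      ∀ K : ℝ, 1 ≤ K → ∃ cList : ℝ, 0 < cList ∧
        ∀ (n : ℕ) (A : Matrix (Fin n) (Fin n) ℝ) (ε Mhat : ℝ), A ≠ 0 → 0 < ε → ε ≤ ε₀ →
          HSketch.totalEnergy A ≤ Mhat → Mhat ≤ K * HSketch.totalEnergy A →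
          ∀ P : HSketch.Params n,
            P = { K := K, ε := ε, Mhat := Mhat, cw := cw, cR := cR, cφ := cφ, ν := ν,
                  cList := cList } →
          ∀ (Ω : Type*) [MeasurableSpace Ω] (μ : Measure Ω) [IsProbabilityMeasure μ]
            (seed : Ω → HSketch.Seed P) (draw : Ω → Option (Fin (P.L + 1) × Fin n)),
            HSketch.IsRun P A μ seed draw →
              0.9 ≤ μ.real {ω | ∃ u, HSketch.Samples A (seed ω) (draw ω) (C * ε) u} ∧
              ∃ I : Finset (Fin n),
                (1 - 6 * ε) * HSketch.totalEnergy A ≤ ∑ i ∈ I, HSketch.energy (HSketch.col A i) ∧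
                ∀ i ∈ I, c * HSketch.energy (HSketch.col A i) / HSketch.totalEnergy A ≤
                  μ.real {ω | HSketch.Samples A (seed ω) (draw ω) (C * ε) i} := by
  -- The constant `1/144` is the `1/72` for a fixed good scale times the `1/2` for the proportion of
  -- good scales. The value `10^24` gives the noise thresholds their margin, and the list size must
  -- grow with `K` because of level `0`.
  refine ⟨min (1 / 10 ^ 6) ((2 : ℝ) ^ (-(10 ^ 5 : ℝ))), 1 / 144, 1, 10 ^ 24, 1, 1, 1,
    lt_min (by norm_num) (Real.rpow_pos_of_pos two_pos _), by norm_num, by norm_num, one_pos,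
    by norm_num, one_pos, one_pos, one_pos, fun K hK => ⟨200 * K, by linarith, ?_⟩⟩
  intro n A ε Mhat hA hε hε0 hM1 hM2 P hP Ω _ μ _ seed draw H
  have S := HSketch.Setting.of_le hA hε (hε0.trans (min_le_left _ _))
    (hε0.trans (min_le_right _ _)) hK hM1 hM2 hP
  obtain rfl : P.ε = ε := by rw [hP]
  obtain ⟨I, hI, hI2⟩ := HSketch.exists_frequently_good S
  rw [one_mul]
  exact ⟨H.le_measure_exists_samples S, I, hI, fun i hi => H.le_measure_samples S (hI2 i hi)⟩
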